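/- **Setting.** Let $\alpha_1,\dots,\alpha_6$ be the simple roots of $E_6$ (the Dynkin diagram is the chain $1-3-4-5-6$ with $2$ attached to $4$), $Q=\sum_i\mathbb Z\alpha_i$ the root lattice with its form $(\cdot,\cdot)$, and $\Phi=\{\alpha\in Q\mid(\alpha,\alpha)=2\}$. For $\alpha=\sum k_i\alpha_i$ and $\beta=\sum l_i\alpha_i$ put $$F(\alpha,\beta)=(-1)^{\sum_{i}k_il_i+k_1l_3+k_4l_2+k_3l_4+k_5l_4+k_6l_5}.$$ The simple Lie algebra of type $E_6$ is $\mathcal G=H\oplus\bigoplus_{\alpha\in\Phi}\mathbb CE_\alpha$, $H=\bigoplus_i\mathbb C\alpha_i$, with $[H,H]=0$, $[h,E_\alpha]=(h,\alpha)E_\alpha$, $[E_\alpha,E_{-\alpha}]=-\alpha$, and, for $\alpha+\beta\neq0$, $[E_\alpha,E_\beta]=F(\alpha,\beta)E_{\alpha+\beta}$ if $\alpha+\beta\in\Phi$ and $0$ otherwise. Let $\beta_1,\dots,\beta_{16}$ be the roots with coefficient $1$ at $\alpha_6$, and put $\xi_i=E_{\beta_i}$, $\eta_i=E_{-\beta_i}$,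 $\mathcal G_+=\sum\mathbb C\xi_i$, $\mathcal G_-=\sum\mathbb C\eta_i$. Let $\mathcal G^{D_5}$ be spanned by $\alpha_1,\dots,\alpha_5$ and the $E_\gamma$ for the roots $\gamma$ with coefficient $0$ at $\alpha_6$, and let $\mathcal G_0=\mathcal G^{D_5}\oplus\mathbb C\widehat\alpha$ with the central element $\widehat\alpha=2\alpha_1+3\alpha_2+4\alpha_3+6\alpha_4+5\alpha_5+4\alpha_6$. Then $\mathcal G=\mathcal G_-\oplus\mathcal G_0\oplus\mathcal G_+$. Let $o(10,\mathbb C)$ be the Lie algebra of the $10\times10$ matrices $\begin{pmatrix}A&B\\C&-A^{T}\end{pmatrix}$ with $5\times5$ blocks, $B$ and $C$ skew-symmetric, and let $\nu:o(10,\mathbb C)\to\mathcal G^{D_5}$ be the isomorphism that sends $E_{1,2}-E_{7,6}$, $E_{2,3}-E_{8,7}$, $E_{3,4}-E_{9,8}$, $E_{4,5}-E_{10,9}$, $E_{4,10}-E_{5,9}$ to $E_{\alpha_1},E_{\alpha_3},E_{\alpha_4},E_{\alpha_5},E_{\alpha_2}$ and their transposes to $-E_{-\alpha_1},-E_{-\alpha_3},-E_{-\alpha_4},-E_{-\alpha_5},-E_{-\alpha_2}$,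 respectively. Let $\varepsilon_1,\dots,\varepsilon_5$ be the basis dual to the $E_{i,i}-E_{5+i,5+i}$, and take $\varepsilon_i\pm\varepsilon_j$ $(i<j)$ as the positive roots of $o(10,\mathbb C)$. Let $\mathcal A=\mathbb C[x_1,\dots,x_{16}]$, on which $u\in\mathcal G_0$ acts as the vector field $u|_{\mathcal A}=\sum_{i,j}\varphi_{i,j}(u)x_j\partial_{x_i}$ with $[u,\eta_i]=\sum_j\varphi_{i,j}(u)\eta_j$. Let $M$ be an $o(10,\mathbb C)$-module and $c\in\mathbb C$. For $u\in\mathcal G_0$ let $\varrho(u)$ be the linear operator on $M$ that is given by the action of $\nu^{-1}(u)$ if $u\in\mathcal G^{D_5}$ and by $\varrho(\widehat\alpha)=2c$. Then $\widehat M=\mathcal A\otimes_{\mathbb C}M$ is a $\mathcal G$-module as follows: $$\xi_i(f\otimes v)=\partial_{x_i}(f)\otimes v,\qquad u(f\otimes v)=u|_{\mathcal A}(f)\otimes v+f\otimes\varrho(u)v\quad(u\in\mathcal G_0),$$ $$\eta_i(f\otimes v)=P_i(f)\otimes v+\sum_{r=1}^{16}x_rf\otimes\varrho([\xi_r,\eta_i])v,\qquad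 P_i=\frac12\sum_{r=1}^{16}x_r\,[\xi_r,\eta_i]|_{\mathcal A}.$$ **Corollary 6.6.** Let $k$ be a positive integer, let $V(k\varepsilon_1)$ be the finite-dimensional irreducible $o(10,\mathbb C)$-module with highest weight $k\varepsilon_1$, and let $c\in\mathbb C$. If $c\notin\{n-14-k\mid n=0,1,2,\dots\}$, then the $\mathcal G$-module $\widehat{V(k\varepsilon_1)}$ is irreducible. -/

import Mathlib

open scoped TensorProduct

noncomputable section

namespace XuE6

/-! ### The root lattice of type `E₆`

Elements are coordinate vectors with respect to the simple roots `α₁, …, α₆` (Bourbaki labelling: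
`1-3-4-5-6` is a chain and `2` is attached to `4`); `α_{i+1}` has index `i : Fin 6`. -/

/-- The symmetric bilinear form of the Dynkin diagram `E₆` in simple root coordinates. -/
def form {R : Type*} [CommRing R] (a b : Fin 6 → R) : R :=
  2 * (a 0 * b 0 + a 1 * b 1 + a 2 * b 2 + a 3 * b 3 + a 4 * b 4 + a 5 * b 5)
    - (a 0 * b 2 + a 2 * b 0) - (a 2 * b 3 + a 3 * b 2) - (a 1 * b 3 + a 3 * b 1)
    - (a 3 * b 4 + a 4 * b 3) - (a 4 * b 5 + a 5 * b 4)

/-- The exponent of the sign `F`. -/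
def cocycleExp (k l : Fin 6 → ℤ) : ℤ :=
  (k 0 * l 0 + k 1 * l 1 + k 2 * l 2 + k 3 * l 3 + k 4 * l 4 + k 5 * l 5)
    + k 0 * l 2 + k 3 * l 1 + k 2 * l 3 + k 4 * l 3 + k 5 * l 4

/-- The bimultiplicative sign `F : Q × Q → {1, -1}`. -/
def F (k l : Fin 6 → ℤ) : ℤ := ((cocycleExp k l).negOnePow : ℤˣ)

/-- The root system of type `E₆`: the vectors of square length two of the root lattice. -/
abbrev Root : Type := {a : Fin 6 → ℤ // form a a = 2}

theorem form_neg_neg (a b : Fin 6 → ℤ) : form (-a) (-b) = form a b := by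
  simp only [form, Pi.neg_apply]; ring

instance : Neg Root := ⟨fun a => ⟨-a.1, by rw [form_neg_neg, a.2]⟩⟩

/-! ### The simple Lie algebra of type `E₆` -/

/-- The underlying space `H ⊕ ⨁_α ℂ E_α` of the simple Lie algebra of type `E₆`, where
`H = ⨁ ℂ α_i`. -/
def E6 : Type := (Fin 6 → ℂ) × (Root →₀ ℂ)

namespace E6

instance : AddCommGroup E6 := inferInstanceAs (AddCommGroup ((Fin 6 → ℂ) × (Root →₀ ℂ)))
instance : Module ℂ E6 := inferInstanceAs (Module ℂ ((Fin 6 → ℂ) × (Root →₀ ℂ)))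

/-- The inclusion of the Cartan subalgebra `H`. -/
def ofH : (Fin 6 → ℂ) →ₗ[ℂ] E6 := LinearMap.inl ℂ (Fin 6 → ℂ) (Root →₀ ℂ)

/-- The component in `H`. -/
def hPart : E6 →ₗ[ℂ] (Fin 6 → ℂ) := LinearMap.fst ℂ (Fin 6 → ℂ) (Root →₀ ℂ)

/-- The component in the sum of the root spaces. -/
def ePart : E6 →ₗ[ℂ] (Root →₀ ℂ) := LinearMap.snd ℂ (Fin 6 → ℂ) (Root →₀ ℂ)

/-- The inclusion of the sum of the root spaces. -/
def ofE : (Root →₀ ℂ) →ₗ[ℂ] E6 := LinearMap.inr ℂ (Fin 6 → ℂ) (Root →₀ ℂ)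

/-- The root vector `E_α`. -/
def E (a : Root) : E6 := ofE (Finsupp.single a 1)

/-- An element of the root lattice as an element of `H`. -/
def latticeH (a : Fin 6 → ℤ) : Fin 6 → ℂ := fun i => (a i : ℂ)

/-- `E_a` if the lattice vector `a` is a root, and `0` otherwise. -/
def EOrZero (a : Fin 6 → ℤ) : E6 := if h : form a a = 2 then E ⟨a, h⟩ else 0

/-- The bracket of two root vectors: `[E_α, E_{-α}] = -α`, and otherwise
`[E_α, E_β] = F(α, β) E_{α+β}` if `α + β` is a root and `0` if not. -/
def rootBracket (a b : Root) : E6 :=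
  if a.1 + b.1 = 0 then -ofH (latticeH a.1) else (F a.1 b.1 : ℂ) • EOrZero (a.1 + b.1)

/-- The linear functional `h ↦ (h, α)` on `H`. -/
def pairing (a : Root) : (Fin 6 → ℂ) →ₗ[ℂ] ℂ where
  toFun h := form h (latticeH a.1)
  map_add' x y := by simp only [form, Pi.add_apply]; ring
  map_smul' r x := by simp only [form, Pi.smul_apply, smul_eq_mul, RingHom.id_apply]; ring

/-- The bilinear extension of `(h, E_α) ↦ (h, α) E_α`. -/
def bracketHE : (Fin 6 → ℂ) →ₗ[ℂ] (Root →₀ ℂ) →ₗ[ℂ] E6 :=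
  (Finsupp.linearCombination ℂ fun a : Root => (pairing a).smulRight (E a)).flip

/-- The bilinear extension of `(E_α, E_β) ↦ [E_α, E_β]`. -/
def bracketEE : (Root →₀ ℂ) →ₗ[ℂ] (Root →₀ ℂ) →ₗ[ℂ] E6 :=
  Finsupp.linearCombination ℂ fun a : Root =>
    Finsupp.linearCombination ℂ fun b : Root => rootBracket a b

/-- The bracket of the Lie algebra of type `E₆`, as a bilinear map. -/
def bracketMap : E6 →ₗ[ℂ] E6 →ₗ[ℂ] E6 :=
  bracketEE.compl₁₂ ePart ePart + bracketHE.compl₁₂ hPart ePart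
    - (bracketHE.compl₁₂ hPart ePart).flip

theorem bracketMap_apply (x y : E6) : bracketMap x y =
    bracketEE (ePart x) (ePart y) + bracketHE (hPart x) (ePart y) - bracketHE (hPart y) (ePart x) :=
  rfl

theorem hPart_ofH (h : Fin 6 → ℂ) : hPart (ofH h) = h := rfl

theorem ePart_ofH (h : Fin 6 → ℂ) : ePart (ofH h) = 0 := rfl

theorem hPart_E (a : Root) : hPart (E a) = 0 := rfl

theorem ePart_E (a : Root) : ePart (E a) = Finsupp.single a 1 := rfl

theorem bracketHE_single (h : Fin 6 → ℂ) (a : Root) :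
    bracketHE h (Finsupp.single a 1) = form h (latticeH a.1) • E a := by
  simp [bracketHE, pairing]

theorem bracketMap_H_H (h h' : Fin 6 → ℂ) : bracketMap (ofH h) (ofH h') = 0 := by
  simp [bracketMap_apply, ePart_ofH]

theorem bracketMap_H_E (h : Fin 6 → ℂ) (a : Root) :
    bracketMap (ofH h) (E a) = form h (latticeH a.1) • E a := by
  simp [bracketMap_apply, ePart_ofH, hPart_ofH, hPart_E, ePart_E, bracketHE_single]

theorem bracketMap_E_H (h : Fin 6 → ℂ) (a : Root) :
    bracketMap (E a) (ofH h) = -(form h (latticeH a.1) • E a) := by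
  simp [bracketMap_apply, ePart_ofH, hPart_ofH, hPart_E, ePart_E, bracketHE_single]

theorem bracketMap_E_E (a b : Root) : bracketMap (E a) (E b) = rootBracket a b := by
  simp [bracketMap_apply, hPart_E, ePart_E, bracketEE]

theorem induction {p : E6 → Prop} (hH : ∀ h, p (ofH h)) (hE : ∀ a, p (E a))
    (hadd : ∀ x y, p x → p y → p (x + y)) (hsmul : ∀ (r : ℂ) x, p x → p (r • x)) (x : E6) :
    p x := by
  have key : ∀ e : Root →₀ ℂ, p (ofE e) := by
    intro e
    induction e using Finsupp.induction_linear with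
    | zero => rw [map_zero, ← map_zero ofH]; exact hH 0
    | add f g hf hg => rw [map_add]; exact hadd _ _ hf hg
    | single a r =>
      have h : ofE (Finsupp.single a r) = r • E a := by
        rw [E, ← map_smul]; simp
      rw [h]; exact hsmul r _ (hE a)
  have hx : x = ofH (hPart x) + ofE (ePart x) :=
    Prod.ext (add_zero _).symm (zero_add _).symm
  rw [hx]; exact hadd _ _ (hH _) (key _)

/-! Properties of the form and of the sign, and the Jacobi identity. -/

theorem form_comm (a b : Fin 6 → ℤ) : form a b = form b a := by
  simp only [form]; ring

theorem form_add_left (a b c : Fin 6 → ℤ) : form (a + b) c = form a c + form b c := by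
  simp only [form, Pi.add_apply]; ring

theorem form_add_right (a b c : Fin 6 → ℤ) : form a (b + c) = form a b + form a c := by
  simp only [form, Pi.add_apply]; ring

theorem form_neg_right (a b : Fin 6 → ℤ) : form a (-b) = -form a b := by
  simp only [form, Pi.neg_apply]; ring

theorem form_neg_left (a b : Fin 6 → ℤ) : form (-a) b = -form a b := by
  simp only [form, Pi.neg_apply]; ring

theorem form_latticeH (a b : Fin 6 → ℤ) :
    form (latticeH a) (latticeH b) = ((form a b : ℤ) : ℂ) := by
  simp only [form, latticeH]; push_cast; ring

theorem six_mul_form (a : Fin 6 → ℤ) : 6 * form a a =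
    3 * (2 * a 0 - a 2) ^ 2 + (3 * a 2 - 2 * a 3) ^ 2 + 3 * (2 * a 1 - a 3) ^ 2
      + 3 * (2 * a 5 - a 4) ^ 2 + (3 * a 4 - 2 * a 3) ^ 2 + a 3 ^ 2 := by
  simp only [form]; ring

theorem form_self_nonneg (a : Fin 6 → ℤ) : 0 ≤ form a a := by
  have h := six_mul_form a
  have : 0 ≤ 6 * form a a := by rw [h]; positivity
  omega

theorem eq_zero_of_form (a : Fin 6 → ℤ) (h0 : form a a = 0) : a = 0 := by
  have h := six_mul_form a
  rw [h0] at h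
  have e1 := sq_nonneg (2 * a 0 - a 2)
  have e2 := sq_nonneg (3 * a 2 - 2 * a 3)
  have e3 := sq_nonneg (2 * a 1 - a 3)
  have e4 := sq_nonneg (2 * a 5 - a 4)
  have e5 := sq_nonneg (3 * a 4 - 2 * a 3)
  have e6 := sq_nonneg (a 3)
  have f1 : 2 * a 0 - a 2 = 0 := pow_eq_zero_iff (two_ne_zero) |>.1 (by linarith)
  have f2 : 3 * a 2 - 2 * a 3 = 0 := pow_eq_zero_iff (two_ne_zero) |>.1 (by linarith)
  have f3 : 2 * a 1 - a 3 = 0 := pow_eq_zero_iff (two_ne_zero) |>.1 (by linarith)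
  have f4 : 2 * a 5 - a 4 = 0 := pow_eq_zero_iff (two_ne_zero) |>.1 (by linarith)
  have f5 : 3 * a 4 - 2 * a 3 = 0 := pow_eq_zero_iff (two_ne_zero) |>.1 (by linarith)
  have f6 : a 3 = 0 := pow_eq_zero_iff (two_ne_zero) |>.1 (by linarith)
  funext i
  fin_cases i <;> simp <;> omega

theorem form_add_self (a b : Fin 6 → ℤ) :
    form (a + b) (a + b) = form a a + form b b + 2 * form a b := by
  simp only [form, Pi.add_apply]; ring

theorem neg_two_le_form (a b : Root) : -2 ≤ form a.1 b.1 := by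
  have h := form_self_nonneg (a.1 + b.1)
  rw [form_add_self, a.2, b.2] at h
  omega

theorem add_eq_zero_iff_form (a b : Root) : a.1 + b.1 = 0 ↔ form a.1 b.1 = -2 := by
  constructor
  · intro h
    have h' := form_add_self a.1 b.1
    rw [h, a.2, b.2] at h'
    simp [form] at h' ⊢
    omega
  · intro h
    apply eq_zero_of_form
    rw [form_add_self, a.2, b.2, h]
    norm_num

theorem F_add_left (a b c : Fin 6 → ℤ) : F (a + b) c = F a c * F b c := by
  have : cocycleExp (a + b) c = cocycleExp a c + cocycleExp b c := by
    simp only [cocycleExp, Pi.add_apply]; ring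
  simp [F, this, Int.negOnePow_add]

theorem F_add_right (a b c : Fin 6 → ℤ) : F a (b + c) = F a b * F a c := by
  have : cocycleExp a (b + c) = cocycleExp a b + cocycleExp a c := by
    simp only [cocycleExp, Pi.add_apply]; ring
  simp [F, this, Int.negOnePow_add]

theorem F_neg_left (a b : Fin 6 → ℤ) : F (-a) b = F a b := by
  have : cocycleExp (-a) b = -cocycleExp a b := by
    simp only [cocycleExp, Pi.neg_apply]; ring
  simp [F, this, Int.negOnePow_neg]

theorem F_neg_right (a b : Fin 6 → ℤ) : F a (-b) = F a b := by
  have : cocycleExp a (-b) = -cocycleExp a b := by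
    simp only [cocycleExp, Pi.neg_apply]; ring
  simp [F, this, Int.negOnePow_neg]

theorem F_mul_self (a b : Fin 6 → ℤ) : F a b * F a b = 1 := by
  unfold F
  rw [← Units.val_mul, Int.units_mul_self, Units.val_one]

theorem F_mul_swap (a b : Fin 6 → ℤ) : F a b * F b a = ((form a b).negOnePow : ℤˣ) := by
  have : cocycleExp a b + cocycleExp b a = form a b + 2 * (a 0 * b 2 + a 2 * b 0 + a 2 * b 3
      + a 3 * b 2 + a 1 * b 3 + a 3 * b 1 + a 3 * b 4 + a 4 * b 3 + a 4 * b 5 + a 5 * b 4) := by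
    simp only [cocycleExp, form]; ring
  unfold F
  rw [← Units.val_mul, ← Int.negOnePow_add, this, Int.negOnePow_add, Int.negOnePow_two_mul, mul_one]

theorem F_root (a : Root) : F a.1 a.1 = -1 := by
  have h : 2 * cocycleExp a.1 a.1 = form a.1 a.1 + 4 * (a.1 0 * a.1 2 + a.1 3 * a.1 1
      + a.1 2 * a.1 3 + a.1 4 * a.1 3 + a.1 5 * a.1 4) := by
    simp only [cocycleExp, form]; ring
  rw [a.2] at h
  unfold F
  rw [Int.negOnePow_odd]
  · simp
  · exact ⟨a.1 0 * a.1 2 + a.1 3 * a.1 1 + a.1 2 * a.1 3 + a.1 4 * a.1 3 + a.1 5 * a.1 4,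
      by omega⟩

theorem F_swap_of_odd (a b : Fin 6 → ℤ) (h : form a b = -1) : F b a = -F a b := by
  have h1 := F_mul_swap a b
  have h2 := F_mul_self a b
  rw [h] at h1
  simp at h1
  linear_combination F a b * h1 - F b a * h2

theorem F_swap_of_zero (a b : Fin 6 → ℤ) (h : form a b = 0) : F b a = F a b := by
  have h1 := F_mul_swap a b
  have h2 := F_mul_self a b
  rw [h] at h1
  simp at h1
  linear_combination F a b * h1 - F b a * h2

theorem EOrZero_root (a : Root) : EOrZero a.1 = E a := by
  have h : form a.1 a.1 = 2 := a.2
  simp only [EOrZero, h, dite_true]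

theorem E_congr {a b : Root} (h : a.1 = b.1) : E a = E b := by
  rw [show a = b from Subtype.ext h]

theorem rootBracket_swap (a b : Root) : rootBracket b a = -rootBracket a b := by
  unfold rootBracket
  by_cases h : a.1 + b.1 = 0
  · have h' : b.1 + a.1 = 0 := by rw [add_comm, h]
    rw [if_pos h, if_pos h', neg_neg, ← map_neg]
    congr 1
    funext i
    have := congrFun h i
    simp only [Pi.add_apply, Pi.zero_apply] at this
    simp only [latticeH, Pi.neg_apply]
    have h2 : b.1 i = -a.1 i := by omega
    rw [h2]; push_cast; ring
  · have h' : ¬ b.1 + a.1 = 0 := by rwa [add_comm]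
    rw [if_neg h, if_neg h', add_comm b.1 a.1]
    by_cases hr : form (a.1 + b.1) (a.1 + b.1) = 2
    · have hf : form a.1 b.1 = -1 := by
        rw [form_add_self, a.2, b.2] at hr; omega
      rw [F_swap_of_odd _ _ hf]
      push_cast
      rw [neg_smul]
    · simp [EOrZero, hr]

theorem bracketMap_skew (x y : E6) : bracketMap x y = -bracketMap y x := by
  induction x using induction with
  | hadd x x' hx hx' => simp only [map_add, LinearMap.add_apply, hx, hx']; abel
  | hsmul r x hx => simp only [map_smul, LinearMap.smul_apply, hx, smul_neg]
  | hH h =>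
    induction y using induction with
    | hadd x x' hx hx' => simp only [map_add, LinearMap.add_apply, hx, hx']; abel
    | hsmul r x hx => simp only [map_smul, LinearMap.smul_apply, hx, smul_neg]
    | hH h' => simp [bracketMap_H_H]
    | hE a => simp [bracketMap_H_E, bracketMap_E_H]
  | hE a =>
    induction y using induction with
    | hadd x x' hx hx' => simp only [map_add, LinearMap.add_apply, hx, hx']; abel
    | hsmul r x hx => simp only [map_smul, LinearMap.smul_apply, hx, smul_neg]
    | hH h' => simp [bracketMap_H_E, bracketMap_E_H]
    | hE b => rw [bracketMap_E_E, bracketMap_E_E, ← rootBracket_swap]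

/-- The cyclic sum of the Jacobi identity. -/
def jac (x y z : E6) : E6 :=
  bracketMap x (bracketMap y z) + bracketMap y (bracketMap z x) + bracketMap z (bracketMap x y)

theorem jac_cyc (x y z : E6) : jac y z x = jac x y z := by
  unfold jac; abel

theorem bracketMap_H_EOrZero (h : Fin 6 → ℂ) (a : Fin 6 → ℤ) :
    bracketMap (ofH h) (EOrZero a) = form h (latticeH a) • EOrZero a := by
  unfold EOrZero
  split_ifs with ha
  · exact bracketMap_H_E h ⟨a, ha⟩
  · simp

theorem bracketMap_H_rootBracket (h : Fin 6 → ℂ) (a b : Root) :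
    bracketMap (ofH h) (rootBracket a b)
      = (form h (latticeH a.1) + form h (latticeH b.1)) • rootBracket a b := by
  have hsum : form h (latticeH a.1) + form h (latticeH b.1) = form h (latticeH (a.1 + b.1)) := by
    simp only [form, latticeH, Pi.add_apply]; push_cast; ring
  unfold rootBracket
  split_ifs with h0
  · rw [hsum, h0, map_neg, bracketMap_H_H]
    simp [form, latticeH]
  · rw [map_smul, bracketMap_H_EOrZero, hsum, smul_comm]

theorem jac_HEE (h : Fin 6 → ℂ) (a b : Root) : jac (ofH h) (E a) (E b) = 0 := by
  unfold jac
  rw [bracketMap_E_E, bracketMap_H_rootBracket, bracketMap_E_H, bracketMap_H_E, map_neg, map_smul,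
    map_smul, bracketMap_E_E, bracketMap_E_E, rootBracket_swap a b]
  module

theorem jac_HHE (h h' : Fin 6 → ℂ) (a : Root) : jac (ofH h) (ofH h') (E a) = 0 := by
  unfold jac
  rw [bracketMap_H_E, bracketMap_E_H, bracketMap_H_H, map_neg, map_smul, map_smul, bracketMap_H_E,
    bracketMap_H_E]
  simp only [map_zero]
  module

theorem triple_of_zero (a b c : Root) (hq : form b.1 c.1 = -2) :
    bracketMap (E a) (rootBracket b c) = ((form b.1 a.1 : ℤ) : ℂ) • E a := by
  rw [rootBracket, if_pos ((add_eq_zero_iff_form b c).2 hq), map_neg, bracketMap_E_H, neg_neg,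
    form_latticeH]

theorem triple_of_ge (a b c : Root) (hq : 0 ≤ form b.1 c.1) :
    bracketMap (E a) (rootBracket b c) = 0 := by
  have h0 : ¬ b.1 + c.1 = 0 := fun h => by
    have := (add_eq_zero_iff_form b c).1 h; omega
  have h1 : ¬ form (b.1 + c.1) (b.1 + c.1) = 2 := by
    rw [form_add_self, b.2, c.2]; omega
  rw [rootBracket, if_neg h0, EOrZero, dif_neg h1]
  simp

theorem triple_of_root (a b c : Root) (hq : form b.1 c.1 = -1) :
    bracketMap (E a) (rootBracket b c) = (F b.1 c.1 : ℂ) •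
      (if a.1 + (b.1 + c.1) = 0 then -ofH (latticeH a.1)
        else ((F a.1 b.1 * F a.1 c.1 : ℤ) : ℂ) • EOrZero (a.1 + (b.1 + c.1))) := by
  have h0 : ¬ b.1 + c.1 = 0 := fun h => by
    have := (add_eq_zero_iff_form b c).1 h; omega
  have h1 : form (b.1 + c.1) (b.1 + c.1) = 2 := by
    rw [form_add_self, b.2, c.2]; omega
  rw [rootBracket, if_neg h0, EOrZero, dif_pos h1, map_smul, bracketMap_E_E, rootBracket]
  simp only [F_add_right]

theorem form_add₃ (a b c : Root) : form (a.1 + (b.1 + c.1)) (a.1 + (b.1 + c.1))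
    = 6 + 2 * (form a.1 b.1 + form b.1 c.1 + form c.1 a.1) := by
  rw [form_add_self, form_add_self, form_add_right, a.2, b.2, c.2, form_comm c.1 a.1]; ring

theorem jac_EEE_neg_two (a b c : Root) (hq : form b.1 c.1 = -2) : jac (E a) (E b) (E c) = 0 := by
  have hbc : c.1 = -b.1 := eq_neg_of_add_eq_zero_right ((add_eq_zero_iff_form b c).2 hq)
  have hr : form c.1 a.1 = -form a.1 b.1 := by rw [hbc, form_neg_left, form_comm]
  have hp1 := neg_two_le_form a b
  have hp2 := neg_two_le_form c a
  have hba := form_comm b.1 a.1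
  have s1 : b.1 + (c.1 + a.1) = a.1 := by rw [hbc]; abel
  have s2 : c.1 + (a.1 + b.1) = a.1 := by rw [hbc]; abel
  have a0 : ¬ a.1 = 0 := fun h => by
    have := a.2; rw [h] at this; simp [form] at this
  unfold jac
  rw [bracketMap_E_E, bracketMap_E_E, bracketMap_E_E, triple_of_zero a b c hq]
  obtain hp | hp | hp | hp | hp : form a.1 b.1 = -2 ∨ form a.1 b.1 = -1 ∨ form a.1 b.1 = 0 ∨
      form a.1 b.1 = 1 ∨ form a.1 b.1 = 2 := by omega
  · rw [triple_of_ge b c a (by omega), triple_of_zero c a b hp, hba, hp]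
    have hac : a.1 = c.1 := by
      rw [hbc]; exact eq_neg_of_add_eq_zero_left ((add_eq_zero_iff_form a b).2 hp)
    rw [E_congr hac, hac, c.2]
    push_cast
    module
  · rw [triple_of_ge b c a (by omega), triple_of_root c a b hp, s2, if_neg a0, EOrZero_root, hba,
      hp, hbc, F_neg_left, F_neg_left, F_root, F_swap_of_odd a.1 b.1 hp, smul_smul,
      ← Int.cast_mul]
    rw [show F a.1 b.1 * (-F a.1 b.1 * -1) = 1 by linear_combination F_mul_self a.1 b.1]
    push_cast
    module
  · rw [triple_of_ge b c a (by omega), triple_of_ge c a b (by omega), hba, hp]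
    simp
  · rw [triple_of_root b c a (by omega), triple_of_ge c a b (by omega), s1, if_neg a0,
      EOrZero_root, hba, hp, hbc, F_neg_left, F_neg_right, F_root, smul_smul, ← Int.cast_mul]
    rw [show F b.1 a.1 * (-1 * F b.1 a.1) = -1 by linear_combination -F_mul_self b.1 a.1]
    push_cast
    module
  · rw [triple_of_zero b c a (by omega), triple_of_ge c a b (by omega), hba, hp]
    have hab : a.1 = b.1 := by
      have h := (add_eq_zero_iff_form c a).2 (by omega)
      rw [hbc] at h
      exact (neg_add_eq_zero.1 h).symm
    rw [E_congr hab, hbc, form_neg_left, b.2]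
    push_cast
    module

theorem jac_EEE_zero (a b c : Root) (hp : form a.1 b.1 = -1) (hq : form b.1 c.1 = -1)
    (hr : form c.1 a.1 = 0) : jac (E a) (E b) (E c) = 0 := by
  have n0 : ∀ x : Fin 6 → ℤ, x = a.1 + (b.1 + c.1) → ¬ x = 0 := by
    intro x hx h
    have := form_add₃ a b c
    rw [← hx, h, hp, hq, hr] at this
    simp [form] at this
  have s2 : c.1 + (a.1 + b.1) = a.1 + (b.1 + c.1) := by abel
  unfold jac
  rw [bracketMap_E_E, bracketMap_E_E, bracketMap_E_E, triple_of_root a b c hq,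
    triple_of_ge b c a (by omega), triple_of_root c a b hp, s2, if_neg (n0 _ rfl),
    if_neg (n0 _ rfl), F_swap_of_odd b.1 c.1 hq, F_swap_of_zero c.1 a.1 hr]
  push_cast
  module

theorem jac_EEE (a b c : Root) : jac (E a) (E b) (E c) = 0 := by
  have hp1 := neg_two_le_form a b
  have hq1 := neg_two_le_form b c
  have hr1 := neg_two_le_form c a
  by_cases hq : form b.1 c.1 = -2
  · exact jac_EEE_neg_two a b c hq
  by_cases hr : form c.1 a.1 = -2
  · rw [← jac_cyc]; exact jac_EEE_neg_two b c a hr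
  by_cases hp : form a.1 b.1 = -2
  · rw [← jac_cyc, ← jac_cyc]; exact jac_EEE_neg_two c a b hp
  have h3 := form_add₃ a b c
  have hnn := form_self_nonneg (a.1 + (b.1 + c.1))
  have s1 : b.1 + (c.1 + a.1) = a.1 + (b.1 + c.1) := by abel
  have s2 : c.1 + (a.1 + b.1) = a.1 + (b.1 + c.1) := by abel
  obtain hs | hs | hs : form a.1 b.1 + form b.1 c.1 + form c.1 a.1 = -3 ∨
      form a.1 b.1 + form b.1 c.1 + form c.1 a.1 = -2 ∨
      -2 < form a.1 b.1 + form b.1 c.1 + form c.1 a.1 := by omega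
  · have hz : a.1 + (b.1 + c.1) = 0 := eq_zero_of_form _ (by omega)
    have hc : c.1 = -(a.1 + b.1) := by rw [← sub_eq_zero]; rw [← hz]; abel
    unfold jac
    rw [bracketMap_E_E, bracketMap_E_E, bracketMap_E_E, triple_of_root a b c (by omega),
      triple_of_root b c a (by omega), triple_of_root c a b (by omega), s1, s2, if_pos hz,
      if_pos hz, if_pos hz]
    have f1 : F b.1 c.1 = F a.1 b.1 := by
      rw [hc, F_neg_right, F_add_right, F_root, F_swap_of_odd a.1 b.1 (by omega)]; ring
    have f2 : F c.1 a.1 = F a.1 b.1 := by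
      rw [hc, F_neg_left, F_add_left, F_root, F_swap_of_odd a.1 b.1 (by omega)]; ring
    rw [f1, f2, ← smul_add, ← smul_add, ← neg_add, ← neg_add, ← map_add, ← map_add]
    have hl : latticeH a.1 + latticeH b.1 + latticeH c.1 = 0 := by
      funext i
      have := congrFun hz i
      simp only [Pi.add_apply, Pi.zero_apply, latticeH] at this ⊢
      rw [add_assoc]
      exact_mod_cast this
    rw [hl]
    simp
  · obtain h | h | h : form c.1 a.1 = 0 ∨ form a.1 b.1 = 0 ∨ form b.1 c.1 = 0 := by omega
    · exact jac_EEE_zero a b c (by omega) (by omega) h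
    · rw [← jac_cyc]; exact jac_EEE_zero b c a (by omega) (by omega) h
    · rw [← jac_cyc, ← jac_cyc]; exact jac_EEE_zero c a b (by omega) (by omega) h
  · have hE : EOrZero (a.1 + (b.1 + c.1)) = 0 := by
      rw [EOrZero, dif_neg (by omega)]
    have hz : ¬ a.1 + (b.1 + c.1) = 0 := fun h => by
      rw [h] at h3; simp [form] at h3; simp [form] at hs; omega
    have key : ∀ x y z : Root, x.1 + (y.1 + z.1) = a.1 + (b.1 + c.1) → -1 ≤ form y.1 z.1 →
        bracketMap (E x) (rootBracket y z) = 0 := by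
      intro x y z hx hy
      by_cases h : form y.1 z.1 = -1
      · rw [triple_of_root x y z h, hx, if_neg hz, hE]; simp
      · exact triple_of_ge x y z (by omega)
    unfold jac
    rw [bracketMap_E_E, bracketMap_E_E, bracketMap_E_E, key a b c rfl (by omega),
      key b c a s1 (by omega), key c a b s2 (by omega)]
    simp

theorem jac_add (x x' y z : E6) : jac (x + x') y z = jac x y z + jac x' y z := by
  simp only [jac, map_add, LinearMap.add_apply]; abel

theorem jac_smul (r : ℂ) (x y z : E6) : jac (r • x) y z = r • jac x y z := by
  simp only [jac, map_smul, LinearMap.smul_apply, smul_add]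

theorem jac_ind {y z : E6} (hH : ∀ h, jac (ofH h) y z = 0) (hE : ∀ a, jac (E a) y z = 0)
    (x : E6) : jac x y z = 0 := by
  induction x using induction with
  | hH h => exact hH h
  | hE a => exact hE a
  | hadd x x' hx hx' => rw [jac_add, hx, hx', add_zero]
  | hsmul r x hx => rw [jac_smul, hx, smul_zero]

theorem jac_eq_zero (x y z : E6) : jac x y z = 0 := by
  have hHHH : ∀ h h' h'', jac (ofH h) (ofH h') (ofH h'') = 0 := by
    intro h h' h''; simp [jac, bracketMap_H_H]
  have s1 : ∀ (h h' : Fin 6 → ℂ) (w : E6), jac w (ofH h) (ofH h') = 0 := by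
    intro h h' w
    refine jac_ind (fun h'' => hHHH _ _ _) (fun a => ?_) w
    rw [← jac_cyc]; exact jac_HHE h h' a
  have s2 : ∀ (h : Fin 6 → ℂ) (a : Root) (w : E6), jac w (ofH h) (E a) = 0 := by
    intro h a w
    refine jac_ind (fun h'' => jac_HHE _ _ _) (fun b => ?_) w
    rw [← jac_cyc]; exact jac_HEE h a b
  have s3 : ∀ (h : Fin 6 → ℂ) (a : Root) (w : E6), jac w (E a) (ofH h) = 0 := by
    intro h a w
    refine jac_ind (fun h'' => ?_) (fun b => ?_) w
    · rw [← jac_cyc, ← jac_cyc]; exact jac_HHE _ _ _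
    · rw [← jac_cyc, ← jac_cyc]; exact jac_HEE _ _ _
  have s4 : ∀ (a b : Root) (w : E6), jac w (E a) (E b) = 0 := by
    intro a b w
    exact jac_ind (fun h'' => jac_HEE _ _ _) (fun c => jac_EEE _ _ _) w
  have t1 : ∀ (h : Fin 6 → ℂ) (y w : E6), jac y (ofH h) w = 0 := by
    intro h y w
    rw [← jac_cyc, ← jac_cyc]
    refine jac_ind (fun h' => ?_) (fun a => ?_) w
    · rw [← jac_cyc]; exact s1 _ _ _
    · rw [← jac_cyc]; exact s2 _ _ _
  have t2 : ∀ (a : Root) (y w : E6), jac y (E a) w = 0 := by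
    intro h y w
    rw [← jac_cyc, ← jac_cyc]
    refine jac_ind (fun h' => ?_) (fun a => ?_) w
    · rw [← jac_cyc]; exact s3 _ _ _
    · rw [← jac_cyc]; exact s4 _ _ _
  rw [← jac_cyc]
  refine jac_ind (fun h => ?_) (fun a => ?_) y
  · rw [← jac_cyc, ← jac_cyc]; exact t1 _ _ _
  · rw [← jac_cyc, ← jac_cyc]; exact t2 _ _ _

instance : LieRing E6 where
  bracket x y := bracketMap x y
  add_lie x y z := by
    change bracketMap (x + y) z = bracketMap x z + bracketMap y z
    rw [map_add, LinearMap.add_apply]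
  lie_add x y z := by
    change bracketMap x (y + z) = bracketMap x y + bracketMap x z
    rw [map_add]
  lie_self x := by
    change bracketMap x x = 0
    have h := bracketMap_skew x x
    have h2 : (2 : ℂ) • bracketMap x x = 0 := by
      rw [two_smul]; nth_rewrite 1 [h]; exact neg_add_cancel _
    exact (smul_eq_zero.1 h2).resolve_left two_ne_zero
  leibniz_lie x y z := by
    change bracketMap x (bracketMap y z)
      = bracketMap (bracketMap x y) z + bracketMap y (bracketMap x z)
    have h := jac_eq_zero x y z
    unfold jac at h
    rw [bracketMap_skew z (bracketMap x y), bracketMap_skew z x, map_neg] at h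
    rw [← sub_eq_zero, ← h]; abel

instance : LieAlgebra ℂ E6 where
  lie_smul r x y := by
    change bracketMap x (r • y) = r • bracketMap x y
    rw [map_smul]

end E6

/-! ### The grading: the root vectors outside the subalgebra of type `D₅` -/

/-- The coordinates of the sixteen positive roots whose coefficient at `α₆` is `1`. -/
def betaVec : Fin 16 → Fin 6 → ℤ :=
  ![![0, 0, 0, 0, 0, 1], ![0, 0, 0, 0, 1, 1], ![0, 0, 0, 1, 1, 1], ![0, 0, 1, 1, 1, 1],
    ![0, 1, 0, 1, 1, 1], ![0, 1, 1, 1, 1, 1], ![1, 0, 1, 1, 1, 1], ![1, 1, 1, 1, 1, 1],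
    ![0, 1, 1, 2, 1, 1], ![1, 1, 1, 2, 1, 1], ![0, 1, 1, 2, 2, 1], ![1, 1, 2, 2, 1, 1],
    ![1, 1, 1, 2, 2, 1], ![1, 1, 2, 2, 2, 1], ![1, 1, 2, 3, 2, 1], ![1, 2, 2, 3, 2, 1]]

theorem form_betaVec : ∀ i, form (betaVec i) (betaVec i) = 2 := by decide

/-- The sixteen positive roots whose coefficient at `α₆` is `1`. -/
def beta (i : Fin 16) : Root := ⟨betaVec i, form_betaVec i⟩

/-- The root vectors `ξ_i = E_{β_i}`, a basis of `𝒢₊`. -/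
def xi (i : Fin 16) : E6 := E6.E (beta i)

/-- The root vectors `η_i = E_{-β_i}`, a basis of `𝒢₋`. -/
def eta (i : Fin 16) : E6 := E6.E (-beta i)

/-- The coefficient of `ξ_i` in an element of the Lie algebra. -/
def xiCoeff (i : Fin 16) : E6 →ₗ[ℂ] ℂ := Finsupp.lapply (beta i) ∘ₗ E6.ePart

/-- The coefficient of `η_i` in an element of the Lie algebra. -/
def etaCoeff (i : Fin 16) : E6 →ₗ[ℂ] ℂ := Finsupp.lapply (-beta i) ∘ₗ E6.ePart

/-! ### The orthogonal Lie algebra `o(10, ℂ)` and its identification with `𝒢^{D₅}` -/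

/-- `o(10, ℂ)`, the matrices `[[A, B], [C, -Aᵀ]]` with `B`, `C` skew symmetric; the index `i ≤ 5`
of a row or column is `Sum.inl`, and `5 + i` is `Sum.inr`. -/
abbrev O10 : Type := LieAlgebra.Orthogonal.typeD (Fin 5) ℂ

theorem mem_typeD {A B C : Matrix (Fin 5) (Fin 5) ℂ} (hB : B.transpose = -B)
    (hC : C.transpose = -C) :
    Matrix.fromBlocks A B C (-A.transpose) ∈ LieAlgebra.Orthogonal.typeD (Fin 5) ℂ := by
  rw [LieAlgebra.Orthogonal.typeD, mem_skewAdjointMatricesLieSubalgebra,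
    mem_skewAdjointMatricesSubmodule, Matrix.IsSkewAdjoint, Matrix.IsAdjointPair,
    LieAlgebra.Orthogonal.JD]
  simp [Matrix.fromBlocks_transpose, Matrix.fromBlocks_multiply, Matrix.fromBlocks_neg, hB, hC]

/-- The element `[[A, B], [C, -Aᵀ]]` of `o(10, ℂ)`. -/
def O10.mk (A B C : Matrix (Fin 5) (Fin 5) ℂ) (hB : B.transpose = -B) (hC : C.transpose = -C) :
    O10 := ⟨Matrix.fromBlocks A B C (-A.transpose), mem_typeD hB hC⟩

/-- `E_{i,i} - E_{5+i,5+i}`. -/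
def O10.cartan (i : Fin 5) : O10 := O10.mk (Matrix.single i i 1) 0 0 (by simp) (by simp)

/-- `E_{i,j} - E_{5+j,5+i}`, a root vector for `ε_i - ε_j` if `i ≠ j`. -/
def O10.minus (i j : Fin 5) : O10 := O10.mk (Matrix.single i j 1) 0 0 (by simp) (by simp)

/-- `E_{i,5+j} - E_{j,5+i}`, a root vector for `ε_i + ε_j` if `i ≠ j`. -/
def O10.plus (i j : Fin 5) : O10 :=
  O10.mk 0 (Matrix.single i j 1 - Matrix.single j i 1) 0 (by simp) (by simp)

/-- `v` is a highest weight vector of weight `∑ μ_i ε_i`: it is nonzero, it is annihilated by the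
root vectors of the positive roots `ε_i ± ε_j` (`i < j`), and `E_{i,i} - E_{5+i,5+i}` acts on it as
`μ_i`. -/
def IsHighestWeightVector {M : Type*} [AddCommGroup M] [Module ℂ M] [LieRingModule O10 M]
    (μ : Fin 5 → ℂ) (v : M) : Prop :=
  v ≠ 0 ∧ (∀ i j : Fin 5, i < j → ⁅O10.minus i j, v⁆ = 0 ∧ ⁅O10.plus i j, v⁆ = 0) ∧
    ∀ i : Fin 5, ⁅O10.cartan i, v⁆ = μ i • v

/-- `M` is the module `V(∑ μ_i ε_i)`: a finite-dimensional irreducible `o(10, ℂ)`-module of highest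
weight `∑ μ_i ε_i`. -/
def IsV (μ : Fin 5 → ℂ) (M : Type*) [AddCommGroup M] [Module ℂ M] [LieRingModule O10 M] : Prop :=
  FiniteDimensional ℂ M ∧ LieModule.IsIrreducible ℂ O10 M ∧ ∃ v : M, IsHighestWeightVector μ v

/-- The coordinates with respect to `ε₁, …, ε₅` of the restriction to the Cartan subalgebra of
`o(10, ℂ)` of `∑ a_i α_i`; here `α₁ = ε₁ - ε₂`, `α₃ = ε₂ - ε₃`, `α₄ = ε₃ - ε₄`, `α₅ = ε₄ - ε₅`,
`α₂ = ε₄ + ε₅`, and `α₆` restricts to `-(ε₁ + ε₂ + ε₃ + ε₄ - ε₅)/2`. -/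
def epsCoord (a : Fin 6 → ℂ) : Fin 5 → ℂ :=
  ![a 0 - a 5 / 2, a 2 - a 0 - a 5 / 2, a 3 - a 2 - a 5 / 2, a 4 + a 1 - a 3 - a 5 / 2,
    a 1 - a 4 + a 5 / 2]

/-- The coordinates with respect to `ε₁, …, ε₅` of the vector `∑ a_i α_i` of the root lattice of
`D₅` (so `a₆ = 0`). -/
def epsInt (a : Fin 6 → ℤ) : Fin 5 → ℤ :=
  ![a 0, a 2 - a 0, a 3 - a 2, a 4 + a 1 - a 3, a 1 - a 4]

/-- The signs `s` with `ν(E_{i,j} - E_{5+j,5+i}) = s E_{ε_i - ε_j}`. -/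
def signMinus : Matrix (Fin 5) (Fin 5) ℤ :=
  !![0, 1, -1, 1, 1; -1, 0, 1, -1, -1; 1, -1, 0, 1, 1; -1, 1, -1, 0, 1; -1, 1, -1, -1, 0]

/-- The signs `s` with `ν(E_{i,5+j} - E_{j,5+i}) = s E_{ε_i + ε_j}` and
`ν(E_{5+i,j} - E_{5+j,i}) = s E_{-ε_i - ε_j}`. -/
def signPlus : Matrix (Fin 5) (Fin 5) ℤ :=
  !![0, -1, 1, 1, -1; 1, 0, -1, -1, 1; -1, 1, 0, 1, -1; -1, 1, -1, 0, 1; 1, -1, 1, -1, 0]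

theorem signPlus_swap : ∀ i j, signPlus j i = -signPlus i j := by decide

/-- `ν⁻¹(E_γ)` for a root `γ` of `D₅` (that is, one with coefficient `0` at `α₆`), and `0` for the
other roots of `E₆`. Here `ν : o(10, ℂ) → 𝒢^{D₅}` is the isomorphism of Lie algebras that sends
`E_{1,2} - E_{7,6}`, `E_{2,3} - E_{8,7}`, `E_{3,4} - E_{9,8}`, `E_{4,5} - E_{10,9}`,
`E_{4,10} - E_{5,9}` to `E_γ` and their transposes to `-E_{-γ}` for `γ = α₁, α₃, α₄, α₅, α₂`. -/
def nuInvRoot (γ : Root) : O10 :=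
  if γ.1 5 = 0 then
    O10.mk
      (Matrix.of fun i j => if epsInt γ.1 = Pi.single i 1 - Pi.single j 1
        then (signMinus i j : ℂ) else 0)
      (Matrix.of fun i j => if epsInt γ.1 = Pi.single i 1 + Pi.single j 1
        then (signPlus i j : ℂ) else 0)
      (Matrix.of fun i j => if epsInt γ.1 = -(Pi.single i 1 + Pi.single j 1)
        then (signPlus i j : ℂ) else 0)
      (by
        ext i j
        simp only [Matrix.transpose_apply, Matrix.of_apply, Matrix.neg_apply, signPlus_swap i j,
          add_comm (Pi.single j 1 : Fin 5 → ℤ) (Pi.single i 1)]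
        split_ifs <;> simp)
      (by
        ext i j
        simp only [Matrix.transpose_apply, Matrix.of_apply, Matrix.neg_apply, signPlus_swap i j,
          add_comm (Pi.single j 1 : Fin 5 → ℤ) (Pi.single i 1)]
        split_ifs <;> simp)
  else 0

/-- The component of `ϱ` in `o(10, ℂ)`, extended by zero to `𝒢₋` and `𝒢₊`: it is `ν⁻¹` on `𝒢^{D₅}`
and it vanishes at the central element `α̂ = 2α₁ + 3α₂ + 4α₃ + 6α₄ + 5α₅ + 4α₆` of `𝒢₀`. -/
def rhoO : E6 →ₗ[ℂ] O10 :=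
  (∑ i : Fin 5, (LinearMap.toSpanSingleton ℂ O10 (O10.cartan i)) ∘ₗ
    ({ toFun := fun h => epsCoord h i
       map_add' := by
        intro x y; fin_cases i <;> simp [epsCoord] <;> ring
       map_smul' := by
        intro r x; fin_cases i <;> simp [epsCoord] <;> ring } : (Fin 6 → ℂ) →ₗ[ℂ] ℂ)) ∘ₗ E6.hPart
  + Finsupp.linearCombination ℂ nuInvRoot ∘ₗ E6.ePart

/-- The coefficient of `κ` in `ϱ`, extended by zero to `𝒢₋` and `𝒢₊`: it vanishes on `𝒢^{D₅}` and is
`2` at `α̂`. -/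
def rhoKappa : E6 →ₗ[ℂ] ℂ := (1 / 2 : ℂ) • (LinearMap.proj 5 ∘ₗ E6.hPart)

/-! ### The module `M̂` -/

/-- The polynomial algebra `𝒜 = ℂ[x₁, …, x₁₆]`. -/
abbrev Poly : Type := MvPolynomial (Fin 16) ℂ

/-- The action on `𝒜` of the element `u` of `𝒢₀`, the derivation `∑ φ_{i,j}(u) x_j ∂_{x_i}` with
`[u, η_i] = ∑_j φ_{i,j}(u) η_j`. (The same formula gives `0` if `u` is in `𝒢₋` or `𝒢₊`.) -/
def polyAct (u : E6) : Derivation ℂ Poly Poly :=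
  MvPolynomial.mkDerivation ℂ fun i =>
    ∑ j : Fin 16, MvPolynomial.C (etaCoeff j ⁅u, eta i⁆) * MvPolynomial.X j

/-- The quadratic vector field `P_i`, that is, the one with quadratic coefficients that satisfies
`[∂_{x_r}, P_i] = [ξ_r, η_i]|_𝒜` for all `r`; explicitly `P_i = ½ ∑_r x_r [ξ_r, η_i]|_𝒜`. -/
def P (i : Fin 16) : Derivation ℂ Poly Poly :=
  (MvPolynomial.C (1 / 2 : ℂ) : Poly) •
    ∑ r : Fin 16, (MvPolynomial.X r : Poly) • polyAct ⁅xi r, eta i⁆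

section Module

variable (M : Type*) [AddCommGroup M] [Module ℂ M] [LieRingModule O10 M] [LieModule ℂ O10 M]

/-- The space `M̂ = 𝒜 ⊗ M`. -/
abbrev Hat : Type _ := Poly ⊗[ℂ] M

/-- The action `f v ↦ d(f) v` of a vector field `d` on `M̂`. -/
def vectorField (d : Derivation ℂ Poly Poly) : Module.End ℂ (Hat M) :=
  LinearMap.rTensor M (d : Poly →ₗ[ℂ] Poly)

/-- The action on `M̂` of `g ϱ(u)` for `u` in `𝒢₀` and a polynomial `g`: a matrix `B` acts as
`(g B)(f v) = (f g) B(v)`, and `κ` acts as the scalar `c`. -/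
def rhoAct (c : ℂ) (g : Poly) (u : E6) : Module.End ℂ (Hat M) :=
  TensorProduct.map (LinearMap.mulLeft ℂ g)
    (LieModule.toEnd ℂ O10 M (rhoO u) + (rhoKappa u * c) • LinearMap.id)

/-- The action of `η_i` on `M̂`, namely `P_i + ∑_r x_r ϱ([ξ_r, η_i])`. -/
def etaAct (c : ℂ) (i : Fin 16) : Module.End ℂ (Hat M) :=
  vectorField M (P i) + ∑ r : Fin 16, rhoAct M c (MvPolynomial.X r) ⁅xi r, eta i⁆

/-- The action on `M̂` of an element of the Lie algebra of type `E₆`: `ξ_i` acts as `∂_{x_i}`, an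
element `u` of `𝒢₀` as `u|_𝒜 + ϱ(u)`, and `η_i` as `P_i + ∑_r x_r ϱ([ξ_r, η_i])`. -/
def act (c : ℂ) (u : E6) : Module.End ℂ (Hat M) :=
  (∑ i : Fin 16, xiCoeff i u • vectorField M (MvPolynomial.pderiv i))
    + (vectorField M (polyAct u) + rhoAct M c 1 u)
    + ∑ i : Fin 16, etaCoeff i u • etaAct M c i

end Module

end XuE6

end

open scoped TensorProduct

noncomputable section

namespace XuE6

/-! ### Enumeration of the roots -/

/-! A nonzero submodule `N` of `M̂` contains some `1 ⊗ m` with `m ≠ 0`: the `ξ_i` act as partial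
derivatives, so they can be applied until only a constant polynomial is left
(`IsCoinduced.exists_mem_layer_zero`). Irreducibility of `M` over `𝒢₀` then gives `1 ⊗ M ⊆ N`. The
theorem therefore reduces to the claim that `1 ⊗ M` generates `M̂` (`isGenerated`).

Generation is tested degree by degree with the Casimir operator of the invariant form `killing`. It
commutes with `𝒢` and is a scalar `χ` on `1 ⊗ M`; since in positive degree no nonzero vector is
annihilated by all `ξ_i`, it is `χ` on all of `M̂` (`IsCoinduced.casimir_eq`). On a highest weight
vector `w` for `𝒢₀` of weight `μ` it equals `casimirValue μ • w - 2 ∑ η_i ξ_i w`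
(`IsHW.casimir_apply`). If no highest weight vector of degree `n + 1` has `casimirValue μ = χ`, the
operator `∑ η_i ξ_i` is injective on that finite-dimensional layer, hence surjective, and the layer
is obtained from degree `n` (`IsCoinduced.layer_le`).

If the real part of `c` is sufficiently negative, a crude estimate excludes equality of Casimir
values in all positive degrees at once (`casimirValue_ne_of_re_lt`). Every other `c` is reached from
such a value in steps of `2`. For the one-dimensional `𝒢₀`-module with `κ = 2`, the constant
polynomial has weight `ω₆` and generates the minuscule module, which lives in polynomials of degree
at most two (`IsCoinduced.wordSpan_eta_le`). Multiplication by these polynomials carries `M̂` with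
parameter `c - 2` to `M̂` with parameter `c` and is compatible with `𝒢` (`hatAct_mulPoly`). Let `N`
be a submodule for `c` that contains the layers of degree `0`, `1`, `2`. The vectors that all these
polynomials multiply into `N` form a submodule for `c - 2` that contains `1 ⊗ M`, so it is
everything; as `1` is one of the polynomials, `N` is everything (`eq_top_of_twist`).

It remains to treat degrees one and two for the given `c`. The leading coefficient of a highest
weight vector is a highest weight vector of `M`, so the weight is the top weight minus a sum of one
or two `β_i`. Equality of Casimir values then forces `c + 14 + k` to be a nonnegative integer, which
is excluded (`casimirValue_ne_one`, `casimirValue_ne_two`).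

That the formulas define a `𝒢`-module at all rests on a rigidity lemma, `eq_zero_of_lie_pderiv`: the
defect of each bracket relation commutes with all derivatives and is homogeneous of nonnegative
degree, so it vanishes as soon as it vanishes on constants. -/

/-- The coordinates of the positive roots of `D₅`, the positive roots with coefficient `0`
at `α₆`. -/
def gammaVec : Fin 20 → Fin 6 → ℤ :=
  ![![1, 0, 0, 0, 0, 0], ![0, 1, 0, 0, 0, 0], ![0, 0, 1, 0, 0, 0], ![0, 0, 0, 1, 0, 0],
    ![0, 0, 0, 0, 1, 0], ![1, 0, 1, 0, 0, 0], ![0, 1, 0, 1, 0, 0], ![0, 0, 1, 1, 0, 0],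
    ![0, 0, 0, 1, 1, 0], ![1, 0, 1, 1, 0, 0], ![0, 1, 1, 1, 0, 0], ![0, 1, 0, 1, 1, 0],
    ![0, 0, 1, 1, 1, 0], ![1, 1, 1, 1, 0, 0], ![1, 0, 1, 1, 1, 0], ![0, 1, 1, 1, 1, 0],
    ![1, 1, 1, 1, 1, 0], ![0, 1, 1, 2, 1, 0], ![1, 1, 1, 2, 1, 0], ![1, 1, 2, 2, 1, 0]]

theorem form_gammaVec : ∀ p, form (gammaVec p) (gammaVec p) = 2 := by decide

/-- The positive roots of `D₅`. -/
def gamma (p : Fin 20) : Root := ⟨gammaVec p, form_gammaVec p⟩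

theorem gammaVec_five : ∀ p, gammaVec p 5 = 0 := by decide

theorem betaVec_five : ∀ i, betaVec i 5 = 1 := by decide

/-- The bounds come from the sum of squares in `six_mul_form`, whose total is `12` for a root. The
inequalities between the quantifiers are partial sums of these squares; they discard most of the box
before the remaining coordinates are enumerated. -/
theorem root_mem_box : ∀ a3 ∈ ([-3, -2, -1, 0, 1, 2, 3] : List ℤ),
    ∀ a2 ∈ ([-3, -2, -1, 0, 1, 2, 3] : List ℤ), (3 * a2 - 2 * a3) ^ 2 + a3 ^ 2 ≤ 12 →
    ∀ a4 ∈ ([-3, -2, -1, 0, 1, 2, 3] : List ℤ),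
    (3 * a2 - 2 * a3) ^ 2 + a3 ^ 2 + (3 * a4 - 2 * a3) ^ 2 ≤ 12 →
    ∀ a1 ∈ ([-2, -1, 0, 1, 2] : List ℤ), ∀ a0 ∈ ([-2, -1, 0, 1, 2] : List ℤ),
    ∀ a5 ∈ ([-2, -1, 0, 1, 2] : List ℤ),
    form ![a0, a1, a2, a3, a4, a5] ![a0, a1, a2, a3, a4, a5] = 2 →
    (∃ p, gammaVec p = ![a0, a1, a2, a3, a4, a5]) ∨
    (∃ p, gammaVec p = ![-a0, -a1, -a2, -a3, -a4, -a5]) ∨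
    (∃ p, betaVec p = ![a0, a1, a2, a3, a4, a5]) ∨
    (∃ p, betaVec p = ![-a0, -a1, -a2, -a3, -a4, -a5]) := by
  decide +kernel

theorem abs_le_three_of_sq_le {x : ℤ} (h : x ^ 2 ≤ 12) : -3 ≤ x ∧ x ≤ 3 := by
  constructor <;> nlinarith

theorem abs_le_two_of_sq_le {x : ℤ} (h : 3 * x ^ 2 ≤ 12) : -2 ≤ x ∧ x ≤ 2 := by
  constructor <;> nlinarith

theorem root_cases (a : Root) : (∃ p, a = gamma p) ∨ (∃ p, a = -gamma p) ∨
    (∃ i, a = beta i) ∨ (∃ i, a = -beta i) := by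
  obtain ⟨a, ha⟩ := a
  have h := E6.six_mul_form a
  rw [ha] at h
  have e1 := sq_nonneg (2 * a 0 - a 2)
  have e2 := sq_nonneg (3 * a 2 - 2 * a 3)
  have e3 := sq_nonneg (2 * a 1 - a 3)
  have e4 := sq_nonneg (2 * a 5 - a 4)
  have e5 := sq_nonneg (3 * a 4 - 2 * a 3)
  have e6 := sq_nonneg (a 3)
  have b3 := abs_le_three_of_sq_le (x := a 3) (by linarith)
  have b2 := abs_le_three_of_sq_le (x := 3 * a 2 - 2 * a 3) (by linarith)
  have b4 := abs_le_three_of_sq_le (x := 3 * a 4 - 2 * a 3) (by linarith)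
  have b0 := abs_le_two_of_sq_le (x := 2 * a 0 - a 2) (by linarith)
  have b1 := abs_le_two_of_sq_le (x := 2 * a 1 - a 3) (by linarith)
  have b5 := abs_le_two_of_sq_le (x := 2 * a 5 - a 4) (by linarith)
  have hvec : a = ![a 0, a 1, a 2, a 3, a 4, a 5] := by
    funext i; fin_cases i <;> rfl
  have hneg : -a = ![-a 0, -a 1, -a 2, -a 3, -a 4, -a 5] := by
    funext i; fin_cases i <;> rfl
  have key := root_mem_box (a 3) (by simp; omega) (a 2) (by simp; omega) (by linarith) (a 4)
    (by simp; omega) (by linarith) (a 1) (by simp; omega) (a 0) (by simp; omega) (a 5)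
    (by simp; omega) (by rw [← hvec, ha])
  rw [← hvec, ← hneg] at key
  rcases key with ⟨p, hp⟩ | ⟨p, hp⟩ | ⟨p, hp⟩ | ⟨p, hp⟩
  · exact Or.inl ⟨p, Subtype.ext hp.symm⟩
  · exact Or.inr (Or.inl ⟨p, Subtype.ext (neg_eq_iff_eq_neg.1 hp.symm)⟩)
  · exact Or.inr (Or.inr (Or.inl ⟨p, Subtype.ext hp.symm⟩))
  · exact Or.inr (Or.inr (Or.inr ⟨p, Subtype.ext (neg_eq_iff_eq_neg.1 hp.symm)⟩))

@[simp] theorem Root.coe_neg (a : Root) : (-a).1 = -a.1 := rfl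

theorem Root.neg_neg (a : Root) : -(-a) = a := Subtype.ext (_root_.neg_neg a.1)

theorem gammaVec_injective : Function.Injective gammaVec := by decide +kernel

theorem betaVec_injective : Function.Injective betaVec := by decide +kernel

theorem gammaVec_ne_neg : ∀ p q, gammaVec p ≠ -gammaVec q := by decide +kernel

theorem beta_injective : Function.Injective beta := fun _ _ h =>
  betaVec_injective (congrArg Subtype.val h)

/-- The map that lists the roots as `γ_p`, `-γ_p`, `β_i`, `-β_i`. -/
def rootOfIndex : (Fin 20 ⊕ Fin 20) ⊕ (Fin 16 ⊕ Fin 16) → Root :=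
  Sum.elim (Sum.elim gamma fun p => -gamma p) (Sum.elim beta fun i => -beta i)

/-- The coefficient at `α₆` is `0`, `1` or `-1` and separates `±γ`, `β` and `-β`. Only a coincidence
of some `γ_p` with some `-γ_q` then has to be excluded separately. -/
theorem rootOfIndex_bijective : Function.Bijective rootOfIndex := by
  constructor
  · have five : ∀ x, (rootOfIndex x).1 5 = Sum.elim (fun _ => 0) (Sum.elim (fun _ => 1)
        fun _ => -1) x := by
      rintro ((p | p) | (i | i)) <;>
        simp [rootOfIndex, gamma, beta, gammaVec_five, betaVec_five]
    intro x y h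
    have h5 := (five x).symm.trans ((congrArg (fun a : Root => a.1 5) h).trans (five y))
    have hv : (rootOfIndex x).1 = (rootOfIndex y).1 := congrArg Subtype.val h
    rcases x with ((p | p) | (i | i)) <;> rcases y with ((q | q) | (j | j)) <;>
      simp at h5 <;> simp [rootOfIndex, gamma, beta] at hv
    · rw [gammaVec_injective hv]
    · exact absurd hv (gammaVec_ne_neg p q)
    · exact absurd hv.symm (gammaVec_ne_neg q p)
    · rw [gammaVec_injective hv]
    · rw [betaVec_injective hv]
    · rw [betaVec_injective hv]
  · intro a
    rcases root_cases a with ⟨p, rfl⟩ | ⟨p, rfl⟩ | ⟨p, rfl⟩ | ⟨p, rfl⟩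
    · exact ⟨Sum.inl (Sum.inl p), rfl⟩
    · exact ⟨Sum.inl (Sum.inr p), rfl⟩
    · exact ⟨Sum.inr (Sum.inl p), rfl⟩
    · exact ⟨Sum.inr (Sum.inr p), rfl⟩

instance : Fintype Root :=
  Fintype.ofBijective rootOfIndex rootOfIndex_bijective

theorem sum_root {A : Type*} [AddCommMonoid A] (f : Root → A) : ∑ a, f a =
    ∑ p, (f (gamma p) + f (-gamma p)) + ∑ i, (f (beta i) + f (-beta i)) := by
  rw [← Function.Bijective.sum_comp rootOfIndex_bijective f, Fintype.sum_sum_type,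
    Fintype.sum_sum_type, Fintype.sum_sum_type, Finset.sum_add_distrib, Finset.sum_add_distrib]
  rfl

/-! ### Brackets of basis vectors, and the grading by the coefficient at `α₆` -/

namespace E6

theorem lie_H_H (h h' : Fin 6 → ℂ) : ⁅ofH h, ofH h'⁆ = 0 := bracketMap_H_H h h'

theorem lie_H_E (h : Fin 6 → ℂ) (a : Root) : ⁅ofH h, E a⁆ = form h (latticeH a.1) • E a :=
  bracketMap_H_E h a

theorem lie_E_E (a b : Root) : ⁅E a, E b⁆ = rootBracket a b := bracketMap_E_E a b

theorem lie_E_neg (a : Root) : ⁅E a, E (-a)⁆ = -ofH (latticeH a.1) := by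
  rw [lie_E_E, rootBracket, if_pos]; simp

theorem eq_ofH_add_sum (x : E6) : x = ofH (hPart x) + ∑ a, ePart x a • E a := by
  have h1 : x = ofH (hPart x) + ofE (ePart x) := Prod.ext (add_zero _).symm (zero_add _).symm
  have h2 : ePart x = ∑ a, ePart x a • Finsupp.single a (1 : ℂ) := by
    conv_lhs => rw [← Finsupp.univ_sum_single (ePart x)]
    simp
  conv_lhs => rw [h1, h2, map_sum]
  simp only [map_smul]
  rfl

/-- The element of `H` with `(·, α₆) = 1` and `(·, α_i) = 0` for `i ≤ 5`. -/
def gradH : Fin 6 → ℂ := ![2 / 3, 1, 4 / 3, 2, 5 / 3, 4 / 3]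

theorem form_gradH (a : Fin 6 → ℂ) : form gradH a = a 5 := by
  simp only [form, gradH]; simp; ring

theorem ePart_lie_gradH (x : E6) (a : Root) :
    ePart ⁅ofH gradH, x⁆ a = (a.1 5 : ℂ) * ePart x a := by
  induction x using induction with
  | hH h => simp [lie_H_H, ePart_ofH]
  | hE b =>
    rw [lie_H_E, form_gradH, map_smul, ePart_E]
    by_cases hab : b = a
    · subst hab; simp [latticeH]
    · simp [hab]
  | hadd x y hx hy => simp only [lie_add, map_add, Finsupp.add_apply, hx, hy]; ring
  | hsmul r x hx => simp only [lie_smul, map_smul, Finsupp.smul_apply, hx, smul_eq_mul]; ring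

theorem hPart_lie_gradH (x : E6) : hPart ⁅ofH gradH, x⁆ = 0 := by
  induction x using induction with
  | hH h => simp [lie_H_H]
  | hE b => rw [lie_H_E, map_smul, hPart_E, smul_zero]
  | hadd x y hx hy => simp only [lie_add, map_add, hx, hy, add_zero]
  | hsmul r x hx => simp only [lie_smul, map_smul, hx, smul_zero]

/-- `x` is homogeneous of degree `d` for the grading `𝒢 = 𝒢₋ ⊕ 𝒢₀ ⊕ 𝒢₊`. -/
def IsDeg (d : ℤ) (x : E6) : Prop := ⁅ofH gradH, x⁆ = (d : ℂ) • x

theorem IsDeg.lie {d e : ℤ} {x y : E6} (hx : IsDeg d x) (hy : IsDeg e y) :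
    IsDeg (d + e) ⁅x, y⁆ := by
  unfold IsDeg at *
  rw [leibniz_lie, hx, hy, smul_lie, lie_smul, ← add_smul]
  push_cast
  rfl

theorem IsDeg.add {d : ℤ} {x y : E6} (hx : IsDeg d x) (hy : IsDeg d y) : IsDeg d (x + y) := by
  unfold IsDeg at *
  rw [lie_add, hx, hy, smul_add]

theorem IsDeg.smul {d : ℤ} {x : E6} (r : ℂ) (hx : IsDeg d x) : IsDeg d (r • x) := by
  unfold IsDeg at *
  rw [lie_smul, hx, smul_comm]

theorem isDeg_zero (d : ℤ) : IsDeg d 0 := by simp [IsDeg]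

theorem isDeg_E (a : Root) : IsDeg (a.1 5) (E a) := by
  rw [IsDeg, lie_H_E, form_gradH]; rfl

theorem isDeg_ofH (h : Fin 6 → ℂ) : IsDeg 0 (ofH h) := by
  rw [IsDeg, lie_H_H]; simp

theorem IsDeg.ePart_eq_zero {d : ℤ} {x : E6} (hx : IsDeg d x) {a : Root} (ha : a.1 5 ≠ d) :
    ePart x a = 0 := by
  have h := ePart_lie_gradH x a
  rw [hx, map_smul, Finsupp.smul_apply, smul_eq_mul, ← sub_eq_zero, ← sub_mul] at h
  refine (mul_eq_zero.1 h).resolve_left ?_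
  exact sub_ne_zero.2 (by exact_mod_cast ha.symm)

theorem IsDeg.hPart_eq_zero {d : ℤ} {x : E6} (hx : IsDeg d x) (hd : d ≠ 0) : hPart x = 0 := by
  have h := hPart_lie_gradH x
  rw [hx, map_smul] at h
  exact (smul_eq_zero.1 h).resolve_left (by exact_mod_cast hd)

end E6

open E6

theorem isDeg_xi (i : Fin 16) : IsDeg 1 (xi i) := by
  have := isDeg_E (beta i)
  rwa [show (beta i).1 5 = 1 from betaVec_five i] at this

theorem isDeg_eta (i : Fin 16) : IsDeg (-1) (eta i) := by
  have := isDeg_E (-beta i)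
  rwa [show (-beta i).1 5 = -1 from congrArg Neg.neg (betaVec_five i)] at this

theorem isDeg_gamma (p : Fin 20) : IsDeg 0 (E (gamma p)) := by
  have := isDeg_E (gamma p)
  rwa [show (gamma p).1 5 = 0 from gammaVec_five p] at this

theorem isDeg_neg_gamma (p : Fin 20) : IsDeg 0 (E (-gamma p)) := by
  have := isDeg_E (-gamma p)
  rwa [show (-gamma p).1 5 = 0 by simp [gamma, gammaVec_five p]] at this

theorem E6.IsDeg.xiCoeff_eq_zero {d : ℤ} {x : E6} (hx : IsDeg d x) (hd : d ≠ 1) (i : Fin 16) :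
    xiCoeff i x = 0 :=
  hx.ePart_eq_zero (by rw [show (beta i).1 5 = 1 from betaVec_five i]; exact hd.symm)

theorem E6.IsDeg.etaCoeff_eq_zero {d : ℤ} {x : E6} (hx : IsDeg d x) (hd : d ≠ -1) (i : Fin 16) :
    etaCoeff i x = 0 :=
  hx.ePart_eq_zero (by
    rw [show (-beta i).1 5 = -1 from congrArg Neg.neg (betaVec_five i)]; exact hd.symm)

/-- The component in `𝒢₀`. -/
def zeroPart (x : E6) : E6 := ofH (hPart x) +
  ∑ p, (ePart x (gamma p) • E (gamma p) + ePart x (-gamma p) • E (-gamma p))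

theorem isDeg_sum {ι : Type*} (s : Finset ι) {d : ℤ} {f : ι → E6} (h : ∀ i ∈ s, IsDeg d (f i)) :
    IsDeg d (∑ i ∈ s, f i) :=
  Finset.sum_induction f (IsDeg d) (fun _ _ => IsDeg.add) (isDeg_zero d) h

theorem isDeg_zeroPart (x : E6) : IsDeg 0 (zeroPart x) :=
  (isDeg_ofH _).add (isDeg_sum _ fun p _ =>
    ((isDeg_gamma p).smul _).add ((isDeg_neg_gamma p).smul _))

theorem eq_sum_parts (x : E6) : x = zeroPart x + ∑ i, xiCoeff i x • xi i
    + ∑ i, etaCoeff i x • eta i := by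
  conv_lhs => rw [eq_ofH_add_sum x, sum_root,
    Finset.sum_add_distrib (s := (Finset.univ : Finset (Fin 16)))]
  rw [zeroPart, add_assoc, add_assoc]
  rfl

theorem E6.IsDeg.eq_zeroPart {x : E6} (hx : IsDeg 0 x) : x = zeroPart x := by
  conv_lhs => rw [eq_sum_parts x]
  simp [hx.xiCoeff_eq_zero, hx.etaCoeff_eq_zero]

theorem zeroPart_eq_zero {d : ℤ} {x : E6} (hx : IsDeg d x) (hd : d ≠ 0) : zeroPart x = 0 := by
  rw [zeroPart, hx.hPart_eq_zero hd, map_zero, zero_add]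
  refine Finset.sum_eq_zero fun p _ => ?_
  rw [hx.ePart_eq_zero, hx.ePart_eq_zero, zero_smul, zero_smul, add_zero]
  · simpa [gamma, gammaVec_five] using hd.symm
  · simpa [gamma, gammaVec_five] using hd.symm

theorem E6.IsDeg.eq_sum_xi {x : E6} (hx : IsDeg 1 x) : x = ∑ i, xiCoeff i x • xi i := by
  conv_lhs => rw [eq_sum_parts x, zeroPart_eq_zero hx one_ne_zero]
  simp [hx.etaCoeff_eq_zero]

theorem E6.IsDeg.eq_sum_eta {x : E6} (hx : IsDeg (-1) x) : x = ∑ i, etaCoeff i x • eta i := by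
  conv_lhs => rw [eq_sum_parts x, zeroPart_eq_zero hx (by norm_num)]
  simp [hx.xiCoeff_eq_zero]

/-- The grading has no degrees besides `-1`, `0`, `1`. In particular `𝒢₊` and `𝒢₋` are abelian. -/
theorem E6.IsDeg.eq_zero {d : ℤ} {x : E6} (hx : IsDeg d x) (h0 : d ≠ 0) (h1 : d ≠ 1)
    (h2 : d ≠ -1) : x = 0 := by
  rw [eq_sum_parts x, zeroPart_eq_zero hx h0]
  simp [hx.xiCoeff_eq_zero h1, hx.etaCoeff_eq_zero h2]

theorem lie_xi_xi (i j : Fin 16) : ⁅xi i, xi j⁆ = 0 :=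
  ((isDeg_xi i).lie (isDeg_xi j)).eq_zero (by norm_num) (by norm_num) (by norm_num)

theorem lie_eta_eta (i j : Fin 16) : ⁅eta i, eta j⁆ = 0 :=
  ((isDeg_eta i).lie (isDeg_eta j)).eq_zero (by norm_num) (by norm_num) (by norm_num)

theorem isDeg_lie_xi_eta (i j : Fin 16) : IsDeg 0 ⁅xi i, eta j⁆ := by
  simpa using (isDeg_xi i).lie (isDeg_eta j)

theorem xiCoeff_xi (i j : Fin 16) : xiCoeff i (xi j) = if i = j then 1 else 0 := by
  change (Finsupp.single (beta j) (1 : ℂ)) (beta i) = _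
  rw [Finsupp.single_apply]
  simp only [beta_injective.eq_iff, eq_comm]

theorem neg_beta_injective : Function.Injective fun i => -beta i := fun i j h =>
  beta_injective (by simpa only [Root.neg_neg] using congrArg Neg.neg h)

theorem etaCoeff_eta (i j : Fin 16) : etaCoeff i (eta j) = if i = j then 1 else 0 := by
  change (Finsupp.single (-beta j) (1 : ℂ)) (-beta i) = _
  rw [Finsupp.single_apply]
  simp only [neg_beta_injective.eq_iff, eq_comm]

/-! ### The invariant form -/

/-- The invariant symmetric bilinear form with `B(E_α, E_{-α}) = -1` that extends `(·, ·)`. -/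
def killing (x y : E6) : ℂ := form (hPart x) (hPart y) - ∑ a, ePart x a * ePart y (-a)

theorem killing_add_left (x x' y : E6) : killing (x + x') y = killing x y + killing x' y := by
  simp only [killing, map_add, Finsupp.add_apply, add_mul, Finset.sum_add_distrib, form,
    Pi.add_apply]
  ring

theorem killing_smul_left (r : ℂ) (x y : E6) : killing (r • x) y = r * killing x y := by
  simp only [killing, map_smul, Finsupp.smul_apply, smul_eq_mul, mul_assoc, ← Finset.mul_sum, form,
    Pi.smul_apply]
  ring

/-- Negation of roots as a permutation. -/
def negRoot : Root ≃ Root := ⟨Neg.neg, Neg.neg, Root.neg_neg, Root.neg_neg⟩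

theorem killing_comm (x y : E6) : killing x y = killing y x := by
  unfold killing
  congr 1
  · simp only [form]; ring
  · rw [← Equiv.sum_comp negRoot]
    refine Finset.sum_congr rfl fun a _ => ?_
    change ePart x (-a) * ePart y (-(-a)) = _
    rw [Root.neg_neg, mul_comm]

theorem killing_add_right (x y y' : E6) : killing x (y + y') = killing x y + killing x y' := by
  rw [killing_comm, killing_add_left, killing_comm y, killing_comm y']

theorem killing_smul_right (r : ℂ) (x y : E6) : killing x (r • y) = r * killing x y := by
  rw [killing_comm, killing_smul_left, killing_comm]

theorem killing_E_right (x : E6) (a : Root) : killing x (E a) = -ePart x (-a) := by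
  rw [killing, hPart_E, ePart_E, Finset.sum_eq_single (-a)]
  · rw [Root.neg_neg]; simp [form]
  · intro b _ hb
    rw [Finsupp.single_apply, if_neg, mul_zero]
    rintro rfl
    exact hb (Root.neg_neg b).symm
  · simp

theorem killing_ofH_right (x : E6) (h : Fin 6 → ℂ) : killing x (ofH h) = form (hPart x) h := by
  simp [killing, hPart_ofH, ePart_ofH]

theorem killing_H_E (h : Fin 6 → ℂ) (a : Root) : killing (ofH h) (E a) = 0 := by
  rw [killing_E_right, ePart_ofH]; simp

theorem killing_E_H (h : Fin 6 → ℂ) (a : Root) : killing (E a) (ofH h) = 0 := by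
  rw [killing_comm, killing_H_E]

theorem killing_E_E (a b : Root) : killing (E a) (E b) = if a.1 + b.1 = 0 then -1 else 0 := by
  rw [killing_E_right, ePart_E, Finsupp.single_apply]
  have : a = -b ↔ a.1 + b.1 = 0 := by
    rw [add_eq_zero_iff_eq_neg, ← Root.coe_neg, Subtype.ext_iff]
  simp only [this]
  split_ifs <;> simp

theorem form_symm {R : Type*} [CommRing R] (a b : Fin 6 → R) : form a b = form b a := by
  simp only [form]; ring

theorem killing_rootBracket_H (a b : Root) (h : Fin 6 → ℂ) : killing (rootBracket a b) (ofH h)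
    = if a.1 + b.1 = 0 then -form h (latticeH a.1) else 0 := by
  rw [rootBracket, killing_ofH_right]
  split_ifs with h0
  · rw [map_neg, hPart_ofH]; simp only [form, Pi.neg_apply]; ring
  · rw [map_smul, EOrZero]
    split_ifs with h1
    · rw [hPart_E]; simp [form]
    · simp [form]

theorem killing_EOrZero_E (v : Fin 6 → ℤ) (c : Root) : killing (EOrZero v) (E c)
    = if v + c.1 = 0 then -1 else 0 := by
  rw [EOrZero]
  split_ifs with h1 h2 h2
  · rw [killing_E_E, if_pos h2]
  · rw [killing_E_E, if_neg h2]
  · refine absurd ?_ h1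
    rw [eq_neg_of_add_eq_zero_left h2, form_neg_neg, c.2]
  · rw [killing_E_right]; simp

theorem killing_rootBracket_E (a b c : Root) : killing (rootBracket a b) (E c)
    = if a.1 + b.1 + c.1 = 0 then -(F a.1 b.1 : ℂ) else 0 := by
  rw [rootBracket]
  split_ifs with h0 h1 h1
  · rw [h0, zero_add] at h1
    have := c.2
    rw [h1] at this
    simp [form] at this
  · rw [← map_neg, killing_H_E]
  · rw [killing_smul_left, killing_EOrZero_E, if_pos h1]; ring
  · rw [killing_smul_left, killing_EOrZero_E, if_neg h1, mul_zero]

/-- Here `c = -(a + b)` and `(a, b) = -1`, so `F(b, c) = F(b, a) F(b, b)`, where both factors bring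
a sign. This cyclic symmetry of the structure constants is the only nontrivial case of invariance of
the form. -/
theorem F_rotate (a b c : Root) (h : a.1 + b.1 + c.1 = 0) : F a.1 b.1 = F b.1 c.1 := by
  have hc : c.1 = -(a.1 + b.1) := eq_neg_of_add_eq_zero_right h
  have hf : form a.1 b.1 = -1 := by
    have h2 := form_add_self a.1 b.1
    have h3 := form_neg_neg (a.1 + b.1) (a.1 + b.1)
    rw [← hc, c.2] at h3
    rw [← h3, a.2, b.2] at h2
    omega
  rw [hc, F_neg_right, F_add_right, F_root, F_swap_of_odd _ _ hf]
  ring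

theorem lie_E_H (a : Root) (h : Fin 6 → ℂ) : ⁅E a, ofH h⁆ = -(form h (latticeH a.1) • E a) :=
  bracketMap_E_H h a

theorem killing_neg_left (x y : E6) : killing (-x) y = -killing x y := by
  rw [← neg_one_smul ℂ, killing_smul_left]; ring

theorem killing_neg_right (x y : E6) : killing x (-y) = -killing x y := by
  rw [killing_comm, killing_neg_left, killing_comm]

theorem killing_zero_left (y : E6) : killing 0 y = 0 := by
  rw [← zero_smul ℂ (0 : E6), killing_smul_left]; ring

theorem killing_zero_right (x : E6) : killing x 0 = 0 := by
  rw [killing_comm, killing_zero_left]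

theorem form_latticeH_of_add_eq_zero (h : Fin 6 → ℂ) {a b : Root} (hab : a.1 + b.1 = 0) :
    form h (latticeH b.1) = -form h (latticeH a.1) := by
  rw [eq_neg_of_add_eq_zero_right hab]
  simp only [form, latticeH, Pi.neg_apply]; push_cast; ring

/-- Both sides are trilinear, so basis vectors suffice. Three root vectors contribute only when the
roots sum to zero, and then `F_rotate` applies. -/
theorem killing_lie (x y z : E6) : killing ⁅x, y⁆ z = killing x ⁅y, z⁆ := by
  induction x using E6.induction with
  | hadd x x' hx hx' => rw [add_lie, killing_add_left, killing_add_left, hx, hx']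
  | hsmul r x hx => rw [smul_lie, killing_smul_left, killing_smul_left, hx]
  | hH h =>
    induction y using E6.induction with
    | hadd x x' hx hx' => rw [lie_add, add_lie, killing_add_left, killing_add_right, hx, hx']
    | hsmul r x hx => rw [lie_smul, smul_lie, killing_smul_left, killing_smul_right, hx]
    | hH h' =>
      induction z using E6.induction with
      | hadd x x' hx hx' => rw [lie_add, killing_add_right, killing_add_right, hx, hx']
      | hsmul r x hx => rw [lie_smul, killing_smul_right, killing_smul_right, hx]
      | hH h'' => rw [lie_H_H, lie_H_H, killing_zero_left, killing_zero_right]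
      | hE a =>
        rw [lie_H_H, lie_H_E, killing_zero_left, killing_smul_right, killing_H_E, mul_zero]
    | hE a =>
      induction z using E6.induction with
      | hadd x x' hx hx' => rw [lie_add, killing_add_right, killing_add_right, hx, hx']
      | hsmul r x hx => rw [lie_smul, killing_smul_right, killing_smul_right, hx]
      | hH h'' =>
        rw [lie_H_E, lie_E_H, killing_smul_left, killing_E_H, killing_neg_right,
          killing_smul_right, killing_H_E]
        simp
      | hE b =>
        rw [lie_H_E, lie_E_E, killing_smul_left, killing_comm (ofH h), killing_rootBracket_H,
          killing_E_E]
        split_ifs <;> simp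
  | hE a =>
    induction y using E6.induction with
    | hadd x x' hx hx' => rw [lie_add, add_lie, killing_add_left, killing_add_right, hx, hx']
    | hsmul r x hx => rw [lie_smul, smul_lie, killing_smul_left, killing_smul_right, hx]
    | hH h' =>
      induction z using E6.induction with
      | hadd x x' hx hx' => rw [lie_add, killing_add_right, killing_add_right, hx, hx']
      | hsmul r x hx => rw [lie_smul, killing_smul_right, killing_smul_right, hx]
      | hH h'' =>
        rw [lie_H_H, lie_E_H, killing_neg_left, killing_smul_left, killing_E_H,
          killing_zero_right]
        simp
      | hE b =>
        rw [lie_E_H, lie_H_E, killing_neg_left, killing_smul_left, killing_smul_right,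
          killing_E_E]
        split_ifs with h0
        · rw [form_latticeH_of_add_eq_zero h' h0]; ring
        · simp
    | hE b =>
      induction z using E6.induction with
      | hadd x x' hx hx' => rw [lie_add, killing_add_right, killing_add_right, hx, hx']
      | hsmul r x hx => rw [lie_smul, killing_smul_right, killing_smul_right, hx]
      | hH h'' =>
        rw [lie_E_E, lie_E_H, killing_rootBracket_H, killing_neg_right, killing_smul_right,
          killing_E_E]
        split_ifs with h0
        · rw [form_latticeH_of_add_eq_zero h'' h0]; ring
        · simp
      | hE c =>
        rw [lie_E_E, lie_E_E, killing_rootBracket_E, killing_comm (E a), killing_rootBracket_E]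
        have hrot : b.1 + c.1 + a.1 = a.1 + b.1 + c.1 := by abel
        rw [hrot]
        split_ifs with h0
        · rw [F_rotate a b c h0]
        · rfl

theorem etaCoeff_eq_killing (j : Fin 16) (x : E6) : etaCoeff j x = -killing x (xi j) := by
  rw [xi, killing_E_right, neg_neg]; rfl

theorem xiCoeff_eq_killing (j : Fin 16) (x : E6) : xiCoeff j x = -killing x (eta j) := by
  rw [eta, killing_E_right, neg_neg, Root.neg_neg]; rfl

/-- The form pairs `𝒢₋` with `𝒢₊`, so by invariance the matrix of `ad u` on one is minus the
transpose of its matrix on the other. -/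
theorem etaCoeff_lie_eta (u : E6) (i j : Fin 16) :
    etaCoeff j ⁅u, eta i⁆ = -xiCoeff i ⁅u, xi j⁆ := by
  rw [etaCoeff_eq_killing, xiCoeff_eq_killing, ← lie_skew, killing_neg_left, killing_lie,
    killing_comm]

theorem lie_xi_eta_self (i : Fin 16) : ⁅xi i, eta i⁆ = -ofH (latticeH (betaVec i)) :=
  lie_E_neg (beta i)

end XuE6
end

noncomputable section

namespace XuE6

open E6

/-! ### The isomorphism of `𝒢^{D₅}` with `o(10, ℂ)` -/

/-- The weights `±ε_i` of the natural module of `o(10, ℂ)`. -/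
def natWeight : Fin 5 ⊕ Fin 5 → Fin 5 → ℤ :=
  Sum.elim (fun i j => if j = i then 1 else 0) (fun i j => if j = i then -1 else 0)

/-- The entries of the matrices of the root vectors in the natural module. -/
def natSign : Fin 5 ⊕ Fin 5 → Fin 5 ⊕ Fin 5 → ℤ
  | .inl i, .inl j => signMinus i j
  | .inl i, .inr j => signPlus i j
  | .inr i, .inl j => signPlus i j
  | .inr i, .inr j => -signMinus j i

/-- The matrix of the root vector of the root `∑ e_i ε_i` of `o(10, ℂ)`. -/
def nuMat (e : Fin 5 → ℤ) : Matrix (Fin 5 ⊕ Fin 5) (Fin 5 ⊕ Fin 5) ℂ :=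
  Matrix.of fun x y => if e = natWeight x - natWeight y then (natSign x y : ℂ) else 0

/-- The four blocks merge into one rule: the entry at `(x, y)` is nonzero only if the root is the
difference of the weights of `x` and `y` in the natural module. This makes commutators of root
vectors amenable to a uniform finite check. -/
theorem coe_nuInvRoot (γ : Root) (h : γ.1 5 = 0) :
    (nuInvRoot γ : Matrix (Fin 5 ⊕ Fin 5) (Fin 5 ⊕ Fin 5) ℂ) = nuMat (epsInt γ.1) := by
  have hs : ∀ i : Fin 5, (Pi.single i 1 : Fin 5 → ℤ) = natWeight (.inl i) := fun i => by
    funext j; simp [natWeight, Pi.single_apply]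
  have hr : ∀ i : Fin 5, natWeight (.inr i) = -natWeight (.inl i) := fun i => by
    funext j; simp only [natWeight, Sum.elim_inr, Sum.elim_inl, Pi.neg_apply]; split_ifs <;> simp
  rw [nuInvRoot, if_pos h]
  simp only [O10.mk, hs]
  ext (i | i) (j | j)
  · simp [nuMat, natSign]
  · simp [nuMat, natSign, hr]
  · simp [nuMat, natSign, hr, sub_eq_add_neg, add_comm]
  · simp [nuMat, natSign, hr, sub_eq_add_neg, add_comm]
    split_ifs <;> simp

/-- The sum over the weights of the natural module, written out. -/
def natSum (f : Fin 5 ⊕ Fin 5 → ℤ) : ℤ :=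
  f (.inl 0) + f (.inl 1) + f (.inl 2) + f (.inl 3) + f (.inl 4)
    + (f (.inr 0) + f (.inr 1) + f (.inr 2) + f (.inr 3) + f (.inr 4))

theorem sum_eq_natSum (f : Fin 5 ⊕ Fin 5 → ℤ) : ∑ x, f x = natSum f := by
  rw [Fintype.sum_sum_type, Fin.sum_univ_five, Fin.sum_univ_five, natSum]

/-- The vector `∑ a_i α_i` of the root lattice of `D₅` in terms of its coordinates with respect to
`ε₁, …, ε₅`. -/
def ofEps (e : Fin 5 → ℤ) : Fin 6 → ℤ :=
  ![e 0, (e 0 + e 1 + e 2 + e 3 + e 4) / 2, e 0 + e 1, e 0 + e 1 + e 2,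
    (e 0 + e 1 + e 2 + e 3 - e 4) / 2, 0]

/-- The integer divisions in `ofEps` are exact here: the two numerators are twice the coefficients
at `α₂` and at `α₅`. -/
theorem ofEps_epsInt (a : Fin 6 → ℤ) (h : a 5 = 0) : ofEps (epsInt a) = a := by
  funext i
  fin_cases i <;> simp [ofEps, epsInt] <;> omega

theorem epsInt_add (a b : Fin 6 → ℤ) : epsInt (a + b) = epsInt a + epsInt b := by
  funext i
  fin_cases i <;> simp [epsInt] <;> ring

/-- The entries of the commutator of the matrices of two root vectors. -/
def commEntry (e e' : Fin 5 → ℤ) (x z : Fin 5 ⊕ Fin 5) : ℤ :=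
  natSum fun y => (if e = natWeight x - natWeight y then natSign x y * natSign y z else 0)
    - (if e' = natWeight x - natWeight y then natSign x y * natSign y z else 0)

/-- The entries of the matrix of the bracket of two root vectors. -/
def bracketEntry (a b : Fin 6 → ℤ) (x z : Fin 5 ⊕ Fin 5) : ℤ :=
  if a + b = 0 then
    if x = z then -(∑ i, epsInt a i * natWeight x i) else 0
  else if form (a + b) (a + b) = 2 then
    (if cocycleExp a b % 2 = 0 then 1 else -1) * natSign x z
  else 0

/-- For a fixed entry `(x, z)` the second root is determined by the first, because the two must sum
to the difference of the weights of `x` and `z`. So the enumeration runs over one root and one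
entry, and the hypothesis on the form says that the remaining vector is a root. -/
theorem commEntry_gamma : ∀ p : Fin 20, ∀ x z : Fin 5 ⊕ Fin 5,
    form (ofEps (natWeight x - natWeight z - epsInt (gammaVec p)))
      (ofEps (natWeight x - natWeight z - epsInt (gammaVec p))) = 2 →
    commEntry (epsInt (gammaVec p)) (natWeight x - natWeight z - epsInt (gammaVec p)) x z
      = bracketEntry (gammaVec p) (ofEps (natWeight x - natWeight z - epsInt (gammaVec p))) x z := by
  decide +kernel

theorem commEntry_neg_gamma : ∀ p : Fin 20, ∀ x z : Fin 5 ⊕ Fin 5,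
    form (ofEps (natWeight x - natWeight z - epsInt (-gammaVec p)))
      (ofEps (natWeight x - natWeight z - epsInt (-gammaVec p))) = 2 →
    commEntry (epsInt (-gammaVec p)) (natWeight x - natWeight z - epsInt (-gammaVec p)) x z
      = bracketEntry (-gammaVec p)
        (ofEps (natWeight x - natWeight z - epsInt (-gammaVec p))) x z := by
  decide +kernel

end XuE6
end

noncomputable section

namespace XuE6

open E6

theorem natWeight_injective : Function.Injective natWeight := by decide +kernel

theorem O10.coe_lie (A B : O10) :
    (⁅A, B⁆ : O10).1 = A.1 * B.1 - B.1 * A.1 := rfl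

theorem O10.coe_smul (r : ℂ) (A : O10) : (r • A).1 = r • A.1 := rfl

theorem O10.coe_neg (A : O10) : (-A).1 = -A.1 := rfl

theorem O10.coe_sum {ι : Type*} (s : Finset ι) (f : ι → O10) :
    (∑ i ∈ s, f i).1 = ∑ i ∈ s, (f i).1 :=
  AddSubmonoidClass.coe_finsetSum f s

theorem rhoO_E (a : Root) : rhoO (E a) = nuInvRoot a := by
  have h : ∀ i, epsCoord 0 i = 0 := by intro i; fin_cases i <;> simp [epsCoord]
  simp [rhoO, hPart_E, ePart_E, h]

theorem coe_cartan (i : Fin 5) : (O10.cartan i : Matrix (Fin 5 ⊕ Fin 5) (Fin 5 ⊕ Fin 5) ℂ)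
    = Matrix.diagonal fun x => (natWeight x i : ℂ) := by
  simp only [O10.cartan, O10.mk]
  ext (x | x) (y | y)
  · by_cases h : x = y
    · subst h
      simp [natWeight, Matrix.single_apply, eq_comm]
    · simp [h, Matrix.single_apply]
      rintro rfl rfl; exact h rfl
  · simp
  · simp
  · by_cases h : x = y
    · subst h
      simp [natWeight, Matrix.single_apply, eq_comm, apply_ite]
    · simp [h, Matrix.single_apply]
      rintro rfl rfl; exact h rfl

theorem rhoO_ofH (h : Fin 6 → ℂ) : rhoO (ofH h) = ∑ i, epsCoord h i • O10.cartan i := by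
  simp [rhoO, hPart_ofH, ePart_ofH]

theorem coe_rhoO_ofH (h : Fin 6 → ℂ) :
    (rhoO (ofH h) : Matrix (Fin 5 ⊕ Fin 5) (Fin 5 ⊕ Fin 5) ℂ)
    = Matrix.diagonal fun x => ∑ i, epsCoord h i * (natWeight x i : ℂ) := by
  rw [rhoO_ofH]
  ext x y
  simp only [O10.coe_sum, O10.coe_smul, coe_cartan,
    Matrix.sum_apply, Matrix.smul_apply, Matrix.diagonal_apply, smul_eq_mul]
  split_ifs <;> simp

theorem epsCoord_latticeH (a : Fin 6 → ℤ) (h : a 5 = 0) (i : Fin 5) :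
    epsCoord (latticeH a) i = (epsInt a i : ℂ) := by
  fin_cases i <;> simp [epsCoord, epsInt, latticeH, h]

theorem F_eq_ite (a b : Fin 6 → ℤ) : F a b = if cocycleExp a b % 2 = 0 then 1 else -1 := by
  unfold F
  split_ifs with h
  · rw [Int.negOnePow_even _ (Int.even_iff.2 h)]; rfl
  · rw [Int.negOnePow_odd _ (Int.odd_iff.2 (by omega))]; rfl

theorem coe_rhoO_rootBracket (a b : Root) (ha : a.1 5 = 0) (hb : b.1 5 = 0)
    (x z : Fin 5 ⊕ Fin 5) :
    (rhoO (rootBracket a b) : Matrix (Fin 5 ⊕ Fin 5) (Fin 5 ⊕ Fin 5) ℂ) x z =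
      if epsInt a.1 + epsInt b.1 = natWeight x - natWeight z
      then (bracketEntry a.1 b.1 x z : ℂ) else 0 := by
  unfold rootBracket bracketEntry
  by_cases h0 : a.1 + b.1 = 0
  · have he : epsInt a.1 + epsInt b.1 = 0 := by
      rw [← epsInt_add, h0]; funext i; fin_cases i <;> simp [epsInt]
    rw [if_pos h0, if_pos h0, he, map_neg, O10.coe_neg, coe_rhoO_ofH]
    by_cases hxz : x = z
    · subst hxz
      simp [epsCoord_latticeH _ ha]
    · have : ¬ (0 : Fin 5 → ℤ) = natWeight x - natWeight z := fun h =>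
        hxz (natWeight_injective (sub_eq_zero.1 h.symm))
      simp [hxz]
  · rw [if_neg h0, if_neg h0, map_smul, O10.coe_smul, EOrZero]
    by_cases h1 : form (a.1 + b.1) (a.1 + b.1) = 2
    · rw [dif_pos h1, if_pos h1, rhoO_E, coe_nuInvRoot _ (by simp [ha, hb])]
      rw [← F_eq_ite, ← epsInt_add]
      simp only [Matrix.smul_apply, nuMat, Matrix.of_apply, smul_eq_mul]
      split_ifs <;> simp
    · rw [dif_neg h1, if_neg h1]
      simp

theorem commEntry_root (a : Root) (ha : a.1 5 = 0) (x z : Fin 5 ⊕ Fin 5)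
    (h : form (ofEps (natWeight x - natWeight z - epsInt a.1))
      (ofEps (natWeight x - natWeight z - epsInt a.1)) = 2) :
    commEntry (epsInt a.1) (natWeight x - natWeight z - epsInt a.1) x z
      = bracketEntry a.1 (ofEps (natWeight x - natWeight z - epsInt a.1)) x z := by
  rcases root_cases a with ⟨p, rfl⟩ | ⟨p, rfl⟩ | ⟨i, rfl⟩ | ⟨i, rfl⟩
  · exact commEntry_gamma p x z h
  · exact commEntry_neg_gamma p x z h
  · rw [show (beta i).1 5 = 1 from betaVec_five i] at ha; norm_num at ha
  · rw [show (-beta i).1 5 = -1 from congrArg Neg.neg (betaVec_five i)] at ha; norm_num at ha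

/-- The entry `(x, z)` of either side vanishes unless the two roots add up to the difference of the
weights of `x` and `z`. In that case the enumeration behind `commEntry_root` gives the equality. -/
theorem rhoO_lie_E_E (a b : Root) (ha : a.1 5 = 0) (hb : b.1 5 = 0) :
    rhoO ⁅E a, E b⁆ = ⁅rhoO (E a), rhoO (E b)⁆ := by
  apply Subtype.ext
  rw [lie_E_E, O10.coe_lie, rhoO_E, rhoO_E, coe_nuInvRoot a ha, coe_nuInvRoot b hb]
  ext x z
  rw [coe_rhoO_rootBracket a b ha hb, Matrix.sub_apply, Matrix.mul_apply, Matrix.mul_apply]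
  simp only [nuMat, Matrix.of_apply]
  by_cases hs : epsInt a.1 + epsInt b.1 = natWeight x - natWeight z
  · have hb' : epsInt b.1 = natWeight x - natWeight z - epsInt a.1 := by rw [← hs]; abel
    have hbv : ofEps (natWeight x - natWeight z - epsInt a.1) = b.1 := by
      rw [← hb', ofEps_epsInt _ hb]
    have key := commEntry_root a ha x z (by rw [hbv]; exact b.2)
    rw [hbv, ← hb', commEntry, ← sum_eq_natSum] at key
    rw [if_pos hs, ← key, ← Finset.sum_sub_distrib]
    push_cast
    refine Finset.sum_congr rfl fun y _ => ?_
    -- The weight differences along `x`, `y`, `z` telescope, so in each summand the condition on one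
    -- factor implies the condition on the other.
    have e1 : epsInt b.1 = natWeight y - natWeight z ↔ epsInt a.1 = natWeight x - natWeight y := by
      rw [hb']
      constructor <;> intro h
      · rw [sub_eq_iff_eq_add] at h
        rw [← sub_eq_iff_eq_add'] at h
        rw [← h]; abel
      · rw [h]; abel
    have e2 : epsInt a.1 = natWeight y - natWeight z ↔ epsInt b.1 = natWeight x - natWeight y := by
      rw [hb']
      constructor <;> intro h
      · rw [h]; abel
      · rw [sub_eq_iff_eq_add] at h
        rw [← sub_eq_iff_eq_add'] at h
        rw [← h]; abel
    simp only [e1, e2]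
    congr 1 <;> split_ifs <;> simp
  · rw [if_neg hs]
    rw [Finset.sum_eq_zero, Finset.sum_eq_zero, sub_zero]
    · intro y _
      split_ifs with h1 h2
      · exact absurd (by rw [h1, h2]; abel) hs
      all_goals simp
    · intro y _
      split_ifs with h1 h2
      · exact absurd (by rw [h1, h2]; abel) hs
      all_goals simp

theorem form_eq_sum_eps (h : Fin 6 → ℂ) (a : Fin 6 → ℤ) (ha : a 5 = 0) :
    form h (latticeH a) = ∑ i, epsCoord h i * (epsInt a i : ℂ) := by
  rw [Fin.sum_univ_five]
  simp only [form, latticeH, epsCoord, epsInt, ha]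
  simp
  ring

theorem rhoO_lie_H_E (h : Fin 6 → ℂ) (a : Root) (ha : a.1 5 = 0) :
    rhoO ⁅ofH h, E a⁆ = ⁅rhoO (ofH h), rhoO (E a)⁆ := by
  apply Subtype.ext
  rw [lie_H_E, map_smul, O10.coe_lie, O10.coe_smul, rhoO_E,
    coe_nuInvRoot a ha, coe_rhoO_ofH]
  ext x y
  rw [Matrix.sub_apply, Matrix.diagonal_mul, Matrix.mul_diagonal, Matrix.smul_apply,
    form_eq_sum_eps _ _ ha, smul_eq_mul]
  simp only [nuMat, Matrix.of_apply]
  split_ifs with he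
  · rw [he, mul_comm (natSign x y : ℂ), ← sub_mul, ← Finset.sum_sub_distrib]
    congr 1
    refine Finset.sum_congr rfl fun i _ => ?_
    simp only [Pi.sub_apply]; push_cast; ring
  · simp

theorem rhoO_lie_H_H (h h' : Fin 6 → ℂ) :
    rhoO ⁅ofH h, ofH h'⁆ = ⁅rhoO (ofH h), rhoO (ofH h')⁆ := by
  apply Subtype.ext
  rw [lie_H_H, map_zero, O10.coe_lie, coe_rhoO_ofH, coe_rhoO_ofH,
    Matrix.diagonal_mul_diagonal, Matrix.diagonal_mul_diagonal]
  simp [mul_comm]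

/-- Induction principle for `𝒢₀`. -/
theorem E6.IsDeg.induction_zero {p : E6 → Prop} (hH : ∀ h, p (ofH h)) (hg : ∀ i, p (E (gamma i)))
    (hn : ∀ i, p (E (-gamma i))) (hadd : ∀ x y, p x → p y → p (x + y))
    (hsmul : ∀ (r : ℂ) x, p x → p (r • x)) {x : E6} (hx : IsDeg 0 x) : p x := by
  rw [hx.eq_zeroPart, zeroPart]
  have h0 : p 0 := by simpa using hH 0
  exact hadd _ _ (hH _) (Finset.sum_induction _ p hadd h0 fun i _ =>
    hadd _ _ (hsmul _ _ (hg i)) (hsmul _ _ (hn i)))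

theorem gamma_five (i : Fin 20) : (gamma i).1 5 = 0 := gammaVec_five i

theorem neg_gamma_five (i : Fin 20) : (-gamma i).1 5 = 0 := by simp [gamma_five]

theorem E6.IsDeg.induction_root {p : E6 → Prop} (hH : ∀ h, p (ofH h))
    (hE : ∀ a : Root, a.1 5 = 0 → p (E a)) (hadd : ∀ x y, p x → p y → p (x + y))
    (hsmul : ∀ (r : ℂ) x, p x → p (r • x)) {x : E6} (hx : IsDeg 0 x) : p x :=
  hx.induction_zero hH (fun i => hE _ (gamma_five i)) (fun i => hE _ (neg_gamma_five i)) hadd hsmul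

/-- `ϱ` is a homomorphism of Lie algebras on `𝒢₀`. -/
theorem rhoO_lie {x y : E6} (hx : IsDeg 0 x) (hy : IsDeg 0 y) :
    rhoO ⁅x, y⁆ = ⁅rhoO x, rhoO y⁆ := by
  refine IsDeg.induction_root (p := fun x => rhoO ⁅x, y⁆ = ⁅rhoO x, rhoO y⁆) (fun h => ?_)
    (fun a ha => ?_) (fun x x' hx hx' => ?_) (fun r x hx => ?_) hx
  · refine IsDeg.induction_root (p := fun y => rhoO ⁅ofH h, y⁆ = ⁅rhoO (ofH h), rhoO y⁆)
      (fun h' => rhoO_lie_H_H h h') (fun b hb => rhoO_lie_H_E h b hb) (fun x x' hx hx' => ?_)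
      (fun r x hx => ?_) hy
    · rw [lie_add, map_add, map_add, lie_add, hx, hx']
    · rw [lie_smul, map_smul, map_smul, lie_smul, hx]
  · refine IsDeg.induction_root (p := fun y => rhoO ⁅E a, y⁆ = ⁅rhoO (E a), rhoO y⁆)
      (fun h' => ?_) (fun b hb => rhoO_lie_E_E a b ha hb) (fun x x' hx hx' => ?_)
      (fun r x hx => ?_) hy
    · rw [← lie_skew, map_neg, rhoO_lie_H_E h' a ha, lie_skew]
    · rw [lie_add, map_add, map_add, lie_add, hx, hx']
    · rw [lie_smul, map_smul, map_smul, lie_smul, hx]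
  · rw [add_lie, map_add, map_add, add_lie, hx, hx']
  · rw [smul_lie, map_smul, map_smul, smul_lie, hx]

theorem hPart_eq_killing_gradH (x : E6) : hPart x 5 = killing (ofH gradH) x := by
  rw [killing_comm, killing_ofH_right, form_symm, form_gradH]

/-- The coordinate at `α₆` is the pairing with `gradH`, which is central in `𝒢₀`; invariance of the
form moves the bracket onto `gradH`. -/
theorem rhoKappa_lie {x y : E6} (hx : IsDeg 0 x) : rhoKappa ⁅x, y⁆ = 0 := by
  suffices h : hPart ⁅x, y⁆ 5 = 0 by simp [rhoKappa, h]
  rw [hPart_eq_killing_gradH, ← killing_lie, hx, Int.cast_zero, zero_smul, killing_zero_left]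

end XuE6
end

noncomputable section

namespace XuE6

open E6 MvPolynomial

/-! ### Vector fields -/

theorem derivation_sum_apply {ι : Type*} (s : Finset ι) (d : ι → Derivation ℂ Poly Poly)
    (f : Poly) : (∑ i ∈ s, d i) f = ∑ i ∈ s, d i f := by
  classical
  induction s using Finset.induction_on with
  | empty => simp
  | insert a s ha ih => rw [Finset.sum_insert ha, Finset.sum_insert ha, Derivation.add_apply, ih]

/-- The duality of `𝒢₋` and `𝒢₊` rewrites the coefficients through brackets with the `ξ_s`, which is
the form in which commutators with `∂_{x_s}` appear. -/
theorem polyAct_X (u : E6) (i : Fin 16) : polyAct u (X i) =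
    ∑ s, C (xiCoeff i ⁅xi s, u⁆) * X s := by
  rw [polyAct, mkDerivation_X]
  refine Finset.sum_congr rfl fun s _ => ?_
  rw [etaCoeff_lie_eta, ← map_neg (xiCoeff i), lie_skew]

theorem polyAct_X_eta (u : E6) (i : Fin 16) : polyAct u (X i) =
    ∑ s, C (etaCoeff s ⁅u, eta i⁆) * X s := by
  rw [polyAct, mkDerivation_X]

/-- `polyAct` as a linear map. -/
def polyActLin : E6 →ₗ[ℂ] Derivation ℂ Poly Poly where
  toFun := polyAct
  map_add' u v := by
    refine derivation_ext fun i => ?_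
    simp only [Derivation.add_apply, polyAct_X, lie_add, map_add, add_mul, Finset.sum_add_distrib]
  map_smul' r u := by
    refine derivation_ext fun i => ?_
    simp only [Derivation.smul_apply, polyAct_X, lie_smul, map_smul, smul_eq_mul, map_mul,
      RingHom.id_apply, Finset.smul_sum, smul_eq_C_mul, mul_assoc]

theorem polyActLin_apply (u : E6) : polyActLin u = polyAct u := rfl

theorem pderiv_polyAct (r : Fin 16) (u : E6) :
    ⁅(pderiv r : Derivation ℂ Poly Poly), polyAct u⁆ = ∑ i, xiCoeff i ⁅xi r, u⁆ • pderiv i := by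
  refine derivation_ext fun j => ?_
  rw [Derivation.commutator_apply, polyAct_X, pderiv_X]
  simp [Derivation.leibniz, derivation_sum_apply, pderiv_X, Pi.single_apply, smul_eq_C_mul,
    apply_ite]

theorem lie_xi_lie_xi_eta (r s i : Fin 16) : ⁅xi r, ⁅xi s, eta i⁆⁆ = ⁅xi s, ⁅xi r, eta i⁆⁆ := by
  rw [leibniz_lie, lie_xi_xi, zero_lie, zero_add]

/-- Differentiating the factor `x_s` and differentiating the linear vector field give equal
contributions, since `[ξ_r, [ξ_s, η_i]]` is symmetric in `r` and `s`. The two together cancel the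
factor `1/2` in `P`. -/
theorem pderiv_P (r i : Fin 16) :
    ⁅(pderiv r : Derivation ℂ Poly Poly), P i⁆ = polyAct ⁅xi r, eta i⁆ := by
  refine derivation_ext fun j => ?_
  have h1 : P i ((pderiv r) (X j : Poly)) = 0 := by
    rw [pderiv_X, Pi.single_apply]; split_ifs <;> simp
  have h2 : ∀ s, pderiv r (polyAct ⁅xi s, eta i⁆ (X j)) = C (xiCoeff j ⁅xi s, ⁅xi r, eta i⁆⁆) := by
    intro s
    rw [polyAct_X, lie_xi_lie_xi_eta s r]
    simp [Derivation.leibniz, pderiv_X, Pi.single_apply]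
  rw [Derivation.commutator_apply, h1, sub_zero, P]
  simp only [Derivation.smul_apply, derivation_sum_apply, smul_eq_mul,
    Derivation.leibniz, map_sum, pderiv_C, h2, mul_zero, add_zero, pderiv_X,
    Finset.sum_add_distrib, Pi.single_apply, mul_ite, mul_one, Finset.sum_ite_eq',
    Finset.mem_univ, if_true]
  have h3 : ∑ s, X s * C (xiCoeff j ⁅xi s, ⁅xi r, eta i⁆⁆) = polyAct ⁅xi r, eta i⁆ (X j) := by
    rw [polyAct_X]; exact Finset.sum_congr rfl fun s _ => mul_comm _ _
  rw [h3, ← two_mul, ← mul_assoc, show (2 : Poly) = C 2 from rfl, ← C_mul]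
  simp

/-- The Euler vector field. -/
def euler : Derivation ℂ Poly Poly := mkDerivation ℂ X

theorem euler_X (i : Fin 16) : euler (X i) = X i := mkDerivation_X _ _ _

theorem euler_eq_sum : euler = ∑ r, (X r : Poly) • pderiv r := by
  refine derivation_ext fun j => ?_
  simp [euler_X, derivation_sum_apply, pderiv_X, Pi.single_apply]

theorem lie_euler_pderiv (r : Fin 16) :
    ⁅euler, (pderiv r : Derivation ℂ Poly Poly)⁆ = -pderiv r := by
  refine derivation_ext fun j => ?_
  rw [Derivation.commutator_apply, euler_X, pderiv_X, Derivation.neg_apply, pderiv_X,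
    Pi.single_apply]
  split_ifs <;> simp

theorem lie_euler_polyAct (u : E6) : ⁅euler, polyAct u⁆ = 0 := by
  refine derivation_ext fun j => ?_
  rw [Derivation.commutator_apply, euler_X, polyAct_X]
  simp [Derivation.leibniz, euler]

theorem lie_euler_P (i : Fin 16) : ⁅euler, P i⁆ = P i := by
  refine derivation_ext fun j => ?_
  have h : ∀ s, euler (polyAct ⁅xi s, eta i⁆ (X j)) = polyAct ⁅xi s, eta i⁆ (X j) := by
    intro s
    have := DFunLike.congr_fun (lie_euler_polyAct ⁅xi s, eta i⁆) (X j)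
    rw [Derivation.commutator_apply, euler_X, Derivation.zero_apply, sub_eq_zero] at this
    exact this
  rw [Derivation.commutator_apply, euler_X, sub_eq_iff_eq_add, ← two_mul]
  have hC : euler (C (1 / 2)) = 0 := by simp [euler]
  simp only [P, Derivation.smul_apply, derivation_sum_apply, smul_eq_mul,
    Derivation.leibniz, hC, map_sum, h, euler_X, mul_zero, add_zero, Finset.sum_add_distrib]
  rw [Finset.sum_congr rfl fun s _ => mul_comm (polyAct ⁅xi s, eta i⁆ (X j)) (X s)]
  ring

/-! ### Operators on `M̂` and rigidity of operators that commute with all derivatives -/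

section Operators

variable {M : Type*} [AddCommGroup M] [Module ℂ M]

theorem vectorField_tmul (d : Derivation ℂ Poly Poly) (f : Poly) (m : M) :
    vectorField M d (f ⊗ₜ m) = d f ⊗ₜ m := rfl

variable (M) in
/-- The action of vector fields on `M̂`, as a linear map. -/
def vectorFieldLin : Derivation ℂ Poly Poly →ₗ[ℂ] Module.End ℂ (Hat M) where
  toFun := vectorField M
  map_add' d e := by
    refine TensorProduct.ext' fun f m => ?_
    simp only [LinearMap.add_apply, vectorField_tmul, Derivation.add_apply,
      TensorProduct.add_tmul]
  map_smul' r d := by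
    refine TensorProduct.ext' fun f m => ?_
    simp only [LinearMap.smul_apply, vectorField_tmul, Derivation.smul_apply,
      TensorProduct.smul_tmul', RingHom.id_apply]

theorem vectorFieldLin_apply (d : Derivation ℂ Poly Poly) : vectorFieldLin M d = vectorField M d :=
  rfl

theorem vectorField_lie (d e : Derivation ℂ Poly Poly) :
    vectorField M ⁅d, e⁆ = ⁅vectorField M d, vectorField M e⁆ := by
  refine TensorProduct.ext' fun f m => ?_
  simp only [Ring.lie_def, LinearMap.sub_apply, Module.End.mul_apply, vectorField_tmul,
    Derivation.commutator_apply, TensorProduct.sub_tmul]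

/-- The operator `f ⊗ m ↦ (g f) ⊗ A m` on `M̂`. -/
def mulAct (g : Poly) (A : Module.End ℂ M) : Module.End ℂ (Hat M) :=
  TensorProduct.map (LinearMap.mulLeft ℂ g) A

theorem mulAct_tmul (g : Poly) (A : Module.End ℂ M) (f : Poly) (m : M) :
    mulAct g A (f ⊗ₜ m) = (g * f) ⊗ₜ A m := rfl

theorem lie_vectorField_mulAct (d : Derivation ℂ Poly Poly) (g : Poly) (A : Module.End ℂ M) :
    ⁅vectorField M d, mulAct g A⁆ = mulAct (d g) A := by
  refine TensorProduct.ext' fun f m => ?_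
  simp only [Ring.lie_def, LinearMap.sub_apply, Module.End.mul_apply, vectorField_tmul,
    mulAct_tmul, Derivation.leibniz, smul_eq_mul, ← TensorProduct.sub_tmul]
  congr 1; ring

theorem mulAct_zero_left (A : Module.End ℂ M) : mulAct 0 A = 0 := by
  refine TensorProduct.ext' fun f m => ?_
  simp [mulAct_tmul]

theorem mulAct_zero_right (g : Poly) : mulAct g (0 : Module.End ℂ M) = 0 := by
  refine TensorProduct.ext' fun f m => ?_
  simp [mulAct_tmul]

theorem mulAct_add_right (g : Poly) (A B : Module.End ℂ M) :
    mulAct g (A + B) = mulAct g A + mulAct g B := by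
  refine TensorProduct.ext' fun f m => ?_
  simp [mulAct_tmul, TensorProduct.tmul_add]

theorem mulAct_smul_right (g : Poly) (r : ℂ) (A : Module.End ℂ M) :
    mulAct g (r • A) = r • mulAct g A := by
  refine TensorProduct.ext' fun f m => ?_
  simp [mulAct_tmul]

variable (M) in
/-- The Euler operator on `M̂`. -/
abbrev eulerOp : Module.End ℂ (Hat M) := vectorField M euler

theorem eulerOp_monomial (d : Fin 16 →₀ ℕ) (m : M) :
    eulerOp M ((monomial d (1 : ℂ)) ⊗ₜ[ℂ] m) = (d.degree : ℂ) • ((monomial d (1 : ℂ)) ⊗ₜ[ℂ] m) := by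
  rw [vectorField_tmul, TensorProduct.smul_tmul']
  congr 1
  have h := (isHomogeneous_monomial (n := d.degree) (1 : ℂ) rfl).sum_X_mul_pderiv
  rw [euler_eq_sum]
  simp only [derivation_sum_apply, Derivation.smul_apply, smul_eq_mul]
  rw [h, Nat.cast_smul_eq_nsmul]

/-- The Euler operator is `∑ x_r ∂_{x_r}`. -/
theorem eulerOp_eq_zero {w : Hat M} (h : ∀ r, vectorField M (pderiv r) w = 0) :
    eulerOp M w = 0 := by
  have key : ∀ w : Hat M, eulerOp M w =
      ∑ r, mulAct (X r) LinearMap.id (vectorField M (pderiv r) w) := by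
    intro w
    induction w using TensorProduct.induction_on with
    | zero => simp
    | add x y hx hy => simp only [map_add, hx, hy, Finset.sum_add_distrib]
    | tmul f m =>
      rw [vectorField_tmul, euler_eq_sum]
      simp [vectorField_tmul, mulAct_tmul, TensorProduct.sum_tmul, derivation_sum_apply]
  rw [key]
  exact Finset.sum_eq_zero fun r _ => by rw [h, map_zero]

theorem hat_hom_ext {N : Type*} [AddCommGroup N] [Module ℂ N] {D D' : Hat M →ₗ[ℂ] N}
    (h : ∀ d m, D (monomial d (1 : ℂ) ⊗ₜ m) = D' (monomial d (1 : ℂ) ⊗ₜ m)) : D = D' := by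
  refine TensorProduct.ext ?_
  refine MvPolynomial.linearMap_ext fun d => LinearMap.ext_ring (LinearMap.ext fun m => h d m)

/-- An operator of nonnegative degree that commutes with the `∂_{x_r}` and vanishes on `1 ⊗ M`
is zero. -/
theorem eq_zero_of_lie_pderiv (D : Module.End ℂ (Hat M)) (s : ℕ)
    (hd : ∀ r, ⁅vectorField M (pderiv r), D⁆ = 0) (hE : ⁅eulerOp M, D⁆ = (s : ℂ) • D)
    (h1 : s = 0 → ∀ m, D (1 ⊗ₜ m) = 0) : D = 0 := by
  have hd' : ∀ r w, vectorField M (pderiv r) (D w) = D (vectorField M (pderiv r) w) := by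
    intro r w
    have := LinearMap.congr_fun (hd r) w
    rwa [Ring.lie_def, LinearMap.sub_apply, LinearMap.zero_apply, sub_eq_zero] at this
  have hE' : ∀ w, eulerOp M (D w) = D (eulerOp M w) + (s : ℂ) • D w := by
    intro w
    have := LinearMap.congr_fun hE w
    rw [Ring.lie_def, LinearMap.sub_apply, sub_eq_iff_eq_add] at this
    rw [add_comm]; exact this
  suffices key : ∀ n : ℕ, ∀ d : Fin 16 →₀ ℕ, d.degree = n → ∀ m,
      D (monomial d (1 : ℂ) ⊗ₜ m) = 0 from hat_hom_ext fun d m => key _ d rfl m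
  -- Induction on the degree of the monomial. By the induction hypothesis the image of a monomial of
  -- degree `n` is killed by all derivatives, hence by the Euler operator; but the Euler operator
  -- acts on it by `n + s`. Only `n = s = 0` escapes, and this is the case covered by `h1`.
  intro n
  induction n with
  | zero =>
    intro d hd0 m
    rw [Finsupp.degree_eq_zero_iff] at hd0
    subst hd0
    by_cases hs : s = 0
    · exact h1 hs m
    · have e1 := hE' (monomial 0 (1 : ℂ) ⊗ₜ m)
      rw [eulerOp_eq_zero, eulerOp_monomial] at e1
      · simpa [hs] using e1.symm
      · intro r
        rw [hd', vectorField_tmul]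
        simp
  | succ n ih =>
    intro d hdn m
    have e1 := hE' (monomial d (1 : ℂ) ⊗ₜ m)
    rw [eulerOp_eq_zero, eulerOp_monomial, map_smul, ← add_smul, hdn] at e1
    · refine (smul_eq_zero.1 e1.symm).resolve_left ?_
      exact_mod_cast (by omega : n + 1 + s ≠ 0)
    · intro r
      rw [hd', vectorField_tmul, pderiv_monomial, one_mul]
      by_cases hr : d r = 0
      · simp [hr]
      · have : (monomial (d - Finsupp.single r 1) (d r : ℂ) : Poly)
            = (d r : ℂ) • monomial (d - Finsupp.single r 1) (1 : ℂ) := by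
          rw [smul_monomial, smul_eq_mul, mul_one]
        rw [this, ← TensorProduct.smul_tmul', map_smul, ih, smul_zero]
        have h2 : d - Finsupp.single r 1 + Finsupp.single r 1 = d := by
          apply tsub_add_cancel_of_le
          rw [Finsupp.single_le_iff]; omega
        have h3 := congrArg Finsupp.degree h2
        rw [map_add, Finsupp.degree_single] at h3
        omega

end Operators

end XuE6
end

noncomputable section

namespace XuE6

open E6 MvPolynomial

/-! ### Commutators of operators -/

section Commutator

variable {V : Type*} [AddCommGroup V] [Module ℂ V] {M : Type*} [AddCommGroup M] [Module ℂ M]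

theorem commutator_add (x y z : Module.End ℂ V) :
    ⁅x, y + z⁆ = ⁅x, y⁆ + ⁅x, z⁆ := by
  simp only [Ring.lie_def]; noncomm_ring

theorem hat_commutator_add (x y z : Module.End ℂ (Hat M)) :
    ⁅x, y + z⁆ = ⁅x, y⁆ + ⁅x, z⁆ :=
  commutator_add x y z

theorem add_commutator (x y z : Module.End ℂ V) :
    ⁅x + y, z⁆ = ⁅x, z⁆ + ⁅y, z⁆ := by
  simp only [Ring.lie_def]; noncomm_ring

theorem hat_add_commutator (x y z : Module.End ℂ (Hat M)) :
    ⁅x + y, z⁆ = ⁅x, z⁆ + ⁅y, z⁆ :=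
  add_commutator x y z

theorem commutator_sub (x y z : Module.End ℂ V) :
    ⁅x, y - z⁆ = ⁅x, y⁆ - ⁅x, z⁆ := by
  simp only [Ring.lie_def]; noncomm_ring

theorem hat_commutator_sub (x y z : Module.End ℂ (Hat M)) :
    ⁅x, y - z⁆ = ⁅x, y⁆ - ⁅x, z⁆ :=
  commutator_sub x y z

theorem commutator_zero (x : Module.End ℂ V) :
    ⁅x, (0 : Module.End ℂ V)⁆ = 0 := by
  simp [Ring.lie_def]

theorem hat_commutator_zero (x : Module.End ℂ (Hat M)) :
    ⁅x, (0 : Module.End ℂ (Hat M))⁆ = 0 :=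
  commutator_zero x

theorem commutator_smul (r : ℂ) (x y : Module.End ℂ V) :
    ⁅x, r • y⁆ = r • ⁅x, y⁆ := by
  simp only [Ring.lie_def, mul_smul_comm, smul_mul_assoc, smul_sub]

theorem hat_commutator_smul (r : ℂ) (x y : Module.End ℂ (Hat M)) :
    ⁅x, r • y⁆ = r • ⁅x, y⁆ :=
  commutator_smul r x y

theorem smul_commutator (r : ℂ) (x y : Module.End ℂ V) :
    ⁅r • x, y⁆ = r • ⁅x, y⁆ := by
  simp only [Ring.lie_def, mul_smul_comm, smul_mul_assoc, smul_sub]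

theorem hat_smul_commutator (r : ℂ) (x y : Module.End ℂ (Hat M)) :
    ⁅r • x, y⁆ = r • ⁅x, y⁆ :=
  smul_commutator r x y

theorem commutator_sum {ι : Type*} (x : Module.End ℂ V) (s : Finset ι) (f : ι → Module.End ℂ V) :
    ⁅x, ∑ i ∈ s, f i⁆ = ∑ i ∈ s, ⁅x, f i⁆ := by
  simp only [Ring.lie_def, Finset.mul_sum, Finset.sum_mul, Finset.sum_sub_distrib]

theorem hat_commutator_sum {ι : Type*} (x : Module.End ℂ (Hat M)) (s : Finset ι) (f : ι → Module.End ℂ (Hat M)) :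
    ⁅x, ∑ i ∈ s, f i⁆ = ∑ i ∈ s, ⁅x, f i⁆ :=
  commutator_sum x s f

theorem commutator_leibniz (x y z : Module.End ℂ V) :
    ⁅x, ⁅y, z⁆⁆ = ⁅⁅x, y⁆, z⁆ + ⁅y, ⁅x, z⁆⁆ := by
  simp only [Ring.lie_def]; noncomm_ring

theorem hat_commutator_leibniz (x y z : Module.End ℂ (Hat M)) :
    ⁅x, ⁅y, z⁆⁆ = ⁅⁅x, y⁆, z⁆ + ⁅y, ⁅x, z⁆⁆ :=
  commutator_leibniz x y z

theorem commutator_skew (x y : Module.End ℂ V) :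
    -⁅y, x⁆ = ⁅x, y⁆ := by
  simp only [Ring.lie_def]; noncomm_ring

theorem hat_commutator_skew (x y : Module.End ℂ (Hat M)) :
    -⁅y, x⁆ = ⁅x, y⁆ :=
  commutator_skew x y

end Commutator

/-! ### The bracket relations of `𝒢` on `M̂` -/

section Representation

variable {M : Type*} [AddCommGroup M] [Module ℂ M]

/-- `R` restricts to a representation of `𝒢₀` and vanishes on `𝒢₋` and `𝒢₊`. -/
structure IsZeroRep (R : E6 →ₗ[ℂ] Module.End ℂ M) : Prop where
  xi : ∀ i, R (xi i) = 0
  eta : ∀ i, R (eta i) = 0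
  lie : ∀ x y, IsDeg 0 x → IsDeg 0 y → R ⁅x, y⁆ = ⁅R x, R y⁆

/-- The action of `η_i` on `M̂` that comes from a representation of `𝒢₀` on `M`. -/
def etaOp (R : E6 →ₗ[ℂ] Module.End ℂ M) (i : Fin 16) : Module.End ℂ (Hat M) :=
  vectorField M (P i) + ∑ r, mulAct (X r) (R ⁅xi r, eta i⁆)

/-- The action of `𝒢` on `M̂` that comes from a representation of `𝒢₀` on `M`. -/
def hatAct (R : E6 →ₗ[ℂ] Module.End ℂ M) : E6 →ₗ[ℂ] Module.End ℂ (Hat M) where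
  toFun u := (∑ i, xiCoeff i u • vectorField M (pderiv i))
    + (vectorField M (polyAct u) + mulAct 1 (R u)) + ∑ i, etaCoeff i u • etaOp R i
  map_add' u v := by
    simp only [← vectorFieldLin_apply, ← polyActLin_apply, map_add, mulAct_add_right, add_smul,
      Finset.sum_add_distrib]
    abel
  map_smul' r u := by
    simp only [← vectorFieldLin_apply, ← polyActLin_apply, map_smul, mulAct_smul_right, smul_assoc,
      smul_eq_mul, mul_smul, RingHom.id_apply, smul_add, Finset.smul_sum]

theorem hatAct_apply (R : E6 →ₗ[ℂ] Module.End ℂ M) (u : E6) : hatAct R u =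
    (∑ i, xiCoeff i u • vectorField M (pderiv i))
    + (vectorField M (polyAct u) + mulAct 1 (R u)) + ∑ i, etaCoeff i u • etaOp R i := rfl

theorem polyAct_xi (i : Fin 16) : polyAct (xi i) = 0 := by
  refine derivation_ext fun j => ?_
  simp [polyAct_X, lie_xi_xi]

theorem polyAct_eta (i : Fin 16) : polyAct (eta i) = 0 := by
  refine derivation_ext fun j => ?_
  simp [polyAct_X_eta, lie_eta_eta]

/-- Induction over homogeneous generators. -/
theorem E6.induction_graded {p : E6 → Prop} (h0 : ∀ x, IsDeg 0 x → p x) (hxi : ∀ i, p (xi i))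
    (heta : ∀ i, p (eta i)) (hadd : ∀ x y, p x → p y → p (x + y))
    (hsmul : ∀ (r : ℂ) x, p x → p (r • x)) (x : E6) : p x := by
  rw [eq_sum_parts x]
  have hz : p 0 := h0 0 (isDeg_zero 0)
  exact hadd _ _ (hadd _ _ (h0 _ (isDeg_zeroPart x))
    (Finset.sum_induction _ p hadd hz fun i _ => hsmul _ _ (hxi i)))
    (Finset.sum_induction _ p hadd hz fun i _ => hsmul _ _ (heta i))

theorem E6.IsDeg.induction_pos {p : E6 → Prop} (hxi : ∀ i, p (XuE6.xi i))
    (hadd : ∀ x y, p x → p y → p (x + y)) (hsmul : ∀ (r : ℂ) x, p x → p (r • x)) {x : E6}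
    (hx : IsDeg 1 x) : p x := by
  rw [hx.eq_sum_xi]
  exact Finset.sum_induction _ p hadd (by simpa using hsmul 0 _ (hxi 0))
    fun i _ => hsmul _ _ (hxi i)

theorem E6.IsDeg.induction_neg {p : E6 → Prop} (heta : ∀ i, p (XuE6.eta i))
    (hadd : ∀ x y, p x → p y → p (x + y)) (hsmul : ∀ (r : ℂ) x, p x → p (r • x)) {x : E6}
    (hx : IsDeg (-1) x) : p x := by
  rw [hx.eq_sum_eta]
  exact Finset.sum_induction _ p hadd (by simpa using hsmul 0 _ (heta 0))
    fun i _ => hsmul _ _ (heta i)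

variable {R : E6 →ₗ[ℂ] Module.End ℂ M}

theorem hatAct_xi (hR : IsZeroRep R) (i : Fin 16) :
    hatAct R (xi i) = vectorField M (pderiv i) := by
  rw [hatAct_apply, polyAct_xi, hR.xi, mulAct_zero_right, ← vectorFieldLin_apply 0, map_zero]
  simp [xiCoeff_xi, (isDeg_xi i).etaCoeff_eq_zero]

theorem hatAct_eta (hR : IsZeroRep R) (i : Fin 16) : hatAct R (eta i) = etaOp R i := by
  rw [hatAct_apply, polyAct_eta, hR.eta, mulAct_zero_right, ← vectorFieldLin_apply 0, map_zero]
  simp [etaCoeff_eta, (isDeg_eta i).xiCoeff_eq_zero]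

theorem hatAct_zero (R : E6 →ₗ[ℂ] Module.End ℂ M) {u : E6} (hu : IsDeg 0 u) :
    hatAct R u = vectorField M (polyAct u) + mulAct 1 (R u) := by
  rw [hatAct_apply]
  simp [hu.etaCoeff_eq_zero, hu.xiCoeff_eq_zero]

theorem hatAct_pos (hR : IsZeroRep R) {x : E6} (hx : IsDeg 1 x) :
    hatAct R x = ∑ i, xiCoeff i x • vectorField M (pderiv i) := by
  conv_lhs => rw [hx.eq_sum_xi]
  simp only [map_sum, map_smul, hatAct_xi hR]

theorem hatAct_zero_one_tmul {u : E6} (hu : IsDeg 0 u) (m : M) :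
    hatAct R u (1 ⊗ₜ m) = 1 ⊗ₜ R u m := by
  rw [hatAct_zero R hu, LinearMap.add_apply, vectorField_tmul, mulAct_tmul]
  simp

theorem lie_vectorField_pderiv_hatAct_zero (hR : IsZeroRep R) (r : Fin 16) {u : E6}
    (hu : IsDeg 0 u) : ⁅vectorField M (pderiv r), hatAct R u⁆ = hatAct R ⁅xi r, u⁆ := by
  rw [hatAct_zero R hu, hat_commutator_add, ← vectorField_lie, lie_vectorField_mulAct, pderiv_polyAct,
    hatAct_pos hR (by simpa using (isDeg_xi r).lie hu), ← vectorFieldLin_apply (∑ i, _)]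
  simp [mulAct_zero_left, vectorFieldLin_apply]

/-- The vector field part is `pderiv_P`; in the sum only the term with `x_r` survives
differentiation, and it supplies the part acting on `M`. -/
theorem lie_vectorField_pderiv_etaOp (r i : Fin 16) :
    ⁅vectorField M (pderiv r), etaOp R i⁆ = hatAct R ⁅xi r, eta i⁆ := by
  rw [hatAct_zero R (isDeg_lie_xi_eta r i), etaOp, hat_commutator_add, ← vectorField_lie, pderiv_P,
    hat_commutator_sum]
  congr 1
  rw [Finset.sum_eq_single r]
  · rw [lie_vectorField_mulAct, pderiv_X_self]
  · intro s _ hs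
    rw [lie_vectorField_mulAct, pderiv_X_of_ne hs, mulAct_zero_left]
  · simp

theorem lie_eulerOp_hatAct (hR : IsZeroRep R) {d : ℤ} {x : E6} (hx : IsDeg d x) :
    ⁅eulerOp M, hatAct R x⁆ = (-(d : ℂ)) • hatAct R x := by
  by_cases h0 : d = 0
  · subst h0
    rw [hatAct_zero R hx, hat_commutator_add, ← vectorField_lie, lie_euler_polyAct,
      lie_vectorField_mulAct, ← vectorFieldLin_apply 0, map_zero]
    simp [mulAct_zero_left]
  by_cases h1 : d = 1
  · subst h1
    refine IsDeg.induction_pos (p := fun x => ⁅eulerOp M, hatAct R x⁆ =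
      (-((1 : ℤ) : ℂ)) • hatAct R x) (fun i => ?_) (fun x y hx hy => ?_) (fun r x hx => ?_) hx
    · rw [hatAct_xi hR, ← vectorField_lie, lie_euler_pderiv, ← vectorFieldLin_apply, map_neg,
        Int.cast_one]
      exact (neg_one_smul ℂ (vectorField M (pderiv i))).symm
    · rw [map_add, hat_commutator_add, hx, hy, smul_add]
    · rw [map_smul, hat_commutator_smul, hx, smul_comm]
  by_cases h2 : d = -1
  · subst h2
    refine IsDeg.induction_neg (p := fun x => ⁅eulerOp M, hatAct R x⁆ =
      (-((-1 : ℤ) : ℂ)) • hatAct R x) (fun i => ?_) (fun x y hx hy => ?_) (fun r x hx => ?_) hx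
    · rw [hatAct_eta hR, etaOp, hat_commutator_add, ← vectorField_lie, lie_euler_P,
        hat_commutator_sum]
      simp [lie_vectorField_mulAct, euler_X]
    · rw [map_add, hat_commutator_add, hx, hy, smul_add]
    · rw [map_smul, hat_commutator_smul, hx, smul_comm]
  · rw [hx.eq_zero h0 h1 h2, map_zero, hat_commutator_zero, smul_zero]

/-- If the commutators with all `ξ_r` are right then so is the bracket of two elements of
nonpositive degree. -/
theorem hatAct_lie_of_xi (hR : IsZeroRep R) {x y : E6} (s t : ℕ) (hx : IsDeg (-(s : ℤ)) x)
    (hy : IsDeg (-(t : ℤ)) y)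
    (h1 : ∀ r, ⁅hatAct R (xi r), hatAct R x⁆ = hatAct R ⁅xi r, x⁆)
    (h2 : ∀ r, ⁅hatAct R (xi r), hatAct R y⁆ = hatAct R ⁅xi r, y⁆)
    (h3 : ∀ r, ⁅hatAct R (xi r), hatAct R ⁅x, y⁆⁆ = hatAct R ⁅xi r, ⁅x, y⁆⁆)
    (h4 : ∀ r, ⁅hatAct R ⁅xi r, x⁆, hatAct R y⁆ = hatAct R ⁅⁅xi r, x⁆, y⁆)
    (h5 : ∀ r, ⁅hatAct R x, hatAct R ⁅xi r, y⁆⁆ = hatAct R ⁅x, ⁅xi r, y⁆⁆) :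
    ⁅hatAct R x, hatAct R y⁆ = hatAct R ⁅x, y⁆ := by
  rw [← sub_eq_zero]
  -- The defect of the bracket relation commutes with every `∂_{x_r}` by the Jacobi identity and
  -- `h1`–`h5`, and it has Euler degree `s + t`. If `s = t = 0`, it vanishes on constants because
  -- `R` is a representation of `𝒢₀`.
  refine eq_zero_of_lie_pderiv _ (s + t) (fun r => ?_) ?_ (fun hst m => ?_)
  · rw [← hatAct_xi hR, hat_commutator_sub, hat_commutator_leibniz, h1, h2, h3, h4, h5, ← map_add,
      ← leibniz_lie]
    exact sub_self (hatAct R _)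
  · rw [hat_commutator_sub, hat_commutator_leibniz, lie_eulerOp_hatAct hR hx, lie_eulerOp_hatAct hR hy,
      lie_eulerOp_hatAct hR (hx.lie hy), hat_smul_commutator, hat_commutator_smul, ← add_smul, smul_sub]
    push_cast
    congr 2 <;> ring
  · obtain ⟨rfl, rfl⟩ : s = 0 ∧ t = 0 := by omega
    simp only [Nat.cast_zero, neg_zero] at hx hy
    have hxy : IsDeg 0 ⁅x, y⁆ := by simpa using hx.lie hy
    rw [Ring.lie_def, LinearMap.sub_apply, LinearMap.sub_apply, Module.End.mul_apply,
      Module.End.mul_apply, hatAct_zero_one_tmul hx, hatAct_zero_one_tmul hy,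
      hatAct_zero_one_tmul hx, hatAct_zero_one_tmul hy, hatAct_zero_one_tmul hxy, hR.lie x y hx hy,
      ← TensorProduct.tmul_sub, ← TensorProduct.tmul_sub, Ring.lie_def]
    simp

theorem hatAct_lie_xi_zero (hR : IsZeroRep R) (r : Fin 16) {u : E6} (hu : IsDeg 0 u) :
    ⁅hatAct R (xi r), hatAct R u⁆ = hatAct R ⁅xi r, u⁆ := by
  rw [hatAct_xi hR, lie_vectorField_pderiv_hatAct_zero hR r hu]

theorem hatAct_lie_pos_zero (hR : IsZeroRep R) {x u : E6} (hx : IsDeg 1 x) (hu : IsDeg 0 u) :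
    ⁅hatAct R x, hatAct R u⁆ = hatAct R ⁅x, u⁆ := by
  refine IsDeg.induction_pos (p := fun x => ⁅hatAct R x, hatAct R u⁆ = hatAct R ⁅x, u⁆)
    (fun i => hatAct_lie_xi_zero hR i hu) (fun x y hx hy => ?_) (fun r x hx => ?_) hx
  · rw [map_add, hat_add_commutator, hx, hy, add_lie, map_add]
  · rw [map_smul, hat_smul_commutator, hx, smul_lie, map_smul]

theorem hatAct_lie_xi_neg (hR : IsZeroRep R) (r : Fin 16) {y : E6} (hy : IsDeg (-1) y) :
    ⁅hatAct R (xi r), hatAct R y⁆ = hatAct R ⁅xi r, y⁆ := by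
  refine IsDeg.induction_neg (p := fun y => ⁅hatAct R (xi r), hatAct R y⁆ = hatAct R ⁅xi r, y⁆)
    (fun i => ?_) (fun x y hx hy => ?_) (fun r x hx => ?_) hy
  · rw [hatAct_xi hR, hatAct_eta hR, lie_vectorField_pderiv_etaOp]
  · rw [map_add, hat_commutator_add, hx, hy, lie_add, map_add]
  · rw [map_smul, hat_commutator_smul, hx, lie_smul, map_smul]

theorem hatAct_lie_pos_neg (hR : IsZeroRep R) {x y : E6} (hx : IsDeg 1 x) (hy : IsDeg (-1) y) :
    ⁅hatAct R x, hatAct R y⁆ = hatAct R ⁅x, y⁆ := by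
  refine IsDeg.induction_pos (p := fun x => ⁅hatAct R x, hatAct R y⁆ = hatAct R ⁅x, y⁆)
    (fun i => hatAct_lie_xi_neg hR i hy) (fun x y hx hy => ?_) (fun r x hx => ?_) hx
  · rw [map_add, hat_add_commutator, hx, hy, add_lie, map_add]
  · rw [map_smul, hat_smul_commutator, hx, smul_lie, map_smul]

theorem hatAct_lie_swap {x y : E6} (h : ⁅hatAct R x, hatAct R y⁆ = hatAct R ⁅x, y⁆) :
    ⁅hatAct R y, hatAct R x⁆ = hatAct R ⁅y, x⁆ := by
  rw [← hat_commutator_skew, h]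
  exact (map_neg (hatAct R) _).symm.trans (congrArg _ (lie_skew y x))

/-- The relations are bootstrapped in the order of total degree: those of `𝒢₊` with `𝒢₀` give those
within `𝒢₀`; together with those of `𝒢₊` with `𝒢₋` these give `𝒢₀` with `𝒢₋`, and these in turn give
`𝒢₋` with `𝒢₋`. -/
theorem hatAct_lie_zero_zero (hR : IsZeroRep R) {u v : E6} (hu : IsDeg 0 u) (hv : IsDeg 0 v) :
    ⁅hatAct R u, hatAct R v⁆ = hatAct R ⁅u, v⁆ := by
  have huv : IsDeg 0 ⁅u, v⁆ := by simpa using hu.lie hv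
  have hxu : ∀ r {u}, IsDeg 0 u → IsDeg 1 ⁅xi r, u⁆ := fun r u hu => by
    simpa using (isDeg_xi r).lie hu
  exact hatAct_lie_of_xi hR 0 0 (by simpa using hu) (by simpa using hv)
    (fun r => hatAct_lie_xi_zero hR r hu) (fun r => hatAct_lie_xi_zero hR r hv)
    (fun r => hatAct_lie_xi_zero hR r huv) (fun r => hatAct_lie_pos_zero hR (hxu r hu) hv)
    (fun r => hatAct_lie_swap (hatAct_lie_pos_zero hR (hxu r hv) hu))

theorem hatAct_lie_zero_neg (hR : IsZeroRep R) {u y : E6} (hu : IsDeg 0 u) (hy : IsDeg (-1) y) :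
    ⁅hatAct R u, hatAct R y⁆ = hatAct R ⁅u, y⁆ := by
  have huy : IsDeg (-1) ⁅u, y⁆ := by simpa using hu.lie hy
  exact hatAct_lie_of_xi hR 0 1 (by simpa using hu) (by simpa using hy)
    (fun r => hatAct_lie_xi_zero hR r hu) (fun r => hatAct_lie_xi_neg hR r hy)
    (fun r => hatAct_lie_xi_neg hR r huy)
    (fun r => hatAct_lie_pos_neg hR (by simpa using (isDeg_xi r).lie hu) hy)
    (fun r => hatAct_lie_zero_zero hR hu (by simpa using (isDeg_xi r).lie hy))

theorem hatAct_lie_eta_eta (hR : IsZeroRep R) (i j : Fin 16) :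
    ⁅hatAct R (eta i), hatAct R (eta j)⁆ = hatAct R ⁅eta i, eta j⁆ :=
  hatAct_lie_of_xi hR 1 1 (by simpa using isDeg_eta i) (by simpa using isDeg_eta j)
    (fun r => hatAct_lie_xi_neg hR r (isDeg_eta i)) (fun r => hatAct_lie_xi_neg hR r (isDeg_eta j))
    (fun r => by rw [lie_eta_eta, lie_zero, map_zero, hat_commutator_zero])
    (fun r => hatAct_lie_zero_neg hR (isDeg_lie_xi_eta r i) (isDeg_eta j))
    (fun r => hatAct_lie_swap (hatAct_lie_zero_neg hR (isDeg_lie_xi_eta r j) (isDeg_eta i)))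

theorem hatAct_lie_xi_xi (hR : IsZeroRep R) (i j : Fin 16) :
    ⁅hatAct R (xi i), hatAct R (xi j)⁆ = hatAct R ⁅xi i, xi j⁆ := by
  rw [lie_xi_xi, map_zero, hatAct_xi hR, hatAct_xi hR, ← vectorField_lie]
  have : ⁅(pderiv i : Derivation ℂ Poly Poly), (pderiv j : Derivation ℂ Poly Poly)⁆ = 0 := by
    refine derivation_ext fun r => ?_
    rw [Derivation.commutator_apply, pderiv_X, pderiv_X, Pi.single_apply, Pi.single_apply]
    split_ifs <;> simp
  rw [this, ← vectorFieldLin_apply, map_zero]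

/-- `M̂` is a `𝒢`-module. -/
theorem hatAct_lie (hR : IsZeroRep R) (x y : E6) :
    hatAct R ⁅x, y⁆ = ⁅hatAct R x, hatAct R y⁆ := by
  symm
  have hadd : ∀ y x x', ⁅hatAct R x, hatAct R y⁆ = hatAct R ⁅x, y⁆ →
      ⁅hatAct R x', hatAct R y⁆ = hatAct R ⁅x', y⁆ →
      ⁅hatAct R (x + x'), hatAct R y⁆ = hatAct R ⁅x + x', y⁆ := fun y x x' h h' => by
    rw [map_add, hat_add_commutator, h, h', add_lie, map_add]
  have hsmul : ∀ (y : E6) (r : ℂ) (x : E6), ⁅hatAct R x, hatAct R y⁆ = hatAct R ⁅x, y⁆ →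
      ⁅hatAct R (r • x), hatAct R y⁆ = hatAct R ⁅r • x, y⁆ := fun y r x h => by
    rw [map_smul, hat_smul_commutator, h, smul_lie, map_smul]
  have swap : ∀ {x : E6}, (∀ y, ⁅hatAct R y, hatAct R x⁆ = hatAct R ⁅y, x⁆) → ∀ y,
      ⁅hatAct R x, hatAct R y⁆ = hatAct R ⁅x, y⁆ := fun h y => hatAct_lie_swap (h y)
  induction x using E6.induction_graded with
  | hadd x x' h h' => exact hadd y x x' h h'
  | hsmul r x h => exact hsmul y r x h
  | h0 u hu =>
    refine swap (fun y => ?_) y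
    induction y using E6.induction_graded with
    | hadd x x' h h' => exact hadd u x x' h h'
    | hsmul r x h => exact hsmul u r x h
    | h0 v hv => exact hatAct_lie_zero_zero hR hv hu
    | hxi i => exact hatAct_lie_xi_zero hR i hu
    | heta i => exact hatAct_lie_swap (hatAct_lie_zero_neg hR hu (isDeg_eta i))
  | hxi j =>
    refine swap (fun y => ?_) y
    induction y using E6.induction_graded with
    | hadd x x' h h' => exact hadd _ x x' h h'
    | hsmul r x h => exact hsmul _ r x h
    | h0 v hv => exact hatAct_lie_swap (hatAct_lie_xi_zero hR j hv)
    | hxi i => exact hatAct_lie_xi_xi hR i j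
    | heta i => exact hatAct_lie_swap (hatAct_lie_xi_neg hR j (isDeg_eta i))
  | heta j =>
    refine swap (fun y => ?_) y
    induction y using E6.induction_graded with
    | hadd x x' h h' => exact hadd _ x x' h h'
    | hsmul r x h => exact hsmul _ r x h
    | h0 v hv => exact hatAct_lie_zero_neg hR hv (isDeg_eta j)
    | hxi i => exact hatAct_lie_xi_neg hR i (isDeg_eta j)
    | heta i => exact hatAct_lie_eta_eta hR i j

end Representation

/-! ### The representation of `𝒢₀` on an `o(10, ℂ)`-module -/

section Rho

variable (M : Type*) [AddCommGroup M] [Module ℂ M] [LieRingModule O10 M] [LieModule ℂ O10 M]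

/-- The representation `ϱ` of `𝒢₀` on an `o(10, ℂ)`-module. -/
def rho (c : ℂ) : E6 →ₗ[ℂ] Module.End ℂ M where
  toFun u := LieModule.toEnd ℂ O10 M (rhoO u) + (rhoKappa u * c) • LinearMap.id
  map_add' u v := by simp only [map_add, add_mul, add_smul]; abel
  map_smul' r u := by simp only [map_smul, smul_eq_mul, mul_assoc, smul_add, mul_smul,
    RingHom.id_apply]

theorem rho_apply (c : ℂ) (u : E6) :
    rho M c u = LieModule.toEnd ℂ O10 M (rhoO u) + (rhoKappa u * c) • LinearMap.id := rfl

theorem isZeroRep_rho (c : ℂ) : IsZeroRep (rho M c) where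
  xi i := by
    have h : nuInvRoot (beta i) = 0 := by
      rw [nuInvRoot, if_neg]; rw [show (beta i).1 5 = 1 from betaVec_five i]; norm_num
    rw [rho_apply, xi, rhoO_E, h]
    simp [rhoKappa, hPart_E]
  eta i := by
    have h : nuInvRoot (-beta i) = 0 := by
      rw [nuInvRoot, if_neg]
      rw [show (-beta i).1 5 = -1 from congrArg Neg.neg (betaVec_five i)]; norm_num
    rw [rho_apply, eta, rhoO_E, h]
    simp [rhoKappa, hPart_E]
  lie x y hx hy := by
    rw [rho_apply, rho_apply, rho_apply, rhoO_lie hx hy, rhoKappa_lie hx]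
    simp only [zero_mul, zero_smul, add_zero, Ring.lie_def, mul_add, add_mul]
    ext m
    simp only [LieModule.toEnd_apply_apply, lie_lie, LinearMap.sub_apply, LinearMap.add_apply, Module.End.mul_apply,
      LinearMap.smul_apply, LinearMap.id_apply, lie_add, smul_add,
      lie_smul, smul_comm (rhoKappa y * c)]
    abel

theorem rhoAct_eq_mulAct (c : ℂ) (g : Poly) (u : E6) : rhoAct M c g u = mulAct g (rho M c u) := by
  rw [rhoAct, mulAct, rho_apply]

theorem act_eq_hatAct (c : ℂ) (u : E6) : act M c u = hatAct (rho M c) u := by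
  rw [act, hatAct_apply]
  simp only [etaAct, etaOp, rhoAct_eq_mulAct]

end Rho

end XuE6
end

noncomputable section

namespace XuE6

open E6

/-! ### The Casimir operator and the operator `∑ η_i ξ_i` -/

section Casimir

variable {V : Type*} [AddCommGroup V] [Module ℂ V]

/-- The basis of `H` dual to the simple roots: the inverse of the Cartan matrix. -/
def coweight : Fin 6 → Fin 6 → ℂ :=
  ![![4 / 3, 1, 5 / 3, 2, 4 / 3, 2 / 3], ![1, 2, 2, 3, 2, 1],
    ![5 / 3, 2, 10 / 3, 4, 8 / 3, 4 / 3], ![2, 3, 4, 6, 4, 2],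
    ![4 / 3, 2, 8 / 3, 4, 10 / 3, 5 / 3], ![2 / 3, 1, 4 / 3, 2, 5 / 3, 4 / 3]]

theorem form_coweight (h : Fin 6 → ℂ) (i : Fin 6) : form h (coweight i) = h i := by
  fin_cases i <;> simp [form, coweight] <;> ring

theorem sum_form_smul_coweight (h : Fin 6 → ℂ) :
    h = ∑ i, form h (Pi.single i 1) • coweight i := by
  funext j
  simp only [Fin.sum_univ_six]
  fin_cases j <;> simp [form, coweight] <;> ring

/-- A basis of `𝒢`. -/
def basisE6 : Fin 6 ⊕ Root → E6 := Sum.elim (fun i => ofH (Pi.single i 1)) E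

/-- The dual basis of `𝒢` for the invariant form. -/
def dualBasisE6 : Fin 6 ⊕ Root → E6 := Sum.elim (fun i => ofH (coweight i)) fun a => -E (-a)

theorem eq_sum_killing_dual (x : E6) : x = ∑ j, killing x (dualBasisE6 j) • basisE6 j := by
  rw [Fintype.sum_sum_type]
  conv_lhs => rw [eq_ofH_add_sum x]
  congr 1
  · have : hPart x = ∑ i, hPart x i • Pi.single i 1 := by
      funext j; simp [Finset.sum_apply, Pi.single_apply]
    conv_lhs => rw [this, map_sum]
    refine Finset.sum_congr rfl fun i _ => ?_
    simp [dualBasisE6, basisE6, killing_ofH_right, form_coweight]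
  · refine Finset.sum_congr rfl fun a _ => ?_
    simp [dualBasisE6, basisE6, killing_neg_right, killing_E_right, Root.neg_neg]

theorem eq_sum_killing_basis (x : E6) : x = ∑ j, killing x (basisE6 j) • dualBasisE6 j := by
  rw [Fintype.sum_sum_type]
  conv_lhs => rw [eq_ofH_add_sum x]
  congr 1
  · conv_lhs => rw [sum_form_smul_coweight (hPart x), map_sum]
    refine Finset.sum_congr rfl fun i _ => ?_
    simp [dualBasisE6, basisE6, killing_ofH_right]
  · rw [← Equiv.sum_comp negRoot]
    refine Finset.sum_congr rfl fun a _ => ?_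
    simp [dualBasisE6, basisE6, killing_E_right, negRoot]

/-- The Casimir operator of a representation. -/
def casimir (π : E6 →ₗ[ℂ] Module.End ℂ V) : Module.End ℂ V :=
  ∑ j, π (basisE6 j) * π (dualBasisE6 j)

variable {π : E6 →ₗ[ℂ] Module.End ℂ V}

theorem rep_mul_comm (hπ : ∀ x y, π ⁅x, y⁆ = ⁅π x, π y⁆) (x y : E6) :
    π x * π y = π y * π x + π ⁅x, y⁆ := by
  rw [hπ, Ring.lie_def]; abel

theorem rep_apply_comm (hπ : ∀ x y, π ⁅x, y⁆ = ⁅π x, π y⁆) (x y : E6) (v : V) :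
    π x (π y v) = π y (π x v) + π ⁅x, y⁆ v :=
  LinearMap.congr_fun (rep_mul_comm hπ x y) v

/-- In dual bases of an invariant form the matrices of `ad x` are negative transposes of each other,
so the two sums that arise from the Leibniz rule cancel term by term. -/
theorem casimir_comm (hπ : ∀ x y, π ⁅x, y⁆ = ⁅π x, π y⁆) (x : E6) :
    π x * casimir π = casimir π * π x := by
  have h1 : ∀ j, π x * (π (basisE6 j) * π (dualBasisE6 j)) =
      π (basisE6 j) * π (dualBasisE6 j) * π x + (π ⁅x, basisE6 j⁆ * π (dualBasisE6 j)
        + π (basisE6 j) * π ⁅x, dualBasisE6 j⁆) := by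
    intro j
    rw [hπ, hπ, Ring.lie_def, Ring.lie_def]; noncomm_ring
  have h2 : ∑ j, π ⁅x, basisE6 j⁆ * π (dualBasisE6 j) = ∑ k, ∑ j,
      killing ⁅x, basisE6 j⁆ (dualBasisE6 k) • (π (basisE6 k) * π (dualBasisE6 j)) := by
    rw [Finset.sum_comm]
    refine Finset.sum_congr rfl fun j _ => ?_
    conv_lhs => rw [eq_sum_killing_dual ⁅x, basisE6 j⁆]
    rw [map_sum, Finset.sum_mul]
    refine Finset.sum_congr rfl fun k _ => ?_
    rw [map_smul, smul_mul_assoc]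
  have h3 : ∑ k, π (basisE6 k) * π ⁅x, dualBasisE6 k⁆ = ∑ k, ∑ j,
      killing ⁅x, dualBasisE6 k⁆ (basisE6 j) • (π (basisE6 k) * π (dualBasisE6 j)) := by
    refine Finset.sum_congr rfl fun k _ => ?_
    conv_lhs => rw [eq_sum_killing_basis ⁅x, dualBasisE6 k⁆]
    rw [map_sum, Finset.mul_sum]
    refine Finset.sum_congr rfl fun j _ => ?_
    rw [map_smul, mul_smul_comm]
  rw [casimir, Finset.mul_sum, Finset.sum_congr rfl fun j _ => h1 j, Finset.sum_add_distrib,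
    ← Finset.sum_mul, Finset.sum_add_distrib, h2, h3, ← Finset.sum_add_distrib, add_eq_left]
  refine Finset.sum_eq_zero fun k _ => ?_
  rw [← Finset.sum_add_distrib]
  refine Finset.sum_eq_zero fun j _ => ?_
  rw [← add_smul, ← lie_skew, killing_neg_left, killing_lie, killing_comm (basisE6 j),
    neg_add_cancel, zero_smul]

/-- The operator `∑ η_i ξ_i`. -/
def etaXi (π : E6 →ₗ[ℂ] Module.End ℂ V) : Module.End ℂ V := ∑ i, π (eta i) * π (xi i)

/-- The argument is the one for the Casimir operator, with the dual pair `𝒢₋`, `𝒢₊` of `𝒢₀`-modules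
in place of dual bases of `𝒢`. -/
theorem etaXi_comm (hπ : ∀ x y, π ⁅x, y⁆ = ⁅π x, π y⁆) {u : E6} (hu : IsDeg 0 u) :
    π u * etaXi π = etaXi π * π u := by
  have h1 : ∀ i, π u * (π (eta i) * π (xi i)) = π (eta i) * π (xi i) * π u
      + (π ⁅u, eta i⁆ * π (xi i) + π (eta i) * π ⁅u, xi i⁆) := by
    intro j
    rw [hπ, hπ, Ring.lie_def, Ring.lie_def]; noncomm_ring
  have h2 : ∑ i, π ⁅u, eta i⁆ * π (xi i) = ∑ k, ∑ i,
      etaCoeff k ⁅u, eta i⁆ • (π (eta k) * π (xi i)) := by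
    rw [Finset.sum_comm]
    refine Finset.sum_congr rfl fun j _ => ?_
    have hd : IsDeg (-1) ⁅u, eta j⁆ := by simpa using hu.lie (isDeg_eta j)
    conv_lhs => rw [hd.eq_sum_eta]
    rw [map_sum, Finset.sum_mul]
    refine Finset.sum_congr rfl fun k _ => ?_
    rw [map_smul, smul_mul_assoc]
  have h3 : ∑ k, π (eta k) * π ⁅u, xi k⁆ = ∑ k, ∑ i,
      xiCoeff i ⁅u, xi k⁆ • (π (eta k) * π (xi i)) := by
    refine Finset.sum_congr rfl fun k _ => ?_
    have hd : IsDeg 1 ⁅u, xi k⁆ := by simpa using hu.lie (isDeg_xi k)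
    conv_lhs => rw [hd.eq_sum_xi]
    rw [map_sum, Finset.mul_sum]
    refine Finset.sum_congr rfl fun j _ => ?_
    rw [map_smul, mul_smul_comm]
  rw [etaXi, Finset.mul_sum, Finset.sum_congr rfl fun j _ => h1 j, Finset.sum_add_distrib,
    ← Finset.sum_mul, Finset.sum_add_distrib, h2, h3, ← Finset.sum_add_distrib, add_eq_left]
  refine Finset.sum_eq_zero fun k _ => ?_
  rw [← Finset.sum_add_distrib]
  refine Finset.sum_eq_zero fun j _ => ?_
  rw [← add_smul, etaCoeff_lie_eta, neg_add_cancel, zero_smul]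

/-- The value at `h ∈ H` of the weight with values `μ_i` at the `α_i`. -/
def evalWeight (μ h : Fin 6 → ℂ) : ℂ := ∑ i, h i * μ i

/-- `w` is a highest weight vector for the subalgebra `𝒢₀`, of weight `μ`. -/
structure IsHW (π : E6 →ₗ[ℂ] Module.End ℂ V) (μ : Fin 6 → ℂ) (w : V) : Prop where
  ne_zero : w ≠ 0
  map_gamma : ∀ p, π (E (gamma p)) w = 0
  map_ofH : ∀ h, π (ofH h) w = evalWeight μ h • w

/-- The eigenvalue of the Casimir operator at a highest weight vector of weight `μ`. -/
def casimirValue (μ : Fin 6 → ℂ) : ℂ :=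
  ∑ i, μ i * evalWeight μ (coweight i) + (∑ p, evalWeight μ (latticeH (gammaVec p))
    + ∑ i, evalWeight μ (latticeH (betaVec i)))

theorem evalWeight_single (μ : Fin 6 → ℂ) (i : Fin 6) : evalWeight μ (Pi.single i 1) = μ i := by
  simp [evalWeight, Pi.single_apply]

/-- Every product `E_α E_{-α}` with `α` positive is reordered so that the raising operator acts
first, at the price of `μ(α)`. For `α = γ_p` the reordered product kills `w`. For `α = β_i` it does
not, since `w` is a highest weight vector for `𝒢₀` only, and the two orders together leave `-2 η_i
ξ_i`. -/
theorem IsHW.casimir_apply (hπ : ∀ x y, π ⁅x, y⁆ = ⁅π x, π y⁆) {μ : Fin 6 → ℂ} {w : V}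
    (hw : IsHW π μ w) : casimir π w = casimirValue μ • w - (2 : ℂ) • etaXi π w := by
  have hneg : ∀ a : Root, π (E a) (π (E (-a)) w) =
      π (E (-a)) (π (E a) w) - evalWeight μ (latticeH a.1) • w := by
    intro a
    rw [rep_apply_comm hπ, lie_E_neg, map_neg, LinearMap.neg_apply, hw.map_ofH, sub_eq_add_neg]
  have hH : ∀ i, (π (basisE6 (Sum.inl i)) * π (dualBasisE6 (Sum.inl i))) w
      = (μ i * evalWeight μ (coweight i)) • w := by
    intro i
    rw [Module.End.mul_apply, basisE6, dualBasisE6, Sum.elim_inl, Sum.elim_inl, hw.map_ofH, map_smul,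
      hw.map_ofH, smul_smul, evalWeight_single, mul_comm]
  have hE : ∀ a, (π (basisE6 (Sum.inr a)) * π (dualBasisE6 (Sum.inr a))) w
      = -(π (E a) (π (E (-a)) w)) := by
    intro a
    rw [Module.End.mul_apply, basisE6, dualBasisE6, Sum.elim_inr, Sum.elim_inr, map_neg,
      LinearMap.neg_apply, map_neg]
  rw [casimir, LinearMap.sum_apply, Fintype.sum_sum_type, Finset.sum_congr rfl fun i _ => hH i,
    Finset.sum_congr rfl fun i _ => hE i, sum_root, casimirValue, etaXi, LinearMap.sum_apply,
    add_smul, add_smul, Finset.sum_smul, Finset.sum_smul, Finset.sum_smul, add_sub_assoc]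
  congr 1
  rw [add_sub_assoc]
  congr 1
  · refine Finset.sum_congr rfl fun p _ => ?_
    rw [hneg, hw.map_gamma, map_zero, Root.neg_neg, hw.map_gamma, map_zero]
    simp [gamma]
  · rw [Finset.smul_sum, ← Finset.sum_sub_distrib]
    refine Finset.sum_congr rfl fun i _ => ?_
    rw [hneg, Root.neg_neg, Module.End.mul_apply, two_smul, eta, xi]
    change _ = evalWeight μ (latticeH (beta i).1) • w - _
    abel

end Casimir

end XuE6
end

noncomputable section

namespace XuE6

open E6

/-! ### Highest weight vectors -/

section HighestWeight

variable {V : Type*} [AddCommGroup V] [Module ℂ V] {π : E6 →ₗ[ℂ] Module.End ℂ V}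

/-- `π` restricts to a representation of `𝒢₀`. -/
def IsRepZero (π : E6 →ₗ[ℂ] Module.End ℂ V) : Prop :=
  ∀ x y, IsDeg 0 x → IsDeg 0 y → ∀ v, π x (π y v) = π y (π x v) + π ⁅x, y⁆ v

theorem IsRepZero.of_rep (hπ : ∀ x y, π ⁅x, y⁆ = ⁅π x, π y⁆) : IsRepZero π :=
  fun x y _ _ v => rep_apply_comm hπ x y v

/-- The vectors obtained from `v` by successive application of the `π (f i)`. -/
inductive Word {ι : Type*} (π : E6 →ₗ[ℂ] Module.End ℂ V) (f : ι → E6) (v : V) : V → Prop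
  | base : Word π f v v
  | step (i : ι) (w : V) : Word π f v w → Word π f v (π (f i) w)

/-- The span of the words. -/
def wordSpan {ι : Type*} (π : E6 →ₗ[ℂ] Module.End ℂ V) (f : ι → E6) (v : V) : Submodule ℂ V :=
  Submodule.span ℂ {w | Word π f v w}

theorem map_mem_wordSpan {ι : Type*} {f : ι → E6} {v w : V} (i : ι) (hw : w ∈ wordSpan π f v) :
    π (f i) w ∈ wordSpan π f v := by
  induction hw using Submodule.span_induction with
  | mem w hw => exact Submodule.subset_span (Word.step i w hw)
  | zero => simp
  | add x y _ _ hx hy => rw [map_add]; exact add_mem hx hy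
  | smul r x _ hx => rw [map_smul]; exact Submodule.smul_mem _ _ hx

/-- An operator moves to the right past each letter at the cost of a commutator that again satisfies
`Q`, so induction on the length reduces to the action on `v`. The class `Q` is `𝒢₀` in one
application and all of `𝒢` in the other. -/
theorem wordSpan_stable {ι : Type*} {f : ι → E6} {v : V} (Q : E6 → Prop)
    (hcomm : ∀ x i, Q x → ∀ v, π x (π (f i) v) = π (f i) (π x v) + π ⁅x, f i⁆ v)
    (hQ : ∀ x i, Q x → Q ⁅x, f i⁆) (hv : ∀ x, Q x → π x v ∈ wordSpan π f v) {x : E6} (hx : Q x)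
    {w : V} (hw : w ∈ wordSpan π f v) : π x w ∈ wordSpan π f v := by
  induction hw using Submodule.span_induction with
  | zero => simp
  | add x y _ _ hx hy => rw [map_add]; exact add_mem hx hy
  | smul r x _ hx => rw [map_smul]; exact Submodule.smul_mem _ _ hx
  | mem w hw =>
    replace hw : Word π f v w := hw
    induction hw generalizing x with
    | base => exact hv x hx
    | step i w _ ih =>
      rw [hcomm x i hx]
      exact add_mem (map_mem_wordSpan i (ih hx)) (ih (hQ x i hx))

/-- The element of `H` that pairs to the height with each root. -/
def heightH : Fin 6 → ℂ := ![8, 11, 15, 21, 15, 8]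

theorem form_heightH (a : Fin 6 → ℂ) : form heightH a = ∑ i, a i := by
  simp only [form, heightH, Fin.sum_univ_six]; simp; ring

theorem height_gammaVec_pos : ∀ p, 1 ≤ ∑ i, gammaVec p i := by decide +kernel

theorem exists_height_gamma (p : Fin 20) :
    ∃ n : ℕ, form heightH (latticeH (gamma p).1) = (n : ℂ) + 1 := by
  have h := height_gammaVec_pos p
  refine ⟨(∑ i, gammaVec p i - 1).toNat, ?_⟩
  have h2 : (((∑ i, gammaVec p i - 1).toNat : ℤ) : ℂ) = ((∑ i, gammaVec p i - 1 : ℤ) : ℂ) := by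
    rw [Int.toNat_of_nonneg (by omega)]
  rw [form_heightH]
  rw [Int.cast_natCast] at h2
  rw [h2]
  simp [latticeH, gamma]

theorem latticeH_neg (a : Root) : latticeH (-a).1 = -latticeH a.1 := by
  funext i; simp [latticeH]

theorem form_neg_right (h a : Fin 6 → ℂ) : form h (-a) = -form h a := by
  simp only [form, Pi.neg_apply]; ring

theorem IsRepZero.ofH_E (h0 : IsRepZero π) (h : Fin 6 → ℂ) {a : Root} (ha : IsDeg 0 (E a)) {w : V}
    {t : ℂ} (hw : π (ofH h) w = t • w) :
    π (ofH h) (π (E a) w) = (t + form h (latticeH a.1)) • π (E a) w := by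
  rw [h0 _ _ (isDeg_ofH h) ha, lie_H_E, hw, map_smul, map_smul, LinearMap.smul_apply, add_smul]

theorem IsRepZero.ofH_E_neg (h0 : IsRepZero π) (h : Fin 6 → ℂ) (p : Fin 20) {w : V}
    {t : ℂ} (hw : π (ofH h) w = t • w) :
    π (ofH h) (π (E (-gamma p)) w) = (t - form h (latticeH (gamma p).1)) • π (E (-gamma p)) w := by
  rw [h0.ofH_E h (isDeg_neg_gamma p) hw, latticeH_neg, form_neg_right, sub_eq_add_neg]

/-- No proper nonzero subspace is stable under `𝒢₀`. -/
def IsIrredZero (π : E6 →ₗ[ℂ] Module.End ℂ V) : Prop :=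
  ∀ N : Submodule ℂ V, (∀ x, IsDeg 0 x → ∀ w ∈ N, π x w ∈ N) → N ≠ ⊥ → N = ⊤

theorem IsHW.wordSpan_stable (h0 : IsRepZero π) {μ : Fin 6 → ℂ} {v : V} (hv : IsHW π μ v) {x : E6}
    (hx : IsDeg 0 x) {w : V} (hw : w ∈ wordSpan π (fun p => E (-gamma p)) v) :
    π x w ∈ wordSpan π (fun p => E (-gamma p)) v := by
  have hvm : v ∈ wordSpan π (fun p => E (-gamma p)) v := Submodule.subset_span Word.base
  refine XuE6.wordSpan_stable (IsDeg 0) (fun x i hx => h0 _ _ hx (isDeg_neg_gamma i))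
    (fun x i hx => by simpa using hx.lie (isDeg_neg_gamma i)) (fun x hx => ?_) hx hw
  refine IsDeg.induction_zero (p := fun x => π x v ∈ wordSpan π (fun p => E (-gamma p)) v)
    (fun h => ?_) (fun i => ?_) (fun i => map_mem_wordSpan (f := fun p => E (-gamma p)) i hvm)
    (fun x y hx hy => ?_) (fun r x hx => ?_) hx
  · rw [hv.map_ofH]; exact Submodule.smul_mem _ _ hvm
  · rw [hv.map_gamma]; exact zero_mem _
  · rw [map_add]; exact add_mem hx hy
  · rw [map_smul]; exact Submodule.smul_mem _ _ hx

theorem IsHW.word_height (h0 : IsRepZero π) {μ : Fin 6 → ℂ} {v : V} (hv : IsHW π μ v) {w : V}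
    (hw : Word π (fun p => E (-gamma p)) v w) : w = v ∨
      ∃ n : ℕ, π (ofH heightH) w = (evalWeight μ heightH - ((n : ℂ) + 1)) • w := by
  induction hw with
  | base => exact Or.inl rfl
  | step i w _ ih =>
    right
    obtain ⟨m, hm⟩ := exists_height_gamma i
    rcases ih with rfl | ⟨n, hn⟩
    · exact ⟨m, by rw [h0.ofH_E_neg _ _ (hv.map_ofH heightH), hm]⟩
    · refine ⟨n + m + 1, ?_⟩
      rw [h0.ofH_E_neg _ _ hn, hm]
      congr 1; push_cast; ring

/-- Words in the lowering operators span a stable subspace, hence everything. Each nonempty word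
lies in an eigenspace of `heightH` strictly below that of `v`. -/
theorem IsHW.decompose (h0 : IsRepZero π) (hirr : IsIrredZero π) {μ : Fin 6 → ℂ} {v : V}
    (hv : IsHW π μ v) (w : V) : ∃ a : ℂ, ∃ u : V, w = a • v + u ∧
      u ∈ ⨆ n : ℕ, (π (ofH heightH)).eigenspace (evalWeight μ heightH - ((n : ℂ) + 1)) := by
  have htop : wordSpan π (fun p => E (-gamma p)) v = ⊤ := by
    refine hirr _ (fun x hx w hw => hv.wordSpan_stable h0 hx hw) fun h => hv.ne_zero ?_
    rw [← Submodule.mem_bot ℂ, ← h]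
    exact Submodule.subset_span Word.base
  have hle : wordSpan π (fun p => E (-gamma p)) v ≤ Submodule.span ℂ {v} ⊔
      ⨆ n : ℕ, (π (ofH heightH)).eigenspace (evalWeight μ heightH - ((n : ℂ) + 1)) := by
    refine Submodule.span_le.2 fun w hw => ?_
    rcases hv.word_height h0 hw with rfl | ⟨n, hn⟩
    · exact Submodule.mem_sup_left (Submodule.mem_span_singleton_self _)
    · exact Submodule.mem_sup_right (Submodule.mem_iSup_of_mem n
        (Module.End.mem_eigenspace_iff.2 hn))
  rw [htop] at hle
  obtain ⟨y, hy, z, hz, rfl⟩ := Submodule.mem_sup.1 (hle (Submodule.mem_top (x := w)))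
  obtain ⟨a, rfl⟩ := Submodule.mem_span_singleton.1 hy
  exact ⟨a, z, rfl, hz⟩

theorem eq_zero_of_mem_eigenspaces {T : Module.End ℂ V} {t : ℂ} {s : ℕ → ℂ} {w : V}
    (hw : T w = t • w) (hs : ∀ n, s n ≠ t) (h : w ∈ ⨆ n, T.eigenspace (s n)) : w = 0 := by
  have h1 : (⨆ n, T.eigenspace (s n)) ≤ ⨆ (μ : ℂ) (_ : μ ≠ t), T.eigenspace μ :=
    iSup_le fun n => le_iSup₂_of_le (s n) (hs n) le_rfl
  exact Submodule.disjoint_def.1 (T.eigenspaces_iSupIndep t) w (Module.End.mem_eigenspace_iff.2 hw)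
    (h1 h)

/-- Eigenspaces of `heightH` are independent, and by `IsHW.decompose` those at or below the height
of `v` span everything. -/
theorem IsHW.height_le (h0 : IsRepZero π) (hirr : IsIrredZero π) {μ ν : Fin 6 → ℂ} {v m : V}
    (hv : IsHW π μ v) (hm : IsHW π ν m) :
    ∃ n : ℕ, evalWeight ν heightH = evalWeight μ heightH - n := by
  by_contra! hne
  obtain ⟨a, u, h, hu⟩ := hv.decompose h0 hirr m
  refine hm.ne_zero (eq_zero_of_mem_eigenspaces
    (s := fun n : ℕ => evalWeight μ heightH - n) (hm.map_ofH heightH) (fun n => (hne n).symm) ?_)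
  rw [h]
  refine add_mem (Submodule.smul_mem _ _ (Submodule.mem_iSup_of_mem 0 ?_)) ?_
  · rw [Module.End.mem_eigenspace_iff, hv.map_ofH]; simp
  · refine SetLike.le_def.1 (iSup_le fun n => ?_) hu
    exact le_iSup_of_le (n + 1) (by push_cast; exact le_rfl)

/-- The highest weight of an irreducible module is unique. -/
theorem IsHW.weight_unique (h0 : IsRepZero π) (hirr : IsIrredZero π) {μ ν : Fin 6 → ℂ} {v m : V}
    (hv : IsHW π μ v) (hm : IsHW π ν m) : ν = μ := by
  obtain ⟨n, hn⟩ := hv.height_le h0 hirr hm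
  obtain ⟨n', hn'⟩ := hm.height_le h0 hirr hv
  -- Each of the two heights lies below the other by a natural number, so both numbers are zero.
  have hnn : ((n + n' : ℕ) : ℂ) = 0 := by
    push_cast
    linear_combination hn + hn'
  have hn0 : n = 0 := by
    have := Nat.cast_eq_zero.1 hnn; omega
  subst hn0
  obtain ⟨a, u, h, hu⟩ := hv.decompose h0 hirr m
  -- At equal heights the remainder `u` has the height of `v`, yet it is a sum of vectors of
  -- strictly smaller height. Hence `m` is a multiple of `v`.
  have hu0 : u = 0 := by
    refine eq_zero_of_mem_eigenspaces (t := evalWeight μ heightH) ?_ (fun n => ?_) hu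
    · have hum : u = m - a • v := by rw [h]; abel
      rw [hum, map_sub, hm.map_ofH, map_smul, hv.map_ofH, hn, smul_sub, smul_comm a]
      simp
    · have : ((n : ℂ) + 1) ≠ 0 := Nat.cast_add_one_ne_zero n
      intro h
      exact this (by linear_combination -h)
  rw [hu0, add_zero] at h
  funext i
  have h1 := hm.map_ofH (Pi.single i 1)
  rw [h, map_smul, hv.map_ofH, smul_comm, ← h, evalWeight_single, evalWeight_single,
    ← sub_eq_zero, ← sub_smul] at h1
  exact (sub_eq_zero.1 ((smul_eq_zero.1 h1).resolve_right hm.ne_zero)).symm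

/-- Commuting operators that preserve a nonzero finite-dimensional subspace have a common
eigenvector in it. -/
theorem exists_common_eigenvector {ι : Type*} [Fintype ι] (T : ι → Module.End ℂ V)
    (hT : ∀ i j v, T i (T j v) = T j (T i v)) (K : Submodule ℂ V) [FiniteDimensional ℂ K]
    (hK : K ≠ ⊥) (hTK : ∀ i, ∀ v ∈ K, T i v ∈ K) :
    ∃ v ∈ K, v ≠ 0 ∧ ∃ μ : ι → ℂ, ∀ i, T i v = μ i • v := by
  classical
  -- One operator is diagonalized at a time. The subspace stays stable under all operators because
  -- they commute, so the next one still has an eigenvector in it.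
  suffices h : ∀ s : Finset ι, ∃ (L : Submodule ℂ V) (μ : ι → ℂ), L ≤ K ∧ L ≠ ⊥ ∧
      (∀ i, ∀ v ∈ L, T i v ∈ L) ∧ ∀ i ∈ s, ∀ v ∈ L, T i v = μ i • v by
    obtain ⟨L, μ, hLK, hL, _, h⟩ := h Finset.univ
    obtain ⟨v, hv, hv0⟩ := L.ne_bot_iff.1 hL
    exact ⟨v, hLK hv, hv0, μ, fun i => h i (Finset.mem_univ i) v hv⟩
  intro s
  induction s using Finset.induction_on with
  | empty => exact ⟨K, 0, le_rfl, hK, hTK, by simp⟩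
  | insert i s hi ih =>
    obtain ⟨L, μ, hLK, hL, hTL, h⟩ := ih
    haveI : FiniteDimensional ℂ L := Submodule.finiteDimensional_of_le hLK
    haveI : Nontrivial L := Submodule.nontrivial_iff_ne_bot.2 hL
    obtain ⟨t, ht⟩ := Module.End.exists_eigenvalue ((T i).restrict (hTL i))
    obtain ⟨w, hw⟩ := ht.exists_hasEigenvector
    refine ⟨L ⊓ (T i).eigenspace t, Function.update μ i t, inf_le_left.trans hLK, ?_, ?_, ?_⟩
    · refine (Submodule.ne_bot_iff _).2 ⟨w, ⟨w.2, ?_⟩, fun h => hw.2 (Subtype.ext h)⟩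
      exact Module.End.mem_eigenspace_iff.2 (congrArg Subtype.val hw.apply_eq_smul)
    · rintro j v ⟨hvL, hv⟩
      refine ⟨hTL j v hvL, Module.End.mem_eigenspace_iff.2 ?_⟩
      rw [hT, Module.End.mem_eigenspace_iff.1 hv, map_smul]
    · rintro j hj v ⟨hvL, hv⟩
      by_cases hji : j = i
      · subst hji
        rw [Function.update_self]; exact Module.End.mem_eigenspace_iff.1 hv
      · rw [Function.update_of_ne hji]
        exact h j ((Finset.mem_insert.1 hj).resolve_left hji) v hvL

theorem evalWeight_eq_sum (μ h : Fin 6 → ℂ) (w : V)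
    (hw : ∀ i, π (ofH (Pi.single i 1)) w = μ i • w) : π (ofH h) w = evalWeight μ h • w := by
  have hh : h = ∑ i, h i • Pi.single i 1 := by
    funext j; simp [Finset.sum_apply, Pi.single_apply]
  conv_lhs => rw [hh]
  simp only [map_sum, map_smul, LinearMap.sum_apply, LinearMap.smul_apply, hw, evalWeight,
    Finset.sum_smul, mul_smul]

/-- A nonzero finite-dimensional `𝒢₀`-stable subspace contains a highest weight vector. -/
theorem IsRepZero.exists_isHW (h0 : IsRepZero π) (W : Submodule ℂ V) [FiniteDimensional ℂ W]
    (hW : W ≠ ⊥) (hst : ∀ x, IsDeg 0 x → ∀ w ∈ W, π x w ∈ W) :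
    ∃ w ∈ W, ∃ μ, IsHW π μ w := by
  haveI : Nontrivial W := Submodule.nontrivial_iff_ne_bot.2 hW
  let T : Module.End ℂ W := (π (ofH heightH)).restrict (hst _ (isDeg_ofH heightH))
  have hfin : {t | T.HasEigenvalue t}.Finite := Module.End.finite_hasEigenvalue T
  obtain ⟨t0, ht0⟩ := Module.End.exists_eigenvalue T
  -- An eigenvalue of the height with maximal real part is chosen: raising operators would increase
  -- it by a positive integer, so they vanish on its eigenspace.
  obtain ⟨t, ht, hmax⟩ := hfin.exists_maximalFor Complex.re _ ⟨t0, ht0⟩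
  have hEig : ∀ w ∈ W, w ≠ 0 → ∀ s, π (ofH heightH) w = s • w → T.HasEigenvalue s := by
    intro w hw hw0 s h
    refine Module.End.hasEigenvalue_of_hasEigenvector (x := ⟨w, hw⟩)
      ⟨Module.End.mem_eigenspace_iff.2 (Subtype.ext h), fun h => hw0 (congrArg Subtype.val h)⟩
  let K : Submodule ℂ V := W ⊓ (π (ofH heightH)).eigenspace t
  have hKt : ∀ w ∈ K, π (ofH heightH) w = t • w := fun w hw => Module.End.mem_eigenspace_iff.1 hw.2
  haveI : FiniteDimensional ℂ K := Submodule.finiteDimensional_of_le inf_le_left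
  have hK : K ≠ ⊥ := by
    obtain ⟨w, hw⟩ := ht.exists_hasEigenvector
    refine (Submodule.ne_bot_iff _).2 ⟨w, ⟨w.2, ?_⟩, fun h => hw.2 (Subtype.ext h)⟩
    exact Module.End.mem_eigenspace_iff.2 (congrArg Subtype.val hw.apply_eq_smul)
  have hcomm : ∀ (h h' : Fin 6 → ℂ) v, π (ofH h) (π (ofH h') v) = π (ofH h') (π (ofH h) v) := by
    intro h h' v
    rw [h0 _ _ (isDeg_ofH h) (isDeg_ofH h'), lie_H_H, map_zero, LinearMap.zero_apply, add_zero]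
  obtain ⟨w, hwK, hw0, μ, hμ⟩ := exists_common_eigenvector
    (fun i : Fin 6 => π (ofH (Pi.single i 1))) (fun i j v => hcomm _ _ v) K hK (fun i v hv =>
      ⟨hst _ (isDeg_ofH _) v hv.1, Module.End.mem_eigenspace_iff.2 (by
        rw [hcomm, hKt v hv, map_smul])⟩)
  refine ⟨w, hwK.1, μ, hw0, fun p => ?_, fun h => evalWeight_eq_sum μ h w hμ⟩
  by_contra hne
  obtain ⟨n, hn⟩ := exists_height_gamma p
  have h1 := h0.ofH_E heightH (isDeg_gamma p) (hKt w hwK)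
  have h2 := hEig _ (hst _ (isDeg_gamma p) w hwK.1) hne _ h1
  rw [hn] at h2
  have h3 : t.re ≤ (t + (n + 1)).re := by
    simp only [Complex.add_re, Complex.natCast_re, Complex.one_re]
    have : (0 : ℝ) ≤ n := n.cast_nonneg
    linarith
  have h4 := hmax h2 h3
  simp only [Complex.add_re, Complex.natCast_re, Complex.one_re] at h4
  have : (0 : ℝ) ≤ n := n.cast_nonneg
  linarith

theorem form_gamma_gamma (p : Fin 20) :
    form (latticeH (gamma p).1) (latticeH (gamma p).1) = 2 := by
  have h := form_gammaVec p
  have h2 : ((form (gammaVec p) (gammaVec p) : ℤ) : ℂ) = 2 := by rw [h]; norm_num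
  rw [← h2]
  simp only [form, latticeH, gamma]
  push_cast
  ring

/-- Highest weights in finite-dimensional stable subspaces are dominant. -/
theorem IsHW.dominant (h0 : IsRepZero π) {W : Submodule ℂ V} [FiniteDimensional ℂ W]
    (hst : ∀ x, IsDeg 0 x → ∀ w ∈ W, π x w ∈ W) {μ : Fin 6 → ℂ} {w : V} (hwW : w ∈ W)
    (hw : IsHW π μ w) (p : Fin 20) :
    ∃ n : ℕ, evalWeight μ (latticeH (gamma p).1) = n := by
  set h := latticeH (gamma p).1 with hh
  set s := evalWeight μ h with hs
  set f := π (E (-gamma p)) with hf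
  by_contra! hne
  have hH : ∀ n : ℕ, π (ofH h) ((f ^ n) w) = (s - 2 * n) • (f ^ n) w := by
    intro n
    induction n with
    | zero => simp [hw.map_ofH, hs]
    | succ n ih =>
      rw [pow_succ', Module.End.mul_apply, h0.ofH_E_neg _ _ ih, form_gamma_gamma]
      congr 1; push_cast; ring
  -- This is the usual `sl₂` formula; the sign comes from the normalization `[E_α, E_{-α}] = -α`. If
  -- `s` is not a natural number, the coefficient never vanishes, so all powers `f ^ n w` are
  -- nonzero.
  have hE : ∀ n : ℕ, π (E (gamma p)) ((f ^ (n + 1)) w) = (-((n + 1 : ℂ) * (s - n))) • (f ^ n) w := by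
    intro n
    induction n with
    | zero =>
      rw [zero_add, pow_one, pow_zero, Module.End.one_apply, hf,
        h0 _ _ (isDeg_gamma p) (isDeg_neg_gamma p), hw.map_gamma, map_zero, lie_E_neg, map_neg,
        LinearMap.neg_apply, hw.map_ofH, ← hh, ← hs, zero_add, ← neg_smul]
      congr 1; push_cast; ring
    | succ n ih =>
      rw [pow_succ', Module.End.mul_apply, hf,
        h0 _ _ (isDeg_gamma p) (isDeg_neg_gamma p), ← hf, ih, map_smul, lie_E_neg, map_neg,
        LinearMap.neg_apply, ← hh, hH, ← Module.End.mul_apply f, ← pow_succ', ← neg_smul,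
        ← add_smul]
      congr 1; push_cast; ring
  have hn0 : ∀ n : ℕ, (f ^ n) w ≠ 0 := by
    intro n
    induction n with
    | zero => simpa using hw.ne_zero
    | succ n ih =>
      intro h
      have := hE n
      rw [h, map_zero] at this
      rcases smul_eq_zero.1 this.symm with h | h
      · rw [neg_eq_zero, mul_eq_zero] at h
        rcases h with h | h
        · exact Nat.cast_add_one_ne_zero n h
        · exact hne n (sub_eq_zero.1 h)
      · exact ih h
  have hmem : ∀ n : ℕ, (f ^ n) w ∈ W := by
    intro n
    induction n with
    | zero => simpa using hwW
    | succ n ih =>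
      rw [pow_succ', Module.End.mul_apply]
      exact hst _ (isDeg_neg_gamma p) _ ih
  -- The eigenvalues `s - 2n` are distinct, which would give an infinite independent family in the
  -- finite-dimensional `W`.
  have hli : LinearIndependent ℂ fun n : ℕ => (⟨(f ^ n) w, hmem n⟩ : W) := by
    refine Module.End.eigenvectors_linearIndependent'
      ((π (ofH h)).restrict (hst _ (isDeg_ofH h))) (fun n : ℕ => s - 2 * n) (fun a b hab => ?_) _
      (fun n => ⟨Module.End.mem_eigenspace_iff.2 (Subtype.ext (hH n)), fun h =>
        hn0 n (congrArg Subtype.val h)⟩)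
    simpa using hab
  exact Set.infinite_univ (Set.finite_univ_iff.2 hli.finite)

theorem gammaVec_simple : ∀ j : Fin 5, gammaVec (Fin.castLE (by norm_num) j) =
    Pi.single (Fin.castLE (by norm_num) j) 1 := by decide

theorem latticeH_gamma_simple (j : Fin 5) :
    latticeH (gamma (Fin.castLE (by norm_num) j)).1 = Pi.single (Fin.castLE (by norm_num) j) 1 := by
  funext i
  simp only [latticeH, gamma, gammaVec_simple, Pi.single_apply]
  split_ifs <;> simp

theorem IsHW.dominant_simple (h0 : IsRepZero π) {W : Submodule ℂ V} [FiniteDimensional ℂ W]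
    (hst : ∀ x, IsDeg 0 x → ∀ w ∈ W, π x w ∈ W) {μ : Fin 6 → ℂ} {w : V} (hwW : w ∈ W)
    (hw : IsHW π μ w) (j : Fin 5) : ∃ n : ℕ, μ (Fin.castLE (by norm_num) j) = n := by
  obtain ⟨n, hn⟩ := hw.dominant h0 hst hwW (Fin.castLE (by norm_num) j)
  rw [latticeH_gamma_simple, evalWeight_single] at hn
  exact ⟨n, hn⟩

end HighestWeight

end XuE6
end

noncomputable section

namespace XuE6

open E6

/-! ### Representations graded in nonpositive degrees -/

section Layers

variable {V : Type*} [AddCommGroup V] [Module ℂ V] {π : E6 →ₗ[ℂ] Module.End ℂ V} {z : ℂ}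

/-- The eigenspace of the grading element for the eigenvalue `z - n`. -/
def layer (π : E6 →ₗ[ℂ] Module.End ℂ V) (z : ℂ) (n : ℕ) : Submodule ℂ V :=
  (π (ofH gradH)).eigenspace (z - n)

theorem mem_layer {n : ℕ} {w : V} : w ∈ layer π z n ↔ π (ofH gradH) w = (z - n) • w :=
  Module.End.mem_eigenspace_iff

theorem map_eigen_of_isDeg (hπ : ∀ x y, π ⁅x, y⁆ = ⁅π x, π y⁆) {d : ℤ} {x : E6} (hx : IsDeg d x)
    {t : ℂ} {w : V} (hw : π (ofH gradH) w = t • w) :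
    π (ofH gradH) (π x w) = (t + d) • π x w := by
  rw [rep_apply_comm hπ, hx, hw, map_smul, map_smul, LinearMap.smul_apply, add_smul]

theorem layer_map_zero (hπ : ∀ x y, π ⁅x, y⁆ = ⁅π x, π y⁆) {x : E6} (hx : IsDeg 0 x) {n : ℕ} {w : V}
    (hw : w ∈ layer π z n) : π x w ∈ layer π z n := by
  rw [mem_layer, map_eigen_of_isDeg hπ hx (mem_layer.1 hw), Int.cast_zero, add_zero]

theorem layer_map_xi (hπ : ∀ x y, π ⁅x, y⁆ = ⁅π x, π y⁆) (i : Fin 16) {n : ℕ} {w : V}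
    (hw : w ∈ layer π z (n + 1)) : π (xi i) w ∈ layer π z n := by
  rw [mem_layer, map_eigen_of_isDeg hπ (isDeg_xi i) (mem_layer.1 hw)]
  congr 1; push_cast; ring

theorem layer_map_eta (hπ : ∀ x y, π ⁅x, y⁆ = ⁅π x, π y⁆) (i : Fin 16) {n : ℕ} {w : V}
    (hw : w ∈ layer π z n) : π (eta i) w ∈ layer π z (n + 1) := by
  rw [mem_layer, map_eigen_of_isDeg hπ (isDeg_eta i) (mem_layer.1 hw)]
  congr 1; push_cast; ring

theorem eq_zero_of_mem_layer {n : ℕ} {w : V} (hw : w ∈ layer π z (n + 1))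
    (h : π (ofH gradH) w = z • w) : w = 0 := by
  rw [mem_layer, h, ← sub_eq_zero, ← sub_smul] at hw
  refine (smul_eq_zero.1 hw).resolve_left ?_
  push_cast
  intro h'
  exact Nat.cast_add_one_ne_zero (R := ℂ) n (by linear_combination h')

/-- The vectors annihilated by all products of `k` of the `ξ_i`. -/
def xiFilt (π : E6 →ₗ[ℂ] Module.End ℂ V) : ℕ → Submodule ℂ V
  | 0 => ⊥
  | k + 1 => ⨅ i, (xiFilt π k).comap (π (xi i))

theorem mem_xiFilt_succ {k : ℕ} {w : V} :
    w ∈ xiFilt π (k + 1) ↔ ∀ i, π (xi i) w ∈ xiFilt π k := by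
  simp [xiFilt]

theorem xiFilt_mono : Monotone (xiFilt π) := by
  refine monotone_nat_of_le_succ fun k => ?_
  induction k with
  | zero => exact bot_le
  | succ k ih =>
    intro w hw
    exact mem_xiFilt_succ.2 fun i => ih (mem_xiFilt_succ.1 hw i)

/-- The representation is generated in top degree in the dual sense: it is the sum of the layers,
the top layer is annihilated by the `ξ_i`, and it contains every vector annihilated by the `ξ_i`. -/
structure IsCoinduced (π : E6 →ₗ[ℂ] Module.End ℂ V) (z : ℂ) : Prop where
  rep : ∀ x y, π ⁅x, y⁆ = ⁅π x, π y⁆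
  iSup_layer : ⨆ n, layer π z n = ⊤
  xi_layer_zero : ∀ i, ∀ w ∈ layer π z 0, π (xi i) w = 0
  mem_layer_zero : ∀ w, (∀ i, π (xi i) w = 0) → π (ofH gradH) w = z • w
  finite : ∀ n, FiniteDimensional ℂ (layer π z n)

theorem IsCoinduced.layer_le_xiFilt (h : IsCoinduced π z) (n : ℕ) :
    layer π z n ≤ xiFilt π (n + 1) := by
  induction n with
  | zero =>
    intro w hw
    refine mem_xiFilt_succ.2 fun i => ?_
    rw [h.xi_layer_zero i w hw]; exact zero_mem _
  | succ n ih =>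
    intro w hw
    exact mem_xiFilt_succ.2 fun i => ih (layer_map_xi h.rep i hw)

theorem IsCoinduced.exists_mem_xiFilt (h : IsCoinduced π z) (w : V) : ∃ k, w ∈ xiFilt π k := by
  have hw : w ∈ ⨆ n, layer π z n := by rw [h.iSup_layer]; exact Submodule.mem_top
  induction hw using Submodule.iSup_induction' with
  | mem n x hx => exact ⟨n + 1, h.layer_le_xiFilt n hx⟩
  | zero => exact ⟨0, zero_mem _⟩
  | add x y _ _ hx hy =>
    obtain ⟨k, hk⟩ := hx
    obtain ⟨l, hl⟩ := hy
    exact ⟨max k l, add_mem (xiFilt_mono (le_max_left _ _) hk) (xiFilt_mono (le_max_right _ _) hl)⟩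

/-- A nonzero stable subspace meets the top layer. -/
theorem IsCoinduced.exists_mem_layer_zero (h : IsCoinduced π z) {N : Submodule ℂ V}
    (hN : ∀ x, ∀ w ∈ N, π x w ∈ N) (hN0 : N ≠ ⊥) : ∃ w ∈ N, w ≠ 0 ∧ w ∈ layer π z 0 := by
  obtain ⟨w, hw, hw0⟩ := N.ne_bot_iff.1 hN0
  obtain ⟨k, hk⟩ := h.exists_mem_xiFilt w
  -- Either all `ξ_i` kill `w`, which puts it in the top layer, or some nonzero `ξ_i w` lies in `N`
  -- one step lower in the filtration.
  induction k generalizing w with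
  | zero => exact absurd ((Submodule.mem_bot ℂ).1 hk) hw0
  | succ k ih =>
    by_cases hx : ∀ i, π (xi i) w = 0
    · exact ⟨w, hw, hw0, mem_layer.2 (by simpa using h.mem_layer_zero w hx)⟩
    · push Not at hx
      obtain ⟨i, hi⟩ := hx
      exact ih _ (hN _ w hw) hi (mem_xiFilt_succ.1 hk i)

theorem casimir_apply_comm (hπ : ∀ x y, π ⁅x, y⁆ = ⁅π x, π y⁆) (x : E6) (w : V) :
    π x (casimir π w) = casimir π (π x w) := by
  rw [← Module.End.mul_apply, casimir_comm hπ, Module.End.mul_apply]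

/-- The Casimir operator is a scalar if it is one on the top layer. -/
theorem IsCoinduced.casimir_eq (h : IsCoinduced π z) {χ : ℂ}
    (h0 : ∀ w ∈ layer π z 0, casimir π w = χ • w) (n : ℕ) {w : V} (hw : w ∈ layer π z n) :
    casimir π w = χ • w := by
  induction n generalizing w with
  | zero => exact h0 w hw
  | succ n ih =>
    -- By induction all `ξ_i` annihilate this difference, so it has the grading eigenvalue of the
    -- top layer; as it lies in layer `n + 1`, it is zero.
    have hmem : casimir π w - χ • w ∈ layer π z (n + 1) := by
      refine sub_mem (mem_layer.2 ?_) (Submodule.smul_mem _ _ hw)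
      rw [casimir_apply_comm h.rep, mem_layer.1 hw, map_smul]
    refine sub_eq_zero.1 (eq_zero_of_mem_layer hmem (h.mem_layer_zero _ fun i => ?_))
    rw [map_sub, casimir_apply_comm h.rep, map_smul, ih (layer_map_xi h.rep i hw), sub_self]

theorem etaXi_apply (w : V) : etaXi π w = ∑ i, π (eta i) (π (xi i) w) := by
  simp [etaXi]

/-- If no highest weight vector of a layer has the Casimir eigenvalue of the top layer, then the
layer is obtained from the preceding one by the action of the `η_i`. -/
theorem IsCoinduced.layer_le (h : IsCoinduced π z) {χ : ℂ}
    (h0 : ∀ w ∈ layer π z 0, casimir π w = χ • w) {n : ℕ}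
    (hne : ∀ μ, ∀ w ∈ layer π z (n + 1), IsHW π μ w → casimirValue μ ≠ χ) {N : Submodule ℂ V}
    (hN : ∀ x, ∀ w ∈ N, π x w ∈ N) (hn : layer π z n ≤ N) : layer π z (n + 1) ≤ N := by
  haveI := h.finite (n + 1)
  have hst : ∀ w ∈ layer π z (n + 1), etaXi π w ∈ layer π z (n + 1) := by
    intro w hw
    rw [etaXi_apply]
    exact sum_mem fun i _ => layer_map_eta h.rep i (layer_map_xi h.rep i hw)
  have hcomm : ∀ x, IsDeg 0 x → ∀ w, π x (etaXi π w) = etaXi π (π x w) := fun x hx w =>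
    LinearMap.congr_fun (etaXi_comm h.rep hx) w
  -- The kernel of `∑ η_i ξ_i` in the layer is finite-dimensional and stable under `𝒢₀`. If it were
  -- nonzero, it would contain a highest weight vector, on which the Casimir operator is both
  -- `casimirValue μ` and `χ`.
  have hinj : layer π z (n + 1) ⊓ LinearMap.ker (etaXi π) = ⊥ := by
    by_contra hbot
    haveI : FiniteDimensional ℂ ↥(layer π z (n + 1) ⊓ LinearMap.ker (etaXi π)) :=
      Submodule.finiteDimensional_of_le inf_le_left
    obtain ⟨w, ⟨hw, hker⟩, μ, hμ⟩ := (IsRepZero.of_rep h.rep).exists_isHW _ hbot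
      (fun x hx w hw => ⟨layer_map_zero h.rep hx hw.1, LinearMap.mem_ker.2 <| by
        rw [← hcomm x hx, LinearMap.mem_ker.1 hw.2, map_zero]⟩)
    have h1 := hμ.casimir_apply h.rep
    rw [LinearMap.mem_ker.1 hker, smul_zero, sub_zero, h.casimir_eq h0 (n + 1) hw,
      ← sub_eq_zero, ← sub_smul] at h1
    exact hne μ w hw hμ (sub_eq_zero.1 ((smul_eq_zero.1 h1).resolve_right hμ.ne_zero)).symm
  let T : Module.End ℂ (layer π z (n + 1)) := (etaXi π).restrict hst
  have hT : Function.Injective T := by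
    rw [← LinearMap.ker_eq_bot, LinearMap.ker_eq_bot']
    intro w hw
    refine Subtype.ext ((Submodule.mem_bot ℂ).1 ?_)
    rw [← hinj]
    exact ⟨w.2, LinearMap.mem_ker.2 (congrArg Subtype.val hw)⟩
  intro w hw
  -- Injectivity in finite dimension gives surjectivity, so `w = ∑ η_i (ξ_i u)` with every `ξ_i u`
  -- in the preceding layer, which is contained in `N`.
  obtain ⟨u, hu⟩ := LinearMap.injective_iff_surjective.1 hT ⟨w, hw⟩
  have hu' : etaXi π u.1 = w := congrArg Subtype.val hu
  rw [← hu', etaXi_apply]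
  exact sum_mem fun i _ => hN _ _ (hn (layer_map_xi h.rep i u.2))

end Layers

end XuE6
end

noncomputable section

namespace XuE6

open E6 MvPolynomial

/-! ### Coordinates of `M̂` -/

section Coordinates

variable {M : Type*} [AddCommGroup M] [Module ℂ M] {R : E6 →ₗ[ℂ] Module.End ℂ M}

variable (M) in
/-- The coordinates of an element of `M̂` with respect to the monomials. -/
def coordEquiv : Hat M ≃ₗ[ℂ] ((Fin 16 →₀ ℕ) →₀ M) :=
  TensorProduct.equivFinsuppOfBasisLeft (basisMonomials (Fin 16) ℂ)

/-- The coefficient of a monomial in an element of `M̂`. -/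
def coord (d : Fin 16 →₀ ℕ) : Hat M →ₗ[ℂ] M := Finsupp.lapply d ∘ₗ (coordEquiv M).toLinearMap

theorem coord_tmul (d : Fin 16 →₀ ℕ) (f : Poly) (m : M) : coord d (f ⊗ₜ m) = coeff d f • m :=
  TensorProduct.equivFinsuppOfBasisLeft_apply_tmul_apply _ _ _ _

theorem coord_monomial (d e : Fin 16 →₀ ℕ) (m : M) :
    coord d (monomial e (1 : ℂ) ⊗ₜ[ℂ] m) = if e = d then m else 0 := by
  rw [coord_tmul, coeff_monomial]
  split_ifs <;> simp

theorem eq_of_coord {w w' : Hat M} (h : ∀ d, coord d w = coord d w') : w = w' :=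
  (coordEquiv M).injective (Finsupp.ext h)

theorem eq_sum_coord (w : Hat M) :
    w = ∑ d ∈ (coordEquiv M w).support, monomial d (1 : ℂ) ⊗ₜ[ℂ] coord d w := by
  refine eq_of_coord fun e => ?_
  rw [map_sum]
  simp only [coord_monomial]
  rw [Finset.sum_ite_eq']
  split_ifs with h
  · rfl
  · exact Finsupp.notMem_support_iff.1 h

theorem eq_one_tmul {w : Hat M} (h : ∀ d, d ≠ 0 → coord d w = 0) : w = 1 ⊗ₜ coord 0 w := by
  refine eq_of_coord fun d => ?_
  have h1 : (1 : Poly) ⊗ₜ[ℂ] coord 0 w = monomial 0 (1 : ℂ) ⊗ₜ[ℂ] coord 0 w := rfl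
  rw [h1, coord_monomial]
  split_ifs with hd
  · rw [hd]
  · exact h d (Ne.symm hd)

theorem coord_mulAct_one (d : Fin 16 →₀ ℕ) (A : Module.End ℂ M) (w : Hat M) :
    coord d (mulAct 1 A w) = A (coord d w) := by
  have : coord d ∘ₗ mulAct 1 A = A ∘ₗ coord (M := M) d := by
    refine TensorProduct.ext' fun f m => ?_
    simp only [LinearMap.comp_apply, mulAct_tmul, one_mul, coord_tmul, map_smul]
  exact LinearMap.congr_fun this w

theorem derivation_monomial (D : Derivation ℂ Poly Poly) (t : Fin 16 → ℂ)
    (hD : ∀ i, D (X i) = t i • X i) (d : Fin 16 →₀ ℕ) :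
    D (monomial d 1) = (∑ i, (d i : ℂ) * t i) • monomial d (1 : ℂ) := by
  induction d using Finsupp.induction_linear with
  | zero =>
    have : (monomial 0 (1 : ℂ) : Poly) = 1 := rfl
    rw [this]; simp
  | add d e hd he =>
    have : (monomial (d + e) (1 : ℂ) : Poly) = monomial d 1 * monomial e 1 := by
      rw [monomial_mul, one_mul]
    rw [this, Derivation.leibniz, hd, he]
    simp only [Finsupp.add_apply, Nat.cast_add, add_mul, Finset.sum_add_distrib, smul_eq_mul,
      add_smul, mul_smul_comm]
    rw [mul_comm (monomial e (1 : ℂ)), add_comm]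
  | single i k =>
    rw [← X_pow_eq_monomial, Derivation.leibniz_pow, hD]
    have : ∑ j, ((Finsupp.single i k j : ℕ) : ℂ) * t j = k * t i := by
      rw [Finset.sum_eq_single i]
      · simp
      · intro j _ hj; simp [Finsupp.single_apply, Ne.symm hj]
      · simp
    rw [this, smul_eq_mul, mul_smul_comm, mul_smul, Nat.cast_smul_eq_nsmul]
    rcases k with _ | k
    · simp
    · rw [Nat.add_sub_cancel, pow_succ]

theorem coord_vectorField_diag (D : Derivation ℂ Poly Poly) (t : Fin 16 → ℂ)
    (hD : ∀ i, D (X i) = t i • X i) (d : Fin 16 →₀ ℕ) (w : Hat M) :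
    coord d (vectorField M D w) = (∑ i, (d i : ℂ) * t i) • coord d w := by
  have : coord d ∘ₗ vectorField M D = (∑ i, (d i : ℂ) * t i) • coord (M := M) d := by
    refine hat_hom_ext fun e m => ?_
    rw [LinearMap.comp_apply, vectorField_tmul, derivation_monomial D t hD, LinearMap.smul_apply,
      ← TensorProduct.smul_tmul', map_smul, coord_monomial]
    split_ifs with h
    · rw [h]
    · simp
  exact LinearMap.congr_fun this w

/-- The weight `∑ d_i β_i`. -/
def monomialWeight (d : Fin 16 →₀ ℕ) : Fin 6 → ℂ := fun j => ∑ i, (d i : ℂ) * (betaVec i j : ℂ)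

theorem form_sum_right {ι : Type*} (s : Finset ι) (h : Fin 6 → ℂ) (a : ι → ℂ)
    (b : ι → Fin 6 → ℂ) : form h (fun j => ∑ i ∈ s, a i * b i j) = ∑ i ∈ s, a i * form h (b i) := by
  classical
  induction s using Finset.induction_on with
  | empty => simp [form]
  | insert i s hi ih =>
    rw [Finset.sum_insert hi, ← ih]
    simp only [Finset.sum_insert hi, form]
    ring

theorem form_monomialWeight (h : Fin 6 → ℂ) (d : Fin 16 →₀ ℕ) :
    form h (monomialWeight d) = ∑ i, (d i : ℂ) * form h (latticeH (betaVec i)) :=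
  form_sum_right _ h _ _

theorem polyAct_ofH_X (h : Fin 6 → ℂ) (i : Fin 16) :
    polyAct (ofH h) (X i) = (-form h (latticeH (betaVec i))) • X i := by
  have h1 : ⁅ofH h, eta i⁆ = (-form h (latticeH (betaVec i))) • eta i := by
    rw [eta, lie_H_E, latticeH_neg, form_neg_right]; rfl
  rw [polyAct_X_eta, h1, Finset.sum_eq_single i]
  · simp [etaCoeff_eta, smul_eq_C_mul]
  · intro j _ hj
    simp [etaCoeff_eta, hj]
  · simp

/-- The variable `x_i` is a weight vector of weight `-β_i`. -/
theorem coord_hatAct_ofH (d : Fin 16 →₀ ℕ) (h : Fin 6 → ℂ) (w : Hat M) :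
    coord d (hatAct R (ofH h) w) = R (ofH h) (coord d w) - form h (monomialWeight d) • coord d w := by
  rw [hatAct_zero R (isDeg_ofH h), LinearMap.add_apply, map_add, coord_mulAct_one,
    coord_vectorField_diag _ _ (polyAct_ofH_X h), form_monomialWeight, add_comm, sub_eq_add_neg,
    ← neg_smul]
  simp

theorem form_gradH_monomialWeight (d : Fin 16 →₀ ℕ) :
    form gradH (monomialWeight d) = (d.degree : ℂ) := by
  rw [form_gradH, monomialWeight, Finsupp.degree_eq_sum]
  simp [betaVec_five]

variable {z : ℂ}

theorem coord_hatAct_gradH (hz : R (ofH gradH) = z • LinearMap.id) (d : Fin 16 →₀ ℕ) (w : Hat M) :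
    coord d (hatAct R (ofH gradH) w) = (z - d.degree) • coord d w := by
  rw [coord_hatAct_ofH, hz, form_gradH_monomialWeight, sub_smul]; rfl

theorem mem_layer_iff_coord (hz : R (ofH gradH) = z • LinearMap.id) {n : ℕ} {w : Hat M} :
    w ∈ layer (hatAct R) z n ↔ ∀ d, d.degree ≠ n → coord d w = 0 := by
  rw [mem_layer]
  constructor
  · intro h d hd
    have h1 := congrArg (coord d) h
    rw [coord_hatAct_gradH hz, map_smul, ← sub_eq_zero, ← sub_smul] at h1
    refine (smul_eq_zero.1 h1).resolve_left fun h2 => hd ?_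
    exact_mod_cast (by linear_combination -h2 : (d.degree : ℂ) = n)
  · intro h
    refine eq_of_coord fun d => ?_
    rw [coord_hatAct_gradH hz, map_smul]
    by_cases hd : d.degree = n
    · rw [hd]
    · rw [h d hd, smul_zero, smul_zero]

theorem monomial_mem_layer (hz : R (ofH gradH) = z • LinearMap.id) (d : Fin 16 →₀ ℕ) (m : M) :
    monomial d (1 : ℂ) ⊗ₜ[ℂ] m ∈ layer (hatAct R) z d.degree := by
  rw [mem_layer_iff_coord hz]
  intro e he
  rw [coord_monomial, if_neg]
  rintro rfl
  exact he rfl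

theorem one_tmul_mem_layer (hz : R (ofH gradH) = z • LinearMap.id) (m : M) :
    (1 : Poly) ⊗ₜ[ℂ] m ∈ layer (hatAct R) z 0 := by
  simpa using monomial_mem_layer hz 0 m

theorem eq_one_tmul_of_mem_layer (hz : R (ofH gradH) = z • LinearMap.id) {w : Hat M}
    (hw : w ∈ layer (hatAct R) z 0) : w = 1 ⊗ₜ coord 0 w := by
  rw [mem_layer_iff_coord hz] at hw
  refine eq_one_tmul fun d hd => hw d ?_
  rwa [Ne, Finsupp.degree_eq_zero_iff]

/-- The layer of index `n` consists of the homogeneous polynomials of degree `n` with coefficients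
in `M`. A vector killed by all `∂_{x_i}` is killed by the Euler operator, which multiplies each
monomial by its degree; so it is constant. -/
theorem isCoinduced_hatAct [FiniteDimensional ℂ M] (hR : IsZeroRep R)
    (hz : R (ofH gradH) = z • LinearMap.id) : IsCoinduced (hatAct R) z where
  rep := hatAct_lie hR
  iSup_layer := by
    rw [eq_top_iff]
    intro w _
    rw [eq_sum_coord w]
    exact sum_mem fun d _ => Submodule.mem_iSup_of_mem d.degree (monomial_mem_layer hz d _)
  xi_layer_zero i w hw := by
    rw [eq_one_tmul_of_mem_layer hz hw, hatAct_xi hR, vectorField_tmul]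
    simp
  mem_layer_zero w hw := by
    have h0 : eulerOp M w = 0 := eulerOp_eq_zero fun r => by rw [← hatAct_xi hR]; exact hw r
    have h1 : w ∈ layer (hatAct R) z 0 := by
      rw [mem_layer_iff_coord hz]
      intro d hd
      have h2 := congrArg (coord d) h0
      rw [coord_vectorField_diag euler 1 (fun i => by simp [euler_X]), map_zero] at h2
      refine (smul_eq_zero.1 h2).resolve_left ?_
      rw [Finsupp.degree_eq_sum] at hd
      simp only [Pi.one_apply, mul_one]
      exact_mod_cast hd
    simpa using mem_layer.1 h1
  finite n := by
    haveI : Finite {d : Fin 16 →₀ ℕ // d.degree = n} := Finsupp.finite_of_degree_eq n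
    let g : layer (hatAct R) z n →ₗ[ℂ] ({d : Fin 16 →₀ ℕ // d.degree = n} → M) :=
      LinearMap.pi fun d => coord d.1 ∘ₗ (layer (hatAct R) z n).subtype
    refine FiniteDimensional.of_injective g ?_
    intro w w' h
    refine Subtype.ext (eq_of_coord fun d => ?_)
    by_cases hd : d.degree = n
    · exact congrFun h ⟨d, hd⟩
    · rw [(mem_layer_iff_coord hz).1 w.2 d hd, (mem_layer_iff_coord hz).1 w'.2 d hd]

/-! ### The leading monomial of a highest weight vector -/

/-- The height of `∑ d_i β_i`. -/
def monomialHeight (d : Fin 16 →₀ ℕ) : ℤ := ∑ i, (d i : ℤ) * ∑ j, betaVec i j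

theorem form_heightH_monomialWeight (d : Fin 16 →₀ ℕ) :
    form heightH (monomialWeight d) = (monomialHeight d : ℂ) := by
  rw [form_monomialWeight, monomialHeight]
  push_cast
  refine Finset.sum_congr rfl fun i _ => ?_
  rw [form_heightH]
  simp [latticeH]

theorem isZeroRep_zero : IsZeroRep (0 : E6 →ₗ[ℂ] Module.End ℂ M) where
  xi _ := rfl
  eta _ := rfl
  lie x y _ _ := by simp [Ring.lie_def]

theorem isRepZero_hatAct (hR : IsZeroRep R) : IsRepZero (hatAct R) :=
  IsRepZero.of_rep (hatAct_lie hR)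

/-- The vector field of `E_γ` raises the height, and `x^e` has height `-monomialHeight e`. Hence
only monomials of strictly smaller `monomialHeight` occur in the image. -/
theorem coord_vectorField_gamma_monomial (p : Fin 20) {d e : Fin 16 →₀ ℕ}
    (h : monomialHeight e ≤ monomialHeight d) (m : M) :
    coord d (vectorField M (polyAct (E (gamma p))) (monomial e (1 : ℂ) ⊗ₜ[ℂ] m)) = 0 := by
  -- With the zero representation on `M` the action on `M̂` involves the polynomials alone, so the
  -- height relation for `E_γ` becomes a statement about its vector field.
  obtain ⟨R, hR⟩ : ∃ R : E6 →ₗ[ℂ] Module.End ℂ M, R = 0 := ⟨0, rfl⟩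
  have hR0 : IsZeroRep R := hR ▸ isZeroRep_zero
  have hRz : ∀ u m, R u m = 0 := fun u m => by rw [hR]; rfl
  have hv : hatAct R (E (gamma p)) = vectorField M (polyAct (E (gamma p))) := by
    rw [hatAct_zero R (isDeg_gamma p), hR, LinearMap.zero_apply, mulAct_zero_right, add_zero]
  have h1 : hatAct R (ofH heightH) (monomial e (1 : ℂ) ⊗ₜ[ℂ] m)
      = (-(monomialHeight e : ℂ)) • (monomial e (1 : ℂ) ⊗ₜ[ℂ] m) := by
    refine eq_of_coord fun d => ?_
    rw [coord_hatAct_ofH, map_smul, coord_monomial, form_heightH_monomialWeight, hRz,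
      zero_sub, ← neg_smul]
    split_ifs with h
    · rw [h]
    · rw [smul_zero, smul_zero]
  have h2 := (isRepZero_hatAct hR0).ofH_E heightH (isDeg_gamma p) h1
  obtain ⟨n, hn⟩ := exists_height_gamma p
  rw [hv, hn] at h2
  generalize vectorField M (polyAct (E (gamma p))) (monomial e (1 : ℂ) ⊗ₜ[ℂ] m) = u at h2 ⊢
  have h3 := coord_hatAct_ofH (R := R) d heightH u
  rw [h2, map_smul, form_heightH_monomialWeight, hRz, zero_sub, ← neg_smul, ← sub_eq_zero,
    ← sub_smul] at h3
  refine (smul_eq_zero.1 h3).resolve_left fun h4 => ?_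
  have : (-(monomialHeight e) + (n + 1) - -(monomialHeight d) : ℤ) = 0 := by exact_mod_cast h4
  omega

theorem evalWeight_add_form (μ b h : Fin 6 → ℂ) :
    evalWeight (fun i => μ i + form (Pi.single i 1) b) h = evalWeight μ h + form h b := by
  simp only [evalWeight, form, Fin.sum_univ_six]
  simp
  ring

/-- The coefficient of a monomial of maximal weight in a highest weight vector of `M̂` is a highest
weight vector of `M`. -/
theorem IsHW.exists_leading {μ : Fin 6 → ℂ} {w : Hat M} (hw : IsHW (hatAct R) μ w) :
    ∃ d m, coord d w = m ∧ IsHW R (fun i => μ i + form (Pi.single i 1) (monomialWeight d)) m := by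
  have hne : (coordEquiv M w).support.Nonempty := by
    rw [Finsupp.support_nonempty_iff]
    intro h
    exact hw.ne_zero ((coordEquiv M).map_eq_zero_iff.1 h)
  -- Because `monomialHeight d` is maximal, the vector field part of `E_γ` contributes nothing to
  -- the coordinate at `d`. There `E_γ` acts through `R` only.
  obtain ⟨d, hd, hmax⟩ := Finset.exists_max_image _ monomialHeight hne
  refine ⟨d, coord d w, rfl, Finsupp.mem_support_iff.1 hd, fun p => ?_, fun h => ?_⟩
  · have h1 : coord d (vectorField M (polyAct (E (XuE6.gamma p))) w) = 0 := by
      conv_lhs => rw [eq_sum_coord w]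
      rw [map_sum, map_sum]
      exact Finset.sum_eq_zero fun e he => coord_vectorField_gamma_monomial p (hmax e he) _
    have h2 := congrArg (coord d) (hw.map_gamma p)
    rwa [hatAct_zero _ (isDeg_gamma p), LinearMap.add_apply, map_add, coord_mulAct_one, h1,
      zero_add, map_zero] at h2
  · have h2 := congrArg (coord d) (hw.map_ofH h)
    rw [coord_hatAct_ofH, map_smul, sub_eq_iff_eq_add, ← add_smul] at h2
    rw [h2, evalWeight_add_form]

end Coordinates

end XuE6
end

noncomputable section

namespace XuE6

open E6 MvPolynomial

/-! ### The 27-dimensional module -/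

section Minuscule

theorem form_betaVec_le_one : ∀ a b, a ≠ b → form (betaVec a) (betaVec b) ≤ 1 := by
  decide +kernel

/-- No three of the `β_i` are mutually orthogonal; repetitions count as nonorthogonal. This is what
limits words in the `η_i` to length two. -/
theorem exists_form_betaVec_pos : ∀ a b c, 1 ≤ form (betaVec a) (betaVec b) ∨
    1 ≤ form (betaVec b) (betaVec c) ∨ 1 ≤ form (betaVec a) (betaVec c) := by
  decide +kernel

/-- The square length is `6 + 2(β_a, β_b) - 2(β_r, β_a) - 2(β_r, β_b)`, which is at least `4` since
the last two products are at most `1`. -/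
theorem form_betaVec_ne_two : ∀ r a b, 1 ≤ form (betaVec a) (betaVec b) → r ≠ a → r ≠ b →
    form (betaVec r + -betaVec a + -betaVec b) (betaVec r + -betaVec a + -betaVec b) ≠ 2 := by
  decide +kernel

theorem form_latticeH (a b : Fin 6 → ℤ) : form (latticeH a) (latticeH b) = ((form a b : ℤ) : ℂ) := by
  simp only [form, latticeH]; push_cast; ring

theorem lie_lie_xi_eta_eta (r a b : Fin 16) (h : 1 ≤ form (betaVec a) (betaVec b)) :
    ⁅⁅xi r, eta a⁆, eta b⁆ = (if r = a then eta b else 0) + if r = b then eta a else 0 := by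
  have hH : ∀ i j, ⁅ofH (latticeH (betaVec i)), eta j⁆
      = -(((form (betaVec i) (betaVec j) : ℤ) : ℂ) • eta j) := by
    intro i j
    rw [eta, lie_H_E, latticeH_neg, form_neg_right, neg_smul, ← form_latticeH]; rfl
  have h1 : a ≠ b → form (betaVec a) (betaVec b) = 1 := fun hab =>
    le_antisymm (form_betaVec_le_one a b hab) h
  by_cases hra : r = a
  · subst hra
    rw [lie_xi_eta_self, neg_lie, hH, neg_neg, if_pos rfl]
    by_cases hab : r = b
    · subst hab
      rw [form_betaVec, if_pos rfl]; push_cast; rw [two_smul]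
    · rw [h1 hab, if_neg hab]; simp
  by_cases hrb : r = b
  · subst hrb
    have hab : a ≠ r := Ne.symm hra
    have h2 : ⁅⁅xi r, eta a⁆, eta r⁆ = ⁅xi r, ⁅eta a, eta r⁆⁆ - ⁅eta a, ⁅xi r, eta r⁆⁆ := lie_lie _ _ _
    rw [h2, lie_eta_eta, lie_zero, lie_xi_eta_self, lie_neg, zero_sub, neg_neg, ← lie_skew, hH,
      neg_neg, form_symm, h1 hab, if_neg hra, if_pos rfl]
    simp
  · rw [if_neg hra, if_neg hrb, add_zero]
    have h5 : ∀ i j, (betaVec i + -betaVec j) 5 = 0 := fun i j => by simp [betaVec_five]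
    have hne : betaVec r + -betaVec a ≠ 0 := fun h => hra
      (betaVec_injective (by rwa [← sub_eq_add_neg, sub_eq_zero] at h))
    have e1 : ⁅xi r, eta a⁆ = (F (betaVec r) (-betaVec a) : ℂ) • EOrZero (betaVec r + -betaVec a) := by
      rw [xi, eta, lie_E_E, rootBracket, if_neg]
      · rfl
      · exact hne
    rw [e1, smul_lie, EOrZero]
    split_ifs with hroot
    · rw [eta, lie_E_E, rootBracket, if_neg, EOrZero, dif_neg]
      · simp
      · exact form_betaVec_ne_two r a b h hra hrb
      · intro h0
        have := congrFun h0 5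
        change (betaVec r + -betaVec a) 5 + -betaVec b 5 = 0 at this
        rw [h5, betaVec_five] at this
        norm_num at this
    · simp

variable {V : Type*} [AddCommGroup V] [Module ℂ V] {π : E6 →ₗ[ℂ] Module.End ℂ V} {z : ℂ}

theorem hPart_lie_xi_eta (r b : Fin 16) : hPart ⁅xi r, eta b⁆ 5 = if r = b then -1 else 0 := by
  have h : ⁅ofH gradH, xi r⁆ = xi r := by
    have := isDeg_xi r
    rw [IsDeg] at this
    simpa using this
  have h2 := xiCoeff_eq_killing b (xi r)
  rw [xiCoeff_xi] at h2
  rw [hPart_eq_killing_gradH, ← killing_lie, h, ← neg_neg (killing _ _), ← h2]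
  simp only [eq_comm (a := b)]
  split_ifs <;> simp

/-- Applying `ξ_r` gives `-δ_{rb} η_a v - δ_{ra} η_b v` from the weight of `v`, and the double
commutator of `lie_lie_xi_eta_eta` cancels exactly these terms. So all `ξ_r` kill this vector of
degree two, and it is zero. -/
theorem IsCoinduced.eta_eta_eq_zero (h : IsCoinduced π z) {v : V} (hv : v ∈ layer π z 0)
    (hψ : ∀ u, IsDeg 0 u → π u v = hPart u 5 • v) {a b : Fin 16}
    (hab : 1 ≤ form (betaVec a) (betaVec b)) : π (eta a) (π (eta b) v) = 0 := by
  have hxi : ∀ r c, π (xi r) (π (eta c) v) = (if r = c then -1 else 0 : ℂ) • v := by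
    intro r c
    rw [rep_apply_comm h.rep, h.xi_layer_zero r v hv, map_zero, zero_add,
      hψ _ (isDeg_lie_xi_eta r c), hPart_lie_xi_eta]
  refine eq_zero_of_mem_layer (layer_map_eta h.rep a (layer_map_eta h.rep b hv))
    (h.mem_layer_zero _ fun r => ?_)
  rw [rep_apply_comm h.rep, hxi, rep_apply_comm h.rep ⁅xi r, eta a⁆,
    hψ _ (isDeg_lie_xi_eta r a), hPart_lie_xi_eta, lie_lie_xi_eta_eta r a b hab, map_add]
  split_ifs <;> simp

/-- The `η_i` commute, so a nonorthogonal pair among the three letters can be moved next to `v`. -/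
theorem IsCoinduced.eta_eta_eta_eq_zero (h : IsCoinduced π z) {v : V} (hv : v ∈ layer π z 0)
    (hψ : ∀ u, IsDeg 0 u → π u v = hPart u 5 • v) (a b c : Fin 16) :
    π (eta a) (π (eta b) (π (eta c) v)) = 0 := by
  have hcomm : ∀ i j w, π (eta i) (π (eta j) w) = π (eta j) (π (eta i) w) := by
    intro i j w
    rw [rep_apply_comm h.rep, lie_eta_eta, map_zero, LinearMap.zero_apply, add_zero]
  rcases exists_form_betaVec_pos a b c with h1 | h1 | h1
  · rw [hcomm b c, hcomm a c, h.eta_eta_eq_zero hv hψ h1, map_zero]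
  · rw [h.eta_eta_eq_zero hv hψ h1, map_zero]
  · rw [hcomm a b, h.eta_eta_eq_zero hv hψ h1, map_zero]

/-- The words in the `η_i` applied to a vector of weight `ω₆` have length at most two. -/
theorem IsCoinduced.wordSpan_eta_le (h : IsCoinduced π z) {v : V} (hv : v ∈ layer π z 0)
    (hψ : ∀ u, IsDeg 0 u → π u v = hPart u 5 • v) :
    wordSpan π eta v ≤ layer π z 0 ⊔ layer π z 1 ⊔ layer π z 2 := by
  have key : ∀ w, Word π eta v w → w = v ∨ (∃ a, w = π (eta a) v) ∨
      (∃ a b, w = π (eta a) (π (eta b) v)) ∨ w = 0 := by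
    intro w hw
    induction hw with
    | base => exact Or.inl rfl
    | step i w _ ih =>
      rcases ih with rfl | ⟨a, rfl⟩ | ⟨a, b, rfl⟩ | rfl
      · exact Or.inr (Or.inl ⟨i, rfl⟩)
      · exact Or.inr (Or.inr (Or.inl ⟨i, a, rfl⟩))
      · exact Or.inr (Or.inr (Or.inr (h.eta_eta_eta_eq_zero hv hψ i a b)))
      · exact Or.inr (Or.inr (Or.inr (map_zero _)))
  refine Submodule.span_le.2 fun w hw => ?_
  rcases key w hw with rfl | ⟨a, rfl⟩ | ⟨a, b, rfl⟩ | rfl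
  · exact Submodule.mem_sup_left (Submodule.mem_sup_left hv)
  · exact Submodule.mem_sup_left (Submodule.mem_sup_right (layer_map_eta h.rep a hv))
  · exact Submodule.mem_sup_right (layer_map_eta h.rep a (layer_map_eta h.rep b hv))
  · exact zero_mem _

theorem IsCoinduced.wordSpan_eta_stable (h : IsCoinduced π z) {v : V} (hv : v ∈ layer π z 0)
    (hψ : ∀ u, IsDeg 0 u → π u v = hPart u 5 • v) (x : E6) {w : V} (hw : w ∈ wordSpan π eta v) :
    π x w ∈ wordSpan π eta v := by
  have hvm : v ∈ wordSpan π eta v := Submodule.subset_span Word.base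
  refine wordSpan_stable (fun _ => True) (fun x i _ w => rep_apply_comm h.rep x (eta i) w)
    (fun _ _ _ => trivial) (fun x _ => ?_) (x := x) trivial hw
  induction x using E6.induction_graded with
  | h0 u hu => rw [hψ u hu]; exact Submodule.smul_mem _ _ hvm
  | hxi i => rw [h.xi_layer_zero i v hv]; exact zero_mem _
  | heta i => exact map_mem_wordSpan i hvm
  | hadd x y hx hy => rw [map_add]; exact add_mem hx hy
  | hsmul r x hx => rw [map_smul]; exact Submodule.smul_mem _ _ hx

end Minuscule

/-! ### Multiplication by polynomials -/

section Multiplication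

/-- The one-dimensional representation `u ↦ ψ(u)` of `𝒢₀`. -/
def charRep : E6 →ₗ[ℂ] Module.End ℂ ℂ where
  toFun u := hPart u 5 • LinearMap.id
  map_add' u v := by rw [map_add, Pi.add_apply, add_smul]
  map_smul' r u := by rw [map_smul, Pi.smul_apply, smul_assoc, RingHom.id_apply]

theorem charRep_apply (u : E6) : charRep u = hPart u 5 • LinearMap.id := rfl

theorem hPart_lie_five {x y : E6} (hx : IsDeg 0 x) : hPart ⁅x, y⁆ 5 = 0 := by
  rw [hPart_eq_killing_gradH, ← killing_lie, hx, Int.cast_zero, zero_smul, killing_zero_left]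

theorem isZeroRep_charRep : IsZeroRep charRep where
  xi i := by rw [charRep_apply, xi, hPart_E]; simp
  eta i := by rw [charRep_apply, eta, hPart_E]; simp
  lie x y hx _ := by
    rw [charRep_apply, charRep_apply, charRep_apply, hPart_lie_five hx, Ring.lie_def]
    ext; simp [mul_comm]

theorem charRep_gradH : charRep (ofH gradH) = (4 / 3 : ℂ) • LinearMap.id := by
  rw [charRep_apply, hPart_ofH]; simp [gradH]

variable {M : Type*} [AddCommGroup M] [Module ℂ M] {R R' : E6 →ₗ[ℂ] Module.End ℂ M}

/-- The polynomial that corresponds to an element of `𝒜 ⊗ ℂ`. -/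
def toPoly : Hat ℂ →ₗ[ℂ] Poly := (TensorProduct.rid ℂ Poly).toLinearMap

theorem toPoly_tmul (f : Poly) (r : ℂ) : toPoly (f ⊗ₜ r) = r • f := TensorProduct.rid_tmul _ _

theorem toPoly_vectorField (D : Derivation ℂ Poly Poly) (t : Hat ℂ) :
    toPoly (vectorField ℂ D t) = D (toPoly t) := by
  have : toPoly ∘ₗ vectorField ℂ D = (D : Poly →ₗ[ℂ] Poly) ∘ₗ toPoly := by
    refine TensorProduct.ext' fun f r => ?_
    rw [LinearMap.comp_apply, LinearMap.comp_apply, vectorField_tmul, toPoly_tmul, toPoly_tmul,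
      map_smul]
    rfl
  exact LinearMap.congr_fun this t

theorem toPoly_mulAct (g : Poly) (r : ℂ) (t : Hat ℂ) :
    toPoly (mulAct g (r • LinearMap.id) t) = r • (g * toPoly t) := by
  have : toPoly ∘ₗ mulAct g (r • LinearMap.id) = r • (LinearMap.mulLeft ℂ g ∘ₗ toPoly) := by
    refine TensorProduct.ext' fun f s => ?_
    rw [LinearMap.comp_apply, mulAct_tmul, toPoly_tmul, LinearMap.smul_apply, LinearMap.smul_apply,
      LinearMap.comp_apply, toPoly_tmul]
    simp [mul_smul]
  exact LinearMap.congr_fun this t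

variable (M) in
/-- Multiplication by a polynomial on `M̂`. -/
def mulPoly : Poly →ₗ[ℂ] Module.End ℂ (Hat M) where
  toFun g := mulAct g LinearMap.id
  map_add' g g' := by
    refine TensorProduct.ext' fun f m => ?_
    simp only [LinearMap.add_apply, mulAct_tmul, add_mul, TensorProduct.add_tmul]
  map_smul' r g := by
    refine TensorProduct.ext' fun f m => ?_
    simp only [LinearMap.smul_apply, mulAct_tmul, RingHom.id_apply, TensorProduct.smul_tmul',
      smul_mul_assoc]

theorem mulPoly_tmul (g f : Poly) (m : M) : mulPoly M g (f ⊗ₜ m) = (g * f) ⊗ₜ m := rfl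

theorem mulPoly_one (w : Hat M) : mulPoly M 1 w = w := by
  induction w using TensorProduct.induction_on with
  | zero => exact map_zero _
  | add x y hx hy => rw [map_add, hx, hy]
  | tmul f m => rw [mulPoly_tmul, one_mul]

theorem vectorField_mulPoly (D : Derivation ℂ Poly Poly) (g : Poly) (w : Hat M) :
    vectorField M D (mulPoly M g w) = mulPoly M (D g) w + mulPoly M g (vectorField M D w) := by
  induction w using TensorProduct.induction_on with
  | zero => simp only [map_zero, add_zero]
  | add x y hx hy => simp only [map_add, hx, hy]; abel
  | tmul f m =>
    rw [mulPoly_tmul, vectorField_tmul, vectorField_tmul, mulPoly_tmul, mulPoly_tmul,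
      Derivation.leibniz, TensorProduct.add_tmul, add_comm, smul_eq_mul, smul_eq_mul, mul_comm f]

theorem mulAct_mulPoly (g' g : Poly) (A : Module.End ℂ M) (r : ℂ) (w : Hat M) :
    mulAct g' (A + r • LinearMap.id) (mulPoly M g w)
      = mulPoly M (r • (g' * g)) w + mulPoly M g (mulAct g' A w) := by
  induction w using TensorProduct.induction_on with
  | zero => simp only [map_zero, add_zero]
  | add x y hx hy => simp only [map_add, hx, hy]; abel
  | tmul f m =>
    rw [mulPoly_tmul, mulAct_tmul, mulAct_tmul, mulPoly_tmul, mulPoly_tmul, LinearMap.add_apply,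
      TensorProduct.tmul_add, LinearMap.smul_apply, LinearMap.id_apply, add_comm, smul_mul_assoc,
      ← TensorProduct.smul_tmul', TensorProduct.tmul_smul, mul_assoc, mul_left_comm g]

/-- The action for the twist `R'` of `R` satisfies a Leibniz rule for multiplication. -/
theorem hatAct_mulPoly (hR : IsZeroRep R) (hR' : IsZeroRep R')
    (h : ∀ u, R' u = R u + hPart u 5 • LinearMap.id) (u : E6) (t : Hat ℂ) (w : Hat M) :
    hatAct R' u (mulPoly M (toPoly t) w) = mulPoly M (toPoly (hatAct charRep u t)) w
      + mulPoly M (toPoly t) (hatAct R u w) := by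
  induction u using E6.induction_graded with
  | hadd x y hx hy =>
    simp only [map_add, LinearMap.add_apply, hx, hy]; abel
  | hsmul r x hx => simp only [map_smul, LinearMap.smul_apply, hx, smul_add]
  | hxi i =>
    rw [hatAct_xi hR, hatAct_xi hR', hatAct_xi isZeroRep_charRep, vectorField_mulPoly,
      toPoly_vectorField]
  | h0 u hu =>
    rw [hatAct_zero _ hu, hatAct_zero _ hu, hatAct_zero _ hu, LinearMap.add_apply,
      LinearMap.add_apply, LinearMap.add_apply, vectorField_mulPoly, h, mulAct_mulPoly, map_add,
      toPoly_vectorField, charRep_apply, toPoly_mulAct, map_add, map_add, LinearMap.add_apply]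
    abel
  | heta i =>
    rw [hatAct_eta hR, hatAct_eta hR', hatAct_eta isZeroRep_charRep, etaOp, etaOp, etaOp,
      LinearMap.add_apply, LinearMap.add_apply, LinearMap.add_apply, vectorField_mulPoly,
      LinearMap.sum_apply, LinearMap.sum_apply, LinearMap.sum_apply, map_add, map_sum, map_add,
      map_sum, toPoly_vectorField, map_add, LinearMap.add_apply, map_sum, LinearMap.sum_apply]
    simp only [h, mulAct_mulPoly, charRep_apply, toPoly_mulAct, Finset.sum_add_distrib]
    abel

theorem coord_mulPoly_one_tmul (d : Fin 16 →₀ ℕ) (t : Hat ℂ) (m : M) :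
    coord d (mulPoly M (toPoly t) (1 ⊗ₜ m)) = coord d t • m := by
  rw [mulPoly_tmul, coord_tmul, mul_one]
  congr 1
  have : (lcoeff ℂ d) ∘ₗ toPoly = coord (M := ℂ) d := by
    refine TensorProduct.ext' fun f r => ?_
    rw [LinearMap.comp_apply, toPoly_tmul, coord_tmul, map_smul, smul_eq_mul, smul_eq_mul, mul_comm]
    rfl
  exact LinearMap.congr_fun this t

/-- Twisting: if `M̂` for `R` is generated by `1 ⊗ M` then so is each submodule for the twist `R'`
that contains the first three layers. -/
theorem eq_top_of_twist (hR : IsZeroRep R) (hR' : IsZeroRep R')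
    (h : ∀ u, R' u = R u + hPart u 5 • LinearMap.id) {z' : ℂ}
    (hz' : R' (ofH gradH) = z' • LinearMap.id)
    (hgen : ∀ N : Submodule ℂ (Hat M), (∀ x, ∀ w ∈ N, hatAct R x w ∈ N) →
      (∀ m, (1 : Poly) ⊗ₜ[ℂ] m ∈ N) → N = ⊤)
    {N : Submodule ℂ (Hat M)} (hN : ∀ x, ∀ w ∈ N, hatAct R' x w ∈ N)
    (h0 : layer (hatAct R') z' 0 ≤ N) (h1 : layer (hatAct R') z' 1 ≤ N)
    (h2 : layer (hatAct R') z' 2 ≤ N) : N = ⊤ := by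
  have hco : IsCoinduced (hatAct charRep) (4 / 3) :=
    isCoinduced_hatAct isZeroRep_charRep charRep_gradH
  have hv : (1 : Poly) ⊗ₜ[ℂ] (1 : ℂ) ∈ layer (hatAct charRep) (4 / 3) 0 :=
    one_tmul_mem_layer charRep_gradH 1
  have hψ : ∀ u, IsDeg 0 u → hatAct charRep u ((1 : Poly) ⊗ₜ[ℂ] (1 : ℂ))
      = hPart u 5 • ((1 : Poly) ⊗ₜ[ℂ] (1 : ℂ)) := by
    intro u hu
    rw [hatAct_zero_one_tmul hu, charRep_apply, LinearMap.smul_apply, LinearMap.id_apply,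
      TensorProduct.tmul_smul]
  set S := wordSpan (hatAct charRep) eta ((1 : Poly) ⊗ₜ[ℂ] (1 : ℂ)) with hS
  -- `S` is the minuscule module inside the polynomials. `T` collects the vectors that all
  -- polynomials of `S` multiply into `N`.
  let T : Submodule ℂ (Hat M) := ⨅ t : S, N.comap (mulPoly M (toPoly t.1))
  have hT : ∀ w, w ∈ T ↔ ∀ t ∈ S, mulPoly M (toPoly t) w ∈ N := by
    intro w
    simp only [T, Submodule.mem_iInf, Submodule.mem_comap, Subtype.forall]
  have hTtop : T = ⊤ := by
    refine hgen T (fun x w hw => ?_) fun m => ?_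
    · rw [hT] at hw ⊢
      intro t ht
      -- By the Leibniz rule, `t · (x w) = x (t · w) - (x t) · w`; the first term lies in `N` as `N`
      -- is stable, the second as `S` is stable.
      have h3 := hatAct_mulPoly hR hR' h x t w
      rw [← sub_eq_iff_eq_add'] at h3
      rw [← h3]
      exact sub_mem (hN x _ (hw t ht)) (hw _ (hco.wordSpan_eta_stable hv hψ x ht))
    · rw [hT]
      intro t ht
      have hlayer : ∀ n, ∀ t ∈ layer (hatAct charRep) (4 / 3) n,
          mulPoly M (toPoly t) (1 ⊗ₜ m) ∈ layer (hatAct R') z' n := by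
        intro n t ht
        rw [mem_layer_iff_coord hz']
        intro d hd
        rw [coord_mulPoly_one_tmul, (mem_layer_iff_coord charRep_gradH).1 ht d hd, zero_smul]
      -- A polynomial of `S` has degree at most two, so its product with `1 ⊗ m` lies in the three
      -- layers assumed to be in `N`.
      obtain ⟨t01, ht01, t2, ht2, rfl⟩ := Submodule.mem_sup.1 (hco.wordSpan_eta_le hv hψ ht)
      obtain ⟨t0, ht0, t1, ht1, rfl⟩ := Submodule.mem_sup.1 ht01
      rw [map_add, map_add, map_add, map_add]
      exact add_mem (add_mem (h0 (hlayer 0 t0 ht0)) (h1 (hlayer 1 t1 ht1))) (h2 (hlayer 2 t2 ht2))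
  rw [eq_top_iff]
  intro w _
  -- The constant polynomial `1` is the empty word of `S`, so membership in `T` includes membership
  -- in `N`.
  have h4 := (hT w).1 (by rw [hTtop]; exact Submodule.mem_top) _ (Submodule.subset_span Word.base)
  rwa [toPoly_tmul, one_smul, mulPoly_one] at h4

end Multiplication

end XuE6
end

noncomputable section

namespace XuE6

open E6

/-! ### `o(10, ℂ)`-modules as `𝒢₀`-modules -/

/-- The matrix `E_{x,y} - E_{y*,x*}`, where `x*` is the index of the opposite weight. -/
def skewUnit (x y : Fin 5 ⊕ Fin 5) : Matrix (Fin 5 ⊕ Fin 5) (Fin 5 ⊕ Fin 5) ℂ :=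
  Matrix.single x y 1 - Matrix.single y.swap x.swap 1

theorem O10.apply_swap (A : O10) (x y : Fin 5 ⊕ Fin 5) : A.1 y.swap x.swap = -A.1 x y := by
  obtain ⟨A, h⟩ := A
  rw [LieAlgebra.Orthogonal.typeD, mem_skewAdjointMatricesLieSubalgebra,
    mem_skewAdjointMatricesSubmodule, Matrix.IsSkewAdjoint, Matrix.IsAdjointPair,
    LieAlgebra.Orthogonal.JD] at h
  have h2 := congrFun (congrFun h x.swap) y
  rcases x with x | x <;> rcases y with y | y <;>
    simpa [Matrix.mul_apply, Fintype.sum_sum_type, Matrix.one_apply] using h2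

/-- By `O10.apply_swap` each entry is counted twice, at `(x, y)` and at its mirror image; hence the
factor `1/2`. -/
theorem O10.eq_sum_skewUnit (A : O10) :
    A.1 = (1 / 2 : ℂ) • ∑ x, ∑ y, A.1 x y • skewUnit x y := by
  ext i j
  have h1 : ∑ x, ∑ y, (A.1 x y • Matrix.single x y (1 : ℂ)) i j = A.1 i j := by
    rw [Finset.sum_eq_single i, Finset.sum_eq_single j]
    · simp
    · intro y _ hy; simp [Matrix.single_apply, hy]
    · simp
    · intro x _ hx; simp [Matrix.single_apply, hx]
    · simp
  have h2 : ∑ x, ∑ y, (A.1 x y • Matrix.single y.swap x.swap (1 : ℂ)) i j = -A.1 i j := by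
    rw [← A.apply_swap i j, Finset.sum_eq_single j.swap, Finset.sum_eq_single i.swap]
    · simp
    · intro y _ hy
      have : y.swap ≠ i := fun h => hy (by rw [← h, Sum.swap_swap])
      simp [Matrix.single_apply, this]
    · simp
    · intro x _ hx
      have : x.swap ≠ j := fun h => hx (by rw [← h, Sum.swap_swap])
      simp [Matrix.single_apply, this]
    · simp
  simp only [Matrix.smul_apply, Matrix.sum_apply, skewUnit, smul_sub, Matrix.sub_apply,
    Finset.sum_sub_distrib] at h1 h2 ⊢
  rw [h1, h2, smul_eq_mul]
  ring

/-- The excluded pairs have weight difference `0`, where `skewUnit` is a Cartan element up to sign,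
or `±2ε_i`, where it vanishes. All other differences are roots. -/
theorem form_ofEps_natWeight : ∀ x y : Fin 5 ⊕ Fin 5, x ≠ y → y ≠ x.swap →
    form (ofEps (natWeight x - natWeight y)) (ofEps (natWeight x - natWeight y)) = 2 ∧
    epsInt (ofEps (natWeight x - natWeight y)) = natWeight x - natWeight y ∧
    natSign x y * natSign x y = 1 := by decide +kernel

theorem natSign_eq : ∀ x y : Fin 5 ⊕ Fin 5, x ≠ y → y ≠ x.swap → ∀ x' y' : Fin 5 ⊕ Fin 5,
    (if natWeight x - natWeight y = natWeight x' - natWeight y' then natSign x' y' else 0)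
      = natSign x y * ((if x = x' ∧ y = y' then 1 else 0) -
        if y.swap = x' ∧ x.swap = y' then 1 else 0) := by decide +kernel

theorem nuMat_natWeight {x y : Fin 5 ⊕ Fin 5} (h1 : x ≠ y) (h2 : y ≠ x.swap) :
    nuMat (natWeight x - natWeight y) = (natSign x y : ℂ) • skewUnit x y := by
  ext x' y'
  have h := natSign_eq x y h1 h2 x' y'
  have h' := congrArg (Int.cast (R := ℂ)) h
  push_cast at h'
  simpa [nuMat, skewUnit, Matrix.single_apply] using h'

/-- The matrices of the elements of `𝒢₀`. -/
def zeroImage : Submodule ℂ (Matrix (Fin 5 ⊕ Fin 5) (Fin 5 ⊕ Fin 5) ℂ) where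
  carrier := {A | ∃ u, IsDeg 0 u ∧ (rhoO u).1 = A}
  zero_mem' := ⟨0, isDeg_zero 0, by simp⟩
  add_mem' := by
    rintro _ _ ⟨u, hu, rfl⟩ ⟨v, hv, rfl⟩
    exact ⟨u + v, hu.add hv, by rw [map_add]; rfl⟩
  smul_mem' := by
    rintro r _ ⟨u, hu, rfl⟩
    exact ⟨r • u, hu.smul r, by rw [map_smul]; rfl⟩

theorem skewUnit_inl_inl_self (i : Fin 5) : skewUnit (.inl i) (.inl i) = (O10.cartan i).1 := by
  rw [coe_cartan]
  ext (x | x) (y | y) <;>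
    simp [skewUnit, Matrix.single_apply, Matrix.diagonal_apply, natWeight, eq_comm] <;>
    aesop

theorem cartan_mem_zeroImage (i : Fin 5) : (O10.cartan i).1 ∈ zeroImage := by
  let e : Fin 5 → ℂ := Pi.single i 1
  -- This vector inverts `epsCoord` on the elements with vanishing coordinate at `α₆`; it is the
  -- complex counterpart of `ofEps`.
  refine ⟨ofH ![e 0, (e 0 + e 1 + e 2 + e 3 + e 4) / 2, e 0 + e 1, e 0 + e 1 + e 2,
    (e 0 + e 1 + e 2 + e 3 - e 4) / 2, 0], isDeg_ofH _, ?_⟩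
  have h : epsCoord ![e 0, (e 0 + e 1 + e 2 + e 3 + e 4) / 2, e 0 + e 1, e 0 + e 1 + e 2,
    (e 0 + e 1 + e 2 + e 3 - e 4) / 2, 0] = e := by
    funext j
    fin_cases j <;> simp [epsCoord] <;> ring
  rw [rhoO_ofH, h]
  congr 1
  rw [Finset.sum_eq_single i]
  · simp [e]
  · intro j _ hj; simp [e, hj]
  · simp

theorem skewUnit_swap (x y : Fin 5 ⊕ Fin 5) : skewUnit y.swap x.swap = -skewUnit x y := by
  simp [skewUnit]

theorem skewUnit_mem_zeroImage (x y : Fin 5 ⊕ Fin 5) : skewUnit x y ∈ zeroImage := by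
  by_cases h1 : x = y
  · subst h1
    rcases x with i | i
    · rw [skewUnit_inl_inl_self]; exact cartan_mem_zeroImage i
    · have h := skewUnit_swap (.inl i) (.inl i)
      rw [Sum.swap_inl] at h
      rw [h, skewUnit_inl_inl_self]
      exact neg_mem (cartan_mem_zeroImage i)
  by_cases h2 : y = x.swap
  · subst h2
    have : skewUnit x x.swap = 0 := by simp [skewUnit]
    rw [this]; exact zero_mem _
  obtain ⟨hf, he, hs⟩ := form_ofEps_natWeight x y h1 h2
  have hmem : nuMat (natWeight x - natWeight y) ∈ zeroImage := by
    refine ⟨E ⟨ofEps (natWeight x - natWeight y), hf⟩, ?_, ?_⟩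
    · simpa [ofEps] using isDeg_E ⟨ofEps (natWeight x - natWeight y), hf⟩
    · rw [rhoO_E, coe_nuInvRoot _ (by simp [ofEps]), he]
  rw [nuMat_natWeight h1 h2] at hmem
  have h3 := zeroImage.smul_mem (natSign x y : ℂ) hmem
  rw [smul_smul, ← Int.cast_mul, hs, Int.cast_one, one_smul] at h3
  exact h3

/-- Surjectivity onto `o(10, ℂ)` is what turns irreducibility of `M` into irreducibility under `𝒢₀`.
-/
theorem exists_rhoO_eq (A : O10) : ∃ u, IsDeg 0 u ∧ rhoO u = A := by
  have h : A.1 ∈ zeroImage := by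
    rw [A.eq_sum_skewUnit]
    exact zeroImage.smul_mem _ (sum_mem fun x _ => sum_mem fun y _ =>
      zeroImage.smul_mem _ (skewUnit_mem_zeroImage x y))
  obtain ⟨u, hu, h⟩ := h
  exact ⟨u, hu, Subtype.ext h⟩

theorem epsInt_gammaVec : ∀ p, ∃ i j : Fin 5, i < j ∧
    (epsInt (gammaVec p) = natWeight (.inl i) - natWeight (.inl j) ∨
      epsInt (gammaVec p) = natWeight (.inl i) - natWeight (.inr j)) := by decide +kernel

theorem skewUnit_inl_inl (i j : Fin 5) : skewUnit (.inl i) (.inl j) = (O10.minus i j).1 := by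
  ext (x | x) (y | y) <;>
    simp [skewUnit, O10.minus, O10.mk, Matrix.single_apply]

theorem skewUnit_inl_inr (i j : Fin 5) : skewUnit (.inl i) (.inr j) = (O10.plus i j).1 := by
  ext (x | x) (y | y) <;>
    simp [skewUnit, O10.plus, O10.mk, Matrix.single_apply]

section

variable {M : Type*} [AddCommGroup M] [Module ℂ M] [LieRingModule O10 M] [LieModule ℂ O10 M]

theorem isRepZero_rho (c : ℂ) : IsRepZero (rho M c) := by
  intro x y hx hy v
  rw [(isZeroRep_rho M c).lie x y hx hy, Ring.lie_def, LinearMap.sub_apply, Module.End.mul_apply,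
    Module.End.mul_apply]
  abel

theorem rho_apply_apply (c : ℂ) (u : E6) (m : M) :
    rho M c u m = ⁅rhoO u, m⁆ + (rhoKappa u * c) • m := rfl

theorem isIrredZero_rho [LieModule.IsIrreducible ℂ O10 M] (c : ℂ) : IsIrredZero (rho M c) := by
  intro N hN hN0
  let N' : LieSubmodule ℂ O10 M :=
    { N with
      lie_mem := by
        intro A m hm
        obtain ⟨u, hu, rfl⟩ := exists_rhoO_eq A
        have h := hN u hu m hm
        rw [rho_apply_apply] at h
        exact (Submodule.add_mem_iff_left N (N.smul_mem _ hm)).1 h }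
  have hN' : (N' : Submodule ℂ M) = N := rfl
  rcases eq_bot_or_eq_top N' with h | h
  · exact absurd (by rw [← hN', h]; rfl) hN0
  · rw [← hN', h]; rfl

/-- `gradH` is one third of the central element `α̂`, on which `ϱ` is `2c`. -/
theorem rho_gradH (c : ℂ) : rho M c (ofH gradH) = (2 * c / 3) • LinearMap.id := by
  have h : rhoO (ofH gradH) = 0 := by
    rw [rhoO_ofH]
    refine Finset.sum_eq_zero fun i _ => ?_
    have : epsCoord gradH i = 0 := by
      fin_cases i <;> simp [epsCoord, gradH] <;> ring
    rw [this, zero_smul]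
  rw [rho_apply, h, map_zero, zero_add]
  congr 1
  simp [rhoKappa, hPart_ofH, gradH]
  ring

/-- `rhoKappa` is half the coordinate at `α₆`, so raising `c` by `2` adds exactly the character of
`charRep`. -/
theorem rho_eq_twist (c : ℂ) (u : E6) :
    rho M c u = rho M (c - 2) u + hPart u 5 • LinearMap.id := by
  rw [rho_apply, rho_apply, add_assoc, ← add_smul]
  congr 2
  simp [rhoKappa]
  ring

/-- The values at the simple coroots of the highest weight of `V(kε₁)` with `κ = c`. -/
def topWeight (k : ℕ) (c : ℂ) : Fin 6 → ℂ := ![k, 0, 0, 0, 0, (c - k) / 2]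

theorem isHW_rho {k : ℕ} {v : M} (hv : IsHighestWeightVector (Pi.single 0 (k : ℂ)) v) (c : ℂ) :
    IsHW (rho M c) (topWeight k c) v where
  ne_zero := hv.1
  map_gamma p := by
    have hk : rhoKappa (E (gamma p)) = 0 := by simp [rhoKappa, hPart_E]
    rw [rho_apply_apply, hk, zero_mul, zero_smul, add_zero, rhoO_E]
    obtain ⟨i, j, hij, h | h⟩ := epsInt_gammaVec p
    · have : nuInvRoot (gamma p) = (natSign (.inl i) (.inl j) : ℂ) • O10.minus i j := by
        refine Subtype.ext ?_
        rw [coe_nuInvRoot _ (gamma_five p), O10.coe_smul, ← skewUnit_inl_inl, gamma, h,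
          nuMat_natWeight (by simpa using hij.ne) (by simp)]
      rw [this, smul_lie, (hv.2.1 i j hij).1, smul_zero]
    · have : nuInvRoot (gamma p) = (natSign (.inl i) (.inr j) : ℂ) • O10.plus i j := by
        refine Subtype.ext ?_
        rw [coe_nuInvRoot _ (gamma_five p), O10.coe_smul, ← skewUnit_inl_inr, gamma, h,
          nuMat_natWeight (by simp) (by simpa using hij.ne')]
      rw [this, smul_lie, (hv.2.1 i j hij).2, smul_zero]
  map_ofH h := by
    have h1 : ⁅rhoO (ofH h), v⁆ = (epsCoord h 0 * k) • v := by
      rw [rhoO_ofH, sum_lie]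
      simp only [smul_lie, hv.2.2, smul_smul, ← Finset.sum_smul]
      congr 1
      rw [Finset.sum_eq_single 0]
      · simp
      · intro j _ hj; simp [hj]
      · simp
    rw [rho_apply_apply, h1, ← add_smul]
    congr 1
    -- The last entry of `topWeight` combines `-k/2`, from the restriction of `α₆` to the Cartan
    -- subalgebra of `o(10, ℂ)`, with `c/2` from `κ`.
    simp [evalWeight, topWeight, Fin.sum_univ_six, epsCoord, rhoKappa, hPart_ofH]
    ring

end

end XuE6
end

noncomputable section

namespace XuE6

open E6

/-! ### Casimir eigenvalues -/

theorem sum_gammaVec : ∀ i, ∑ p, gammaVec p i = (![8, 10, 14, 18, 10, 0] : Fin 6 → ℤ) i := by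
  decide +kernel

theorem sum_betaVec : ∀ i, ∑ a, betaVec a i = (![8, 12, 16, 24, 20, 16] : Fin 6 → ℤ) i := by
  decide +kernel

theorem sum_evalWeight {ι : Type*} [Fintype ι] (b : ι → Fin 6 → ℤ) (μ : Fin 6 → ℂ) :
    ∑ p, evalWeight μ (latticeH (b p)) = ∑ i, ((∑ p, b p i : ℤ) : ℂ) * μ i := by
  simp only [evalWeight, latticeH]
  rw [Finset.sum_comm]
  refine Finset.sum_congr rfl fun i _ => ?_
  rw [← Finset.sum_mul]
  push_cast
  rfl

/-- The Casimir eigenvalue of type `D₅`. -/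
def d5Value {K : Type*} [Field K] (a : Fin 5 → K) : K :=
  a 0 ^ 2 + 2 * a 2 ^ 2 + 3 * a 3 ^ 2 + 5 / 4 * a 1 ^ 2 + 5 / 4 * a 4 ^ 2
    + 2 * (a 0 * a 2 + a 0 * a 3 + a 0 * a 1 / 2 + a 0 * a 4 / 2 + 2 * a 2 * a 3 + a 2 * a 1
      + a 2 * a 4 + 3 / 2 * a 3 * a 1 + 3 / 2 * a 3 * a 4 + 3 / 4 * a 1 * a 4)
    + 8 * a 0 + 10 * a 1 + 14 * a 2 + 18 * a 3 + 10 * a 4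

/-- `H` is the orthogonal sum of the Cartan subalgebra of `D₅` and the line of `gradH`. The factor
`3/4` is the inverse of `(gradH, gradH) = 4/3`, and the linear term arises because the sum of the
`β_i` is `12 gradH`. -/
theorem casimirValue_eq (μ : Fin 6 → ℂ) : casimirValue μ =
    d5Value (fun j : Fin 5 => μ (Fin.castLE (by norm_num) j))
      + 3 / 4 * evalWeight μ gradH ^ 2 + 12 * evalWeight μ gradH := by
  rw [casimirValue, sum_evalWeight, sum_evalWeight]
  simp only [sum_gammaVec, sum_betaVec, evalWeight, gradH, d5Value, Fin.sum_univ_six, coweight]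
  simp [Fin.castLE]
  ring

/-- This expands `(λ, λ + 2ρ)` at `λ = μ - b`, where `(ρ, b)` is the height of `b`. -/
theorem casimirValue_sub_form (μ b : Fin 6 → ℂ) :
    casimirValue (fun i => μ i - form (Pi.single i 1) b)
      = casimirValue μ - 2 * evalWeight μ b + form b b - 2 * ∑ i, b i := by
  rw [casimirValue_eq, casimirValue_eq]
  simp only [evalWeight, gradH, d5Value, Fin.sum_univ_six, form]
  simp [Fin.castLE]
  ring

theorem casimirValue_topWeight (k : ℕ) (c : ℂ) :
    casimirValue (topWeight k c) = k ^ 2 + 8 * k + c ^ 2 / 3 + 8 * c := by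
  rw [casimirValue_eq]
  simp only [evalWeight, gradH, d5Value, Fin.sum_univ_six, topWeight]
  simp [Fin.castLE]
  ring

theorem d5Value_nonneg (n : Fin 5 → ℕ) : 0 ≤ d5Value (fun j => (n j : ℝ)) := by
  unfold d5Value
  positivity

/-- The difference of the two values is `x - k(k + 8) - N c + 3/4 N² - 12 N`, where the `D₅` part
`x` is nonnegative by dominance. The bound on the real part of `c` makes `-N c` outweigh the
negative terms, so the real part is positive. -/
theorem casimirValue_ne_of_re_lt {k : ℕ} {c : ℂ} (hc : c.re < -(k * (k + 8) : ℝ) - 12)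
    {μ : Fin 6 → ℂ} {N : ℕ} (hN : 1 ≤ N)
    (hdom : ∀ j : Fin 5, ∃ n : ℕ, μ (Fin.castLE (by norm_num) j) = n)
    (hg : evalWeight μ gradH = 2 * c / 3 - N) : casimirValue μ ≠ casimirValue (topWeight k c) := by
  choose n hn using hdom
  intro h
  rw [casimirValue_topWeight, casimirValue_eq, hg, funext hn] at h
  have hx := d5Value_nonneg n
  have hcast : d5Value (fun j => (n j : ℂ)) = ((d5Value (fun j => (n j : ℝ)) : ℝ) : ℂ) := by
    simp only [d5Value]; push_cast; rfl
  rw [hcast] at h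
  set x := d5Value (fun j => (n j : ℝ))
  have h2 : (x : ℂ) - k * (k + 8) - N * c + 3 / 4 * N ^ 2 - 12 * N = 0 := by
    linear_combination h
  have h3 : x - k * (k + 8) - N * c.re + 3 / 4 * N ^ 2 - 12 * N = 0 := by
    have h4 := congrArg Complex.re h2
    have e : (x : ℂ) - k * (k + 8) - N * c + 3 / 4 * N ^ 2 - 12 * N
        = ((x - k * (k + 8) + 3 / 4 * N ^ 2 - 12 * N : ℝ) : ℂ) - ((N : ℝ) : ℂ) * c := by
      push_cast; ring
    rw [e, Complex.sub_re, Complex.ofReal_re, Complex.re_ofReal_mul, Complex.zero_re] at h4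
    linarith
  have hN' : (1 : ℝ) ≤ N := by exact_mod_cast hN
  have hk : (0 : ℝ) ≤ k * (k + 8) := by positivity
  have h5 : (N : ℝ) * c.re < N * (-(k * (k + 8) : ℝ) - 12) :=
    mul_lt_mul_of_pos_left hc (by linarith)
  nlinarith [mul_le_mul_of_nonneg_right hN' hk, sq_nonneg (N : ℝ)]

/-- The indices `1` to `4` are the nodes `α₂, …, α₅` of `D₄`, at which `kε₁` vanishes; dominance of
the top weight minus `β_a` gives the hypothesis. The bounds are chosen to make `c + 14 + k`
nonnegative in `casimirValue_ne_one`. -/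
theorem dominant_betaVec : ∀ a,
    (∀ j : Fin 6, 1 ≤ j → j ≤ 4 → form (Pi.single j 1) (betaVec a) ≤ 0) →
    betaVec a 0 ≤ 1 ∧ ∑ i, betaVec a i ≤ 8 := by decide +kernel

theorem dominant_betaVec_add : ∀ a b,
    (∀ j : Fin 6, 1 ≤ j → j ≤ 4 → form (Pi.single j 1) (betaVec a + betaVec b) ≤ 0) →
    (betaVec a + betaVec b) 0 ≤ 2 ∧
    0 ≤ 14 + form (betaVec a + betaVec b) (betaVec a + betaVec b) / 2
      - ∑ i, (betaVec a + betaVec b) i ∧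
    form (betaVec a + betaVec b) (betaVec a + betaVec b) % 2 = 0 := by decide +kernel

/-! ### Generation of `M̂` by `1 ⊗ M` -/

section Generation

variable {M : Type*} [AddCommGroup M] [Module ℂ M] [LieRingModule O10 M] [LieModule ℂ O10 M]

/-- `M̂` is generated by `1 ⊗ M`. -/
def IsGenerated (M : Type*) [AddCommGroup M] [Module ℂ M] [LieRingModule O10 M]
    [LieModule ℂ O10 M] (c : ℂ) : Prop :=
  ∀ N : Submodule ℂ (Hat M), (∀ x, ∀ w ∈ N, hatAct (rho M c) x w ∈ N) →
    (∀ m, (1 : Poly) ⊗ₜ[ℂ] m ∈ N) → N = ⊤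

theorem isCoinduced_rho [FiniteDimensional ℂ M] (c : ℂ) :
    IsCoinduced (hatAct (rho M c)) (2 * c / 3) :=
  isCoinduced_hatAct (isZeroRep_rho M c) (rho_gradH c)

theorem layer_zero_le {c : ℂ} {N : Submodule ℂ (Hat M)} (h : ∀ m, (1 : Poly) ⊗ₜ[ℂ] m ∈ N) :
    layer (hatAct (rho M c)) (2 * c / 3) 0 ≤ N := by
  intro w hw
  rw [eq_one_tmul_of_mem_layer (rho_gradH c) hw]
  exact h _

/-- The vectors `m` with `1 ⊗ m` in `N` form a `𝒢₀`-stable subspace of the irreducible module `M`.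
-/
theorem forall_one_tmul_mem [LieModule.IsIrreducible ℂ O10 M] {c : ℂ} {N : Submodule ℂ (Hat M)}
    (hN : ∀ x, IsDeg 0 x → ∀ w ∈ N, hatAct (rho M c) x w ∈ N) {m : M} (hm : m ≠ 0)
    (hmN : (1 : Poly) ⊗ₜ[ℂ] m ∈ N) (m' : M) : (1 : Poly) ⊗ₜ[ℂ] m' ∈ N := by
  let K : Submodule ℂ M := N.comap (TensorProduct.mk ℂ Poly M 1)
  have hK : K = ⊤ := by
    refine isIrredZero_rho c K (fun x hx w hw => ?_) ((Submodule.ne_bot_iff _).2 ⟨m, hmN, hm⟩)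
    change (1 : Poly) ⊗ₜ[ℂ] rho M c x w ∈ N
    rw [← hatAct_zero_one_tmul hx]
    exact hN x hx _ hw
  have : m' ∈ K := by rw [hK]; exact Submodule.mem_top
  exact this

variable {k : ℕ} {v : M}

theorem isHW_one_tmul (hv : IsHighestWeightVector (Pi.single 0 (k : ℂ)) v) (c : ℂ) :
    IsHW (hatAct (rho M c)) (topWeight k c) ((1 : Poly) ⊗ₜ[ℂ] v) where
  ne_zero h := hv.1 (by
    have h1 := congrArg (coord 0) h
    rwa [coord_tmul, map_zero, MvPolynomial.coeff_zero_one, one_smul] at h1)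
  map_gamma p := by
    rw [hatAct_zero_one_tmul (isDeg_gamma p), (isHW_rho hv c).map_gamma, TensorProduct.tmul_zero]
  map_ofH h := by
    rw [hatAct_zero_one_tmul (isDeg_ofH h), (isHW_rho hv c).map_ofH, TensorProduct.tmul_smul]

/-- The eigenspace of the Casimir operator is stable and contains `1 ⊗ v`, because all `ξ_i` kill `1
⊗ v`. Hence it contains `1 ⊗ M`. -/
theorem casimir_layer_zero [FiniteDimensional ℂ M] [LieModule.IsIrreducible ℂ O10 M]
    (hv : IsHighestWeightVector (Pi.single 0 (k : ℂ)) v) (c : ℂ) :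
    ∀ w ∈ layer (hatAct (rho M c)) (2 * c / 3) 0,
      casimir (hatAct (rho M c)) w = casimirValue (topWeight k c) • w := by
  have hco := isCoinduced_rho (M := M) c
  intro w hw
  have key := layer_zero_le (c := c) (N := (casimir (hatAct (rho M c))).eigenspace
    (casimirValue (topWeight k c))) (forall_one_tmul_mem (c := c) (fun x _ w hw => ?_) hv.1 ?_)
  · exact Module.End.mem_eigenspace_iff.1 (key hw)
  · rw [Module.End.mem_eigenspace_iff] at hw ⊢
    rw [← casimir_apply_comm hco.rep, hw, map_smul]
  · rw [Module.End.mem_eigenspace_iff, (isHW_one_tmul hv c).casimir_apply hco.rep, etaXi_apply,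
      Finset.sum_eq_zero, smul_zero, sub_zero]
    intro i _
    rw [hco.xi_layer_zero i _ (one_tmul_mem_layer (rho_gradH c) v), map_zero]

theorem IsHW.evalWeight_gradH {c : ℂ} {μ : Fin 6 → ℂ} {n : ℕ} {w : Hat M}
    (hw : IsHW (hatAct (rho M c)) μ w) (h : w ∈ layer (hatAct (rho M c)) (2 * c / 3) n) :
    evalWeight μ gradH = 2 * c / 3 - n := by
  have h1 := hw.map_ofH gradH
  rw [mem_layer.1 h, ← sub_eq_zero, ← sub_smul] at h1
  exact (sub_eq_zero.1 ((smul_eq_zero.1 h1).resolve_right hw.ne_zero)).symm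

theorem IsHW.dominant_layer [FiniteDimensional ℂ M] {c : ℂ} {μ : Fin 6 → ℂ} {n : ℕ} {w : Hat M}
    (hw : IsHW (hatAct (rho M c)) μ w) (h : w ∈ layer (hatAct (rho M c)) (2 * c / 3) n)
    (j : Fin 5) : ∃ n : ℕ, μ (Fin.castLE (by norm_num) j) = n := by
  have hco := isCoinduced_rho (M := M) c
  haveI := hco.finite n
  exact hw.dominant_simple (IsRepZero.of_rep hco.rep)
    (fun x hx w hw => layer_map_zero hco.rep hx hw) h j

theorem isGenerated_of_re_lt [FiniteDimensional ℂ M] [LieModule.IsIrreducible ℂ O10 M]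
    (hv : IsHighestWeightVector (Pi.single 0 (k : ℂ)) v) {c : ℂ}
    (hc : c.re < -(k * (k + 8) : ℝ) - 12) : IsGenerated M c := by
  intro N hN h1
  have hco := isCoinduced_rho (M := M) c
  have key : ∀ n, layer (hatAct (rho M c)) (2 * c / 3) n ≤ N := by
    intro n
    induction n with
    | zero => exact layer_zero_le h1
    | succ n ih =>
      refine hco.layer_le (casimir_layer_zero hv c) (fun μ w hw hμ => ?_) hN ih
      exact casimirValue_ne_of_re_lt hc (Nat.succ_pos n) (hμ.dominant_layer hw)
        (hμ.evalWeight_gradH hw)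
  rw [eq_top_iff, ← hco.iSup_layer]
  exact iSup_le key

theorem exists_single_add {n : ℕ} {d : Fin 16 →₀ ℕ} (hd : d.degree = n + 1) :
    ∃ a e, d = Finsupp.single a 1 + e ∧ e.degree = n := by
  have h0 : d ≠ 0 := by
    rintro rfl
    rw [map_zero] at hd
    omega
  obtain ⟨a, ha⟩ := Finsupp.ne_iff.1 h0
  have h1 : Finsupp.single a 1 + (d - Finsupp.single a 1) = d := by
    apply add_tsub_cancel_of_le
    rw [Finsupp.single_le_iff]
    exact Nat.one_le_iff_ne_zero.2 ha
  refine ⟨a, d - Finsupp.single a 1, h1.symm, ?_⟩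
  have h2 := congrArg Finsupp.degree h1
  rw [map_add, Finsupp.degree_single] at h2
  omega

theorem monomialWeight_zero : monomialWeight 0 = latticeH 0 := by
  funext j; simp [monomialWeight, latticeH]

theorem monomialWeight_single_add (a : Fin 16) {e : Fin 16 →₀ ℕ} {b : Fin 6 → ℤ}
    (h : monomialWeight e = latticeH b) :
    monomialWeight (Finsupp.single a 1 + e) = latticeH (betaVec a + b) := by
  funext j
  have h1 := congrFun h j
  simp only [monomialWeight, latticeH] at h1 ⊢
  simp only [Finsupp.add_apply, Nat.cast_add, add_mul, Finset.sum_add_distrib, h1, Pi.add_apply,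
    Int.cast_add]
  congr 1
  rw [Finset.sum_eq_single a]
  · simp
  · intro i _ hi; simp [Finsupp.single_apply, Ne.symm hi]
  · simp

/-- The weight of a highest weight vector of `M̂`. -/
theorem IsHW.exists_weight [LieModule.IsIrreducible ℂ O10 M]
    (hv : IsHighestWeightVector (Pi.single 0 (k : ℂ)) v) {c : ℂ} {μ : Fin 6 → ℂ} {n : ℕ} {w : Hat M}
    (hw : IsHW (hatAct (rho M c)) μ w) (h : w ∈ layer (hatAct (rho M c)) (2 * c / 3) n) :
    ∃ d : Fin 16 →₀ ℕ, d.degree = n ∧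
      μ = fun i => topWeight k c i - form (Pi.single i 1) (monomialWeight d) := by
  obtain ⟨d, m, hm, hd⟩ := hw.exists_leading
  refine ⟨d, ?_, ?_⟩
  · by_contra hne
    exact hd.ne_zero (by rw [← hm, (mem_layer_iff_coord (rho_gradH c)).1 h d hne])
  -- The leading coefficient is a highest weight vector of the irreducible module `M`, so its weight
  -- must be the top weight.
  · have h1 := (isHW_rho hv c).weight_unique (isRepZero_rho c) (isIrredZero_rho c) hd
    funext i
    rw [← congrFun h1 i, add_sub_cancel_right]

theorem form_single_latticeH (j : Fin 6) (b : Fin 6 → ℤ) :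
    form (Pi.single j 1) (latticeH b) = ((form (Pi.single j 1) b : ℤ) : ℂ) := by
  rw [← form_latticeH]
  congr 1
  funext i
  simp only [latticeH, Pi.single_apply]
  split_ifs <;> simp

/-- At `α₂, …, α₅` the top weight is zero, so there the value of `μ` is `-(α_j, b)`, which has to be
a natural number. -/
theorem form_single_nonpos_of_dominant {c : ℂ} {μ : Fin 6 → ℂ} {b : Fin 6 → ℤ}
    (hμ : μ = fun i => topWeight k c i - form (Pi.single i 1) (latticeH b))
    (hdom : ∀ j : Fin 5, ∃ n : ℕ, μ (Fin.castLE (by norm_num) j) = n) (j : Fin 6) (h1 : 1 ≤ j)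
    (h4 : j ≤ 4) : form (Pi.single j 1) b ≤ 0 := by
  obtain ⟨i, rfl⟩ : ∃ i : Fin 5, Fin.castLE (by norm_num) i = j :=
    ⟨⟨j.1, by omega⟩, Fin.ext rfl⟩
  obtain ⟨n, hn⟩ := hdom i
  have h0 : topWeight k c (Fin.castLE (by norm_num) i) = 0 := by
    fin_cases i
    · exact absurd h1 (by decide)
    all_goals simp [topWeight, Fin.castLE]
  rw [hμ] at hn
  simp only [h0, form_single_latticeH, zero_sub] at hn
  have : (-(form (Pi.single (Fin.castLE (by norm_num) i) 1) b) : ℤ) = n := by exact_mod_cast hn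
  omega

theorem casimirValue_eq_topWeight {c : ℂ} {μ : Fin 6 → ℂ} {b : Fin 6 → ℤ}
    (hμ : μ = fun i => topWeight k c i - form (Pi.single i 1) (latticeH b))
    (h : casimirValue μ = casimirValue (topWeight k c)) :
    2 * k * (b 0 : ℂ) + (c - k) * b 5 = ((form b b : ℤ) : ℂ) - 2 * ((∑ i, b i : ℤ) : ℂ) := by
  rw [hμ, casimirValue_sub_form, form_latticeH] at h
  have h1 : evalWeight (topWeight k c) (latticeH b) = k * (b 0 : ℂ) + (c - k) / 2 * b 5 := by
    simp [evalWeight, topWeight, latticeH, Fin.sum_univ_six]; ring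
  have h2 : ∑ i, latticeH b i = ((∑ i, b i : ℤ) : ℂ) := by simp [latticeH]
  rw [h1, h2] at h
  linear_combination -h

theorem exists_nat_of_int {c : ℂ} (x : ℤ) (hx : 0 ≤ x) (h : c + 14 + k = x) :
    ∃ n : ℕ, c = (n : ℂ) - 14 - k := by
  lift x to ℕ using hx
  exact ⟨x, by rw [Int.cast_natCast] at h; rw [← h]; ring⟩

/-- Equality of Casimir values at the top weight minus `β_a` reads `c + 14 + k = 2k(1 - b₁) + 2(8 -
h)`, with `b₁` the coefficient of `β_a` at `α₁` and `h` its height. The right side is a nonnegative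
integer. -/
theorem casimirValue_ne_one [FiniteDimensional ℂ M] [LieModule.IsIrreducible ℂ O10 M]
    (hv : IsHighestWeightVector (Pi.single 0 (k : ℂ)) v) {c : ℂ}
    (hc : ∀ n : ℕ, c ≠ (n : ℂ) - 14 - k) {μ : Fin 6 → ℂ} {w : Hat M}
    (hw : w ∈ layer (hatAct (rho M c)) (2 * c / 3) 1) (hμ : IsHW (hatAct (rho M c)) μ w) :
    casimirValue μ ≠ casimirValue (topWeight k c) := by
  intro h
  obtain ⟨d, hd, hdμ⟩ := hμ.exists_weight hv hw
  obtain ⟨a, e, rfl, he⟩ := exists_single_add hd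
  rw [Finsupp.degree_eq_zero_iff] at he
  subst he
  rw [monomialWeight_single_add a monomialWeight_zero, add_zero] at hdμ
  obtain ⟨h0, hs⟩ := dominant_betaVec a fun j h1 h4 =>
    form_single_nonpos_of_dominant hdμ (hμ.dominant_layer hw) j h1 h4
  have h2 := casimirValue_eq_topWeight hdμ h
  rw [form_betaVec, betaVec_five] at h2
  obtain ⟨n, hn⟩ := exists_nat_of_int (k := k) (c := c)
    (2 * k * (1 - betaVec a 0) + 2 * (8 - ∑ i, betaVec a i))
    (add_nonneg (mul_nonneg (by positivity) (by omega)) (by omega))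
    (by push_cast at h2 ⊢; linear_combination h2)
  exact hc n hn

/-- For `b = β_a + β_b` equality reads `c + 14 + k = k(2 - b₁) + 14 + (b, b)/2 - h`, with `b₁` the
coefficient at `α₁` and `h` the height of `b`; this is again a nonnegative integer. -/
theorem casimirValue_ne_two [FiniteDimensional ℂ M] [LieModule.IsIrreducible ℂ O10 M]
    (hv : IsHighestWeightVector (Pi.single 0 (k : ℂ)) v) {c : ℂ}
    (hc : ∀ n : ℕ, c ≠ (n : ℂ) - 14 - k) {μ : Fin 6 → ℂ} {w : Hat M}
    (hw : w ∈ layer (hatAct (rho M c)) (2 * c / 3) 2) (hμ : IsHW (hatAct (rho M c)) μ w) :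
    casimirValue μ ≠ casimirValue (topWeight k c) := by
  intro h
  obtain ⟨d, hd, hdμ⟩ := hμ.exists_weight hv hw
  obtain ⟨a, e, rfl, he⟩ := exists_single_add hd
  obtain ⟨b, e', rfl, he'⟩ := exists_single_add he
  rw [Finsupp.degree_eq_zero_iff] at he'
  subst he'
  rw [monomialWeight_single_add a (monomialWeight_single_add b monomialWeight_zero), add_zero]
    at hdμ
  obtain ⟨h0, hs, hev⟩ := dominant_betaVec_add a b fun j h1 h4 =>
    form_single_nonpos_of_dominant hdμ (hμ.dominant_layer hw) j h1 h4
  have h2 := casimirValue_eq_topWeight hdμ h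
  have h5 : (betaVec a + betaVec b) 5 = 2 := by
    rw [Pi.add_apply, betaVec_five, betaVec_five]; rfl
  rw [h5] at h2
  -- The square length is even, so the integer division by `2` is exact.
  have hf : form (betaVec a + betaVec b) (betaVec a + betaVec b)
      = 2 * (form (betaVec a + betaVec b) (betaVec a + betaVec b) / 2) := by omega
  rw [hf] at h2
  obtain ⟨n, hn⟩ := exists_nat_of_int (k := k) (c := c)
    (k * (2 - (betaVec a + betaVec b) 0) + (14 + form (betaVec a + betaVec b)
      (betaVec a + betaVec b) / 2 - ∑ i, (betaVec a + betaVec b) i))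
    (add_nonneg (mul_nonneg (by positivity) (by omega)) hs)
    (by
      generalize form (betaVec a + betaVec b) (betaVec a + betaVec b) / 2 = f at h2 ⊢
      generalize ∑ i, (betaVec a + betaVec b) i = s at h2 ⊢
      generalize (betaVec a + betaVec b) 0 = b0 at h2 ⊢
      push_cast at h2 ⊢
      linear_combination h2 / 2)
  exact hc n hn

/-- Generation for `c - 2` implies generation for `c`. -/
theorem IsGenerated.twist [FiniteDimensional ℂ M] [LieModule.IsIrreducible ℂ O10 M]
    (hv : IsHighestWeightVector (Pi.single 0 (k : ℂ)) v) {c : ℂ}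
    (hc : ∀ n : ℕ, c ≠ (n : ℂ) - 14 - k) (h : IsGenerated M (c - 2)) : IsGenerated M c := by
  intro N hN hN1
  have hco := isCoinduced_rho (M := M) c
  have h0 := layer_zero_le (c := c) hN1
  have h1 := hco.layer_le (casimir_layer_zero hv c)
    (fun μ w hw hμ => casimirValue_ne_one hv hc hw hμ) hN h0
  have h2 := hco.layer_le (casimir_layer_zero hv c)
    (fun μ w hw hμ => casimirValue_ne_two hv hc hw hμ) hN h1
  exact eq_top_of_twist (isZeroRep_rho M (c - 2)) (isZeroRep_rho M c) (rho_eq_twist c)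
    (rho_gradH c) h hN h0 h1 h2

/-- The excluded set is closed under adding natural numbers, so `c - 2`, `c - 4`, … avoid it
whenever `c` does. Far enough down `isGenerated_of_re_lt` applies, and twisting climbs back to `c`.
-/
theorem isGenerated [FiniteDimensional ℂ M] [LieModule.IsIrreducible ℂ O10 M]
    (hv : IsHighestWeightVector (Pi.single 0 (k : ℂ)) v) {c : ℂ}
    (hc : ∀ n : ℕ, c ≠ (n : ℂ) - 14 - k) : IsGenerated M c := by
  have key : ∀ m : ℕ, ∀ c : ℂ, (∀ n : ℕ, c ≠ (n : ℂ) - 14 - k) → IsGenerated M (c - 2 * m) →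
      IsGenerated M c := by
    intro m
    induction m with
    | zero => intro c _ h; simpa using h
    | succ m ih =>
      intro c hc h
      refine IsGenerated.twist hv hc (ih (c - 2) (fun n hn => hc (n + 2) ?_) ?_)
      · push_cast; linear_combination hn
      · convert h using 1; push_cast; ring
  -- This `m` brings the real part of `c - 2m` below the bound required by `isGenerated_of_re_lt`.
  obtain ⟨m, hm⟩ := exists_nat_gt (c.re + k * (k + 8) + 12)
  refine key m c hc (isGenerated_of_re_lt hv ?_)
  have h0 : (0 : ℝ) ≤ m := m.cast_nonneg
  have h1 : (c - 2 * m).re = c.re - 2 * m := by simp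
  rw [h1]
  linarith

theorem eq_top_of_stable [FiniteDimensional ℂ M] [LieModule.IsIrreducible ℂ O10 M]
    (hv : IsHighestWeightVector (Pi.single 0 (k : ℂ)) v) {c : ℂ}
    (hc : ∀ n : ℕ, c ≠ (n : ℂ) - 14 - k) {N : Submodule ℂ (Hat M)}
    (hN : ∀ x, ∀ w ∈ N, hatAct (rho M c) x w ∈ N) (hN0 : N ≠ ⊥) : N = ⊤ := by
  obtain ⟨w, hwN, hw0, hw⟩ := (isCoinduced_rho (M := M) c).exists_mem_layer_zero hN hN0
  have h1 := eq_one_tmul_of_mem_layer (rho_gradH c) hw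
  refine isGenerated hv hc N hN (forall_one_tmul_mem (fun x _ => hN x) (m := coord 0 w) ?_ ?_)
  · intro h
    rw [h, TensorProduct.tmul_zero] at h1
    exact hw0 h1
  · rwa [← h1]

variable (M) in
/-- The `𝒢`-module structure of `M̂`. -/
abbrev hatLieRingModule (c : ℂ) : LieRingModule E6 (Hat M) where
  bracket u w := hatAct (rho M c) u w
  add_lie u u' w := by rw [map_add, LinearMap.add_apply]
  lie_add u w w' := map_add _ w w'
  leibniz_lie u u' w := by
    rw [hatAct_lie (isZeroRep_rho M c), Ring.lie_def, LinearMap.sub_apply, Module.End.mul_apply,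
      Module.End.mul_apply, sub_add_cancel]

end Generation

end XuE6
end

/-! ### The module structure and its irreducibility -/

theorem corollary6p6 (k : ℕ) (hk : 0 < k) (M : Type*) [AddCommGroup M] [Module ℂ M]
    [LieRingModule XuE6.O10 M] [LieModule ℂ XuE6.O10 M]
    (hM : XuE6.IsV (Pi.single 0 (k : ℂ)) M)
    (c : ℂ) (hc : ∀ n : ℕ, c ≠ (n : ℂ) - 14 - (k : ℂ)) :
    ∃ _ : LieRingModule XuE6.E6 (XuE6.Hat M),
      LieModule ℂ XuE6.E6 (XuE6.Hat M) ∧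
      (∀ (u : XuE6.E6) (w : XuE6.Hat M), ⁅u, w⁆ = XuE6.act M c u w) ∧
      LieModule.IsIrreducible ℂ XuE6.E6 (XuE6.Hat M) := by
  obtain ⟨hfd, hirr, v, hv⟩ := hM
  letI := XuE6.hatLieRingModule M c
  refine ⟨XuE6.hatLieRingModule M c, ⟨fun r u w => ?_, fun r u w => ?_⟩, fun u w => ?_, ?_⟩
  · exact (congrArg (fun T => T w) (map_smul (XuE6.hatAct (XuE6.rho M c)) r u))
  · exact map_smul (XuE6.hatAct (XuE6.rho M c) u) r w
  · rw [XuE6.act_eq_hatAct]; rfl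
  · haveI : Nontrivial (XuE6.Hat M) := nontrivial_of_ne _ _ (XuE6.isHW_one_tmul hv c).ne_zero
    refine LieModule.IsIrreducible.mk fun N hN => ?_
    rw [← LieSubmodule.toSubmodule_eq_top]
    refine XuE6.eq_top_of_stable hv hc (fun x w hw => N.lie_mem (x := x) hw) ?_
    rwa [Ne, LieSubmodule.toSubmodule_eq_bot]
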